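/- Let $\Gamma=\mathrm{SL}_2(\mathbb Z)$, $T=\left(\begin{smallmatrix}1&1\\0&1\end{smallmatrix}\right)$, $B=\{\pm T^n: n\in\mathbb Z\}$, let $\mathfrak H$ be the upper half-plane with $z=x+iy$, $q=e^{2\pi i z}$, and $j(\gamma,w)=cw+d$ for $\gamma=\left(\begin{smallmatrix}*&*\\c&d\end{smallmatrix}\right)\in\Gamma$. For $r,s\in\mathbb Z$ let $\mathcal M_{r,s}$ be the space of real-analytic $f:\mathfrak H\to\mathbb C$ such that: (i) $f(z)=O(y^C)$ as $y\to\infty$, uniformly in $x$, for some $C>0$; (ii) $f(\gamma z)=j(\gamma,z)^r j(\gamma,\bar z)^s f(z)$ for all $\gamma\in\Gamma$, $z\in\mathfrak H$; (iii) $f(z)=\sum_{|j|\le N}y^j\sum_{m,n\ge0}a^{(j)}_{m,n}q^m\bar q^n$ for some $N\in\mathbb N$ and $a^{(j)}_{m,n}\in\mathbb C$, each inner double series converging absolutely on $\mathfrak H$. Put $\mathcal M=\bigoplus_{r,s\in\mathbb Z}\mathcal M_{r,s}$. Let $\partial$ and $\bar\partial$ be the bigraded operators which on functions of weights $(r,s)$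 are $$\partial_r=2iy\frac{\partial}{\partial z}+r\ \text{ (with values in weights } (r+1,s-1)),\qquad \bar\partial_s=-2iy\frac{\partial}{\partial\bar z}+s\ \text{ (with values in weights } (r-1,s+1)).$$ Let $S=\bigoplus_n S_n$ be the space of holomorphic cusp forms for $\Gamma$, $\bar S$ the space of their complex conjugates, and $\mathcal E_{r,s}(z)=\sum_{\gamma\in B\backslash\Gamma}j(\gamma,z)^{-r}j(\gamma,\bar z)^{-s}$. The space $\mathcal{MI}'_2$ of extended modular iterated integrals of length $2$ is the largest subspace of $\mathcal M$ satisfying $$\partial\,\mathcal{MI}'_2\subset\mathcal{MI}'_2+\bigoplus_{\substack{j\in\mathbb Z,\ r,s\ge1\\ r+s\ge4\text{ even}}}y^j\mathcal E_{r,s}S,\qquad \bar\partial\,\mathcal{MI}'_2\subset\mathcal{MI}'_2+\bigoplus_{\substack{j\in\mathbb Z,\ r,s\ge1\\ r+s\ge4\text{ even}}}y^j\mathcal E_{r,s}\bar S .$$ For an even integer $k\ge12$ and $f\in S_k$ put $$F_f^+(z,X)=\int_{i\infty}^z f(w)(w-X)^{k-2}\,dw,\qquad F_f^-(z,X)=\overline{\int_{i\infty}^z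 f(w)(w-X)^{k-2}\,dw},$$ where the bar acts trivially on $X$. For integers $r,s$ with $r+s$ even and $r+s>k$ put $$\phi^\pm_{r,s}(f;z,X)=\sum_{\gamma\in B\backslash\Gamma}\frac{F_f^\pm(\gamma z,\gamma X)\,j(\gamma,X)^{k-2}}{j(\gamma,z)^r j(\gamma,\bar z)^s}=\sum_{i=0}^{k-2}\phi^\pm_{r,s}(f;i,z)(X-z)^i(X-\bar z)^{k-2-i}.$$ **Theorem.** The series defining $\phi^\pm_{r,s}(f;z,X)$ converge absolutely (as series of polynomials in $X$, for each $z\in\mathfrak H$). Let $\mathcal A$ be the complex vector space spanned by all the functions $\phi^\pm_{r,s}(f;i,-)$, regarded as having weights $(r+i,\,s+k-2-i)$, for even $k\ge12$, $f\in S_k$, integers $r,s$ with $r+s$ even and $r+s>k$, and $0\le i\le k-2$. Then $\mathcal A\subset\mathcal{MI}'_2$. -/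

import Mathlib

open scoped MatrixGroups UpperHalfPlane ComplexConjugate
open UpperHalfPlane

noncomputable section

namespace ModIter

/-! ### Real-analytic modular forms for `Γ = SL(2, ℤ)` -/

/-- The automorphy factor `j(γ, w) = c w + d`, for an arbitrary complex number `w`
(it is used at `w = z` and at `w = conj z`). -/
def autj (γ : SL(2, ℤ)) (w : ℂ) : ℂ := (γ 1 0 : ℂ) * w + (γ 1 1 : ℂ)

/-- `q = exp (2 π i z)`. -/
def qpar (z : ℍ) : ℂ := Complex.exp (2 * Real.pi * Complex.I * (z : ℂ))

/-- Real-analyticity of a function on the upper half-plane, as a function on an open subset of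
`ℂ = ℝ²`. -/
def IsRealAnalytic (f : ℍ → ℂ) : Prop :=
  AnalyticOnNhd ℝ (fun w : ℂ => f (ofComplex w)) {w : ℂ | 0 < w.im}

/-- `f(z) = O(y ^ C)` as `y → ∞`, uniformly in `x`, for some `C > 0`. -/
def HasModerateGrowth (f : ℍ → ℂ) : Prop :=
  ∃ C : ℝ, 0 < C ∧ f =O[atImInfty] (fun z : ℍ => z.im ^ C)

/-- `f` has an expansion `∑_{|j| ≤ N} y ^ j ∑_{m, n ≥ 0} a_{m,n}^{(j)} q ^ m (conj q) ^ n` for some `N`;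
the finitely many `j` that occur are the support of the finitely supported family `a`, and each
inner double series converges absolutely at every point. -/
def HasFourierExpansion (f : ℍ → ℂ) : Prop :=
  ∃ a : ℤ →₀ (ℕ × ℕ → ℂ),
    (∀ (j : ℤ) (z : ℍ), Summable fun p : ℕ × ℕ => a j p * qpar z ^ p.1 * conj (qpar z) ^ p.2) ∧
    ∀ z : ℍ, f z = a.sum fun j c =>
      (z.im : ℂ) ^ j * ∑' p : ℕ × ℕ, c p * qpar z ^ p.1 * conj (qpar z) ^ p.2

/-- The space `𝓜_{r,s}` of real-analytic modular forms of weights `(r, s)`. -/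
def realAnForms (r s : ℤ) : Submodule ℂ (ℍ → ℂ) where
  carrier := {f | IsRealAnalytic f ∧ HasModerateGrowth f ∧
    (∀ (γ : SL(2, ℤ)) (z : ℍ), f (γ • z) = autj γ z ^ r * autj γ (conj (z : ℂ)) ^ s * f z) ∧
    HasFourierExpansion f}
  zero_mem' := by
    refine ⟨?_, ⟨1, one_pos, Asymptotics.isBigO_zero _ _⟩, by simp, 0, by simp [summable_zero],
      by simp⟩
    exact analyticOnNhd_const
  add_mem' := by
    rintro f g ⟨hf1, ⟨C, hC, hf2⟩, hf3, a, ha, hf4⟩ ⟨hg1, ⟨D, hD, hg2⟩, hg3, b, hb, hg4⟩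
    refine ⟨hf1.add hg1, ⟨max C D, lt_max_of_lt_left hC, ?_⟩, ?_, a + b, ?_, ?_⟩
    · have key : ∀ E : ℝ, E ≤ max C D →
          (fun z : ℍ => z.im ^ E) =O[atImInfty] (fun z : ℍ => z.im ^ (max C D)) := by
        intro E hE
        refine Asymptotics.IsBigO.of_bound 1 ?_
        have h1 : ∀ᶠ z : ℍ in atImInfty, 1 ≤ z.im :=
          Filter.tendsto_comap.eventually (Filter.eventually_ge_atTop (1 : ℝ))
        filter_upwards [h1] with z hz
        rw [one_mul, Real.norm_of_nonneg (by positivity), Real.norm_of_nonneg (by positivity)]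
        exact Real.rpow_le_rpow_of_exponent_le hz hE
      exact (hf2.trans (key C (le_max_left _ _))).add (hg2.trans (key D (le_max_right _ _)))
    · intro γ z
      simp only [Pi.add_apply, hf3 γ z, hg3 γ z]
      ring
    · intro j z
      refine ((ha j z).add (hb j z)).congr fun p => ?_
      simp only [Finsupp.add_apply, Pi.add_apply]
      ring
    · intro z
      have e : ∀ c : ℤ →₀ (ℕ × ℕ → ℂ), (c.sum fun j c =>
          (z.im : ℂ) ^ j * ∑' p : ℕ × ℕ, c p * qpar z ^ p.1 * conj (qpar z) ^ p.2) =
          ∑ j ∈ c.support, (z.im : ℂ) ^ j *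
            ∑' p : ℕ × ℕ, c j p * qpar z ^ p.1 * conj (qpar z) ^ p.2 := fun c => rfl
      have e2 : ∀ (c : ℤ →₀ (ℕ × ℕ → ℂ)) (s : Finset ℤ), c.support ⊆ s →
          (c.sum fun j c =>
          (z.im : ℂ) ^ j * ∑' p : ℕ × ℕ, c p * qpar z ^ p.1 * conj (qpar z) ^ p.2) =
          ∑ j ∈ s, (z.im : ℂ) ^ j *
            ∑' p : ℕ × ℕ, c j p * qpar z ^ p.1 * conj (qpar z) ^ p.2 := by
        intro c s hs
        rw [e]
        refine Finset.sum_subset hs fun j _ hj => ?_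
        rw [Finsupp.notMem_support_iff.1 hj]
        simp
      simp only [Pi.add_apply, hf4 z, hg4 z]
      rw [e2 a (a.support ∪ b.support) Finset.subset_union_left,
        e2 b (a.support ∪ b.support) Finset.subset_union_right,
        e2 (a + b) (a.support ∪ b.support) Finsupp.support_add, ← Finset.sum_add_distrib]
      refine Finset.sum_congr rfl fun j _ => ?_
      rw [← mul_add, ← (ha j z).tsum_add (hb j z)]
      congr 1
      refine tsum_congr fun p => ?_
      simp only [Finsupp.add_apply, Pi.add_apply]
      ring
  smul_mem' := by
    rintro c f ⟨hf1, ⟨C, hC, hf2⟩, hf3, a, ha, hf4⟩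
    refine ⟨analyticOnNhd_const.mul hf1, ⟨C, hC, hf2.const_mul_left c⟩, ?_, c • a, ?_, ?_⟩
    · intro γ z
      simp only [Pi.smul_apply, smul_eq_mul, hf3 γ z]
      ring
    · intro j z
      refine ((ha j z).mul_left c).congr fun p => ?_
      simp only [Finsupp.smul_apply, Pi.smul_apply, smul_eq_mul]
      ring
    · intro z
      simp only [Pi.smul_apply, smul_eq_mul, hf4 z]
      rw [Finsupp.sum_smul_index' (by simp), Finsupp.mul_sum]
      refine Finsupp.sum_congr fun j _ => ?_
      rw [mul_left_comm, ← tsum_mul_left]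
      congr 1
      refine tsum_congr fun p => ?_
      simp only [Pi.smul_apply, smul_eq_mul]
      ring

/-- Bigraded families of functions: finitely supported families indexed by weights `(r, s) ∈ ℤ²`. -/
abbrev GradedFun : Type := (ℤ × ℤ) →₀ (ℍ → ℂ)

/-- `𝓜 = ⨁_{r,s ∈ ℤ} 𝓜_{r,s}`, as the space of finitely supported families whose component of index
`(r, s)` lies in `𝓜_{r,s}`. -/
def gradedM : Submodule ℂ GradedFun where
  carrier := {F | ∀ p : ℤ × ℤ, F p ∈ realAnForms p.1 p.2}
  zero_mem' := fun _ => Submodule.zero_mem _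
  add_mem' := fun hF hG p => Submodule.add_mem _ (hF p) (hG p)
  smul_mem' := fun c _ hF p => Submodule.smul_mem _ c (hF p)

/-! ### The operators `∂` and `∂̄` -/

/-- `∂/∂z = (∂/∂x - i ∂/∂y) / 2`. -/
def dz (f : ℍ → ℂ) (z : ℍ) : ℂ :=
  (fderiv ℝ (fun w : ℂ => f (ofComplex w)) z 1
    - Complex.I * fderiv ℝ (fun w : ℂ => f (ofComplex w)) z Complex.I) / 2

/-- `∂/∂z̄ = (∂/∂x + i ∂/∂y) / 2`. -/
def dzbar (f : ℍ → ℂ) (z : ℍ) : ℂ :=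
  (fderiv ℝ (fun w : ℂ => f (ofComplex w)) z 1
    + Complex.I * fderiv ℝ (fun w : ℂ => f (ofComplex w)) z Complex.I) / 2

/-- `∂_r = 2 i y ∂/∂z + r`. -/
def maass (r : ℤ) (f : ℍ → ℂ) : ℍ → ℂ := fun z =>
  2 * Complex.I * (z.im : ℂ) * dz f z + (r : ℂ) * f z

/-- `∂̄_s = -2 i y ∂/∂z̄ + s`. -/
def maassBar (s : ℤ) (f : ℍ → ℂ) : ℍ → ℂ := fun z =>
  -2 * Complex.I * (z.im : ℂ) * dzbar f z + (s : ℂ) * f z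

/-- The bigraded operator `∂`, equal to `∂_r` from index `(r, s)` to index `(r + 1, s - 1)`. -/
def del (F : GradedFun) : GradedFun :=
  F.sum fun p f => Finsupp.single (p.1 + 1, p.2 - 1) (maass p.1 f)

/-- The bigraded operator `∂̄`, equal to `∂̄_s` from index `(r, s)` to index `(r - 1, s + 1)`. -/
def delBar (F : GradedFun) : GradedFun :=
  F.sum fun p f => Finsupp.single (p.1 - 1, p.2 + 1) (maassBar p.2 f)

/-! ### Eisenstein series and the space of extended modular iterated integrals of length two -/

/-- `B = {± T ^ n : n ∈ ℤ}`. -/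
def subgroupB : Subgroup SL(2, ℤ) where
  carrier := {γ | ∃ n : ℤ, γ = ModularGroup.T ^ n ∨ γ = -ModularGroup.T ^ n}
  one_mem' := ⟨0, by simp⟩
  mul_mem' := by
    rintro _ _ ⟨n, rfl | rfl⟩ ⟨m, rfl | rfl⟩ <;> refine ⟨n + m, ?_⟩ <;> simp [zpow_add]
  inv_mem' := by
    rintro _ ⟨n, rfl | rfl⟩
    · exact ⟨-n, Or.inl (by simp)⟩
    · refine ⟨-n, Or.inr ?_⟩
      rw [inv_eq_iff_mul_eq_one, neg_mul_neg, ← zpow_add]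
      simp

/-- The set `B \ Γ` of cosets `B γ`. Sums over `B \ Γ` below use a chosen representative
`γ.out` of each coset; the summands do not depend on that choice. -/
abbrev CosetB : Type := Quotient (QuotientGroup.rightRel subgroupB)

/-- `𝓔_{r,s}(z) = ∑_{γ ∈ B \ Γ} j(γ, z)^{-r} j(γ, z̄)^{-s}`. -/
def eisen (r s : ℤ) (z : ℍ) : ℂ :=
  ∑' γ : CosetB, autj γ.out z ^ (-r) * autj γ.out (conj (z : ℂ)) ^ (-s)

/-- `⨁ y ^ j 𝓔_{r,s} S`, over `j ∈ ℤ`, `r, s ≥ 1`, `r + s ≥ 4` even, where `S = ⨁_n S_n` is the space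
of holomorphic cusp forms. For `g ∈ S_n` the function `y ^ j 𝓔_{r,s} g` has weights
`(r + n - j, s - j)`. -/
def eisenCusp : Submodule ℂ GradedFun :=
  Submodule.span ℂ {G | ∃ j r s n : ℤ, 1 ≤ r ∧ 1 ≤ s ∧ 4 ≤ r + s ∧ Even (r + s) ∧
    ∃ g : CuspForm 𝒮ℒ n, G = Finsupp.single (r + n - j, s - j)
      (fun z : ℍ => (z.im : ℂ) ^ j * eisen r s z * g z)}

/-- `⨁ y ^ j 𝓔_{r,s} S̄`, with `S̄` the space of complex conjugates of elements of `S`. -/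
def eisenCuspBar : Submodule ℂ GradedFun :=
  Submodule.span ℂ {G | ∃ j r s n : ℤ, 1 ≤ r ∧ 1 ≤ s ∧ 4 ≤ r + s ∧ Even (r + s) ∧
    ∃ g : CuspForm 𝒮ℒ n, G = Finsupp.single (r - j, s + n - j)
      (fun z : ℍ => (z.im : ℂ) ^ j * eisen r s z * conj (g z))}

/-- The subspaces `N` of `𝓜` with `∂ N ⊆ N + ⨁ y ^ j 𝓔_{r,s} S` and `∂̄ N ⊆ N + ⨁ y ^ j 𝓔_{r,s} S̄`. -/
def admissible : Set (Submodule ℂ GradedFun) :=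
  {N | N ≤ gradedM ∧
    (∀ F ∈ N, del F ∈ N ⊔ eisenCusp) ∧ (∀ F ∈ N, delBar F ∈ N ⊔ eisenCuspBar)}

/-- The space `MI'₂` of extended modular iterated integrals of length two: the largest subspace of
`𝓜` satisfying the two inclusions (see `isGreatest_extMI`). -/
def extMI : Submodule ℂ GradedFun := sSup admissible

lemma differentiableAt_of_mem {r s : ℤ} {f : ℍ → ℂ} (hf : f ∈ realAnForms r s) (z : ℍ) :
    DifferentiableAt ℝ (fun w : ℂ => f (ofComplex w)) z :=
  (hf.1 z z.im_pos).differentiableAt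

lemma maass_add {r s a : ℤ} {f g : ℍ → ℂ} (hf : f ∈ realAnForms r s) (hg : g ∈ realAnForms r s) :
    maass a (f + g) = maass a f + maass a g := by
  funext z
  have h := fderiv_fun_add (differentiableAt_of_mem hf z) (differentiableAt_of_mem hg z)
  simp only [maass, dz, Pi.add_apply, h, add_apply]
  ring

lemma maassBar_add {r s a : ℤ} {f g : ℍ → ℂ} (hf : f ∈ realAnForms r s)
    (hg : g ∈ realAnForms r s) : maassBar a (f + g) = maassBar a f + maassBar a g := by
  funext z
  have h := fderiv_fun_add (differentiableAt_of_mem hf z) (differentiableAt_of_mem hg z)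
  simp only [maassBar, dzbar, Pi.add_apply, h, add_apply]
  ring

lemma maass_zero (a : ℤ) : maass a 0 = 0 := by
  funext z
  simp [maass, dz]

lemma maassBar_zero (a : ℤ) : maassBar a 0 = 0 := by
  funext z
  simp [maassBar, dzbar]

lemma del_apply (F : GradedFun) (p : ℤ × ℤ) :
    del F p = maass (p.1 - 1) (F (p.1 - 1, p.2 + 1)) := by
  classical
  rw [del, Finsupp.sum_apply, Finsupp.sum, Finset.sum_eq_single (p.1 - 1, p.2 + 1)]
  · simp
  · rintro ⟨a, b⟩ _ hb
    refine Finsupp.single_eq_of_ne ?_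
    rintro rfl
    exact hb (by simp)
  · intro h
    rw [Finsupp.notMem_support_iff.1 h, maass_zero]
    simp

lemma delBar_apply (F : GradedFun) (p : ℤ × ℤ) :
    delBar F p = maassBar (p.2 - 1) (F (p.1 + 1, p.2 - 1)) := by
  classical
  rw [delBar, Finsupp.sum_apply, Finsupp.sum, Finset.sum_eq_single (p.1 + 1, p.2 - 1)]
  · simp
  · rintro ⟨a, b⟩ _ hb
    refine Finsupp.single_eq_of_ne ?_
    rintro rfl
    exact hb (by simp)
  · intro h
    rw [Finsupp.notMem_support_iff.1 h, maassBar_zero]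
    simp

lemma del_add {F G : GradedFun} (hF : F ∈ gradedM) (hG : G ∈ gradedM) :
    del (F + G) = del F + del G := by
  refine Finsupp.ext fun p => ?_
  rw [Finsupp.add_apply]
  simp only [del_apply, Finsupp.add_apply]
  exact maass_add (hF (p.1 - 1, p.2 + 1)) (hG (p.1 - 1, p.2 + 1))

lemma delBar_add {F G : GradedFun} (hF : F ∈ gradedM) (hG : G ∈ gradedM) :
    delBar (F + G) = delBar F + delBar G := by
  refine Finsupp.ext fun p => ?_
  rw [Finsupp.add_apply]
  simp only [delBar_apply, Finsupp.add_apply]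
  exact maassBar_add (hF (p.1 + 1, p.2 - 1)) (hG (p.1 + 1, p.2 - 1))

/-- `MI'₂` is itself admissible, hence it is the largest admissible subspace. -/
theorem isGreatest_extMI : IsGreatest admissible extMI := by
  have hle : extMI ≤ gradedM := sSup_le fun N hN => hN.1
  refine ⟨⟨hle, ?_, ?_⟩, fun N hN => le_sSup hN⟩
  · intro F hF
    have hF' := hF
    rw [extMI, sSup_eq_iSup'] at hF'
    refine Submodule.iSup_induction (motive := fun F => F ∈ extMI ∧ del F ∈ extMI ⊔ eisenCusp) _
      hF' ?_ ?_ ?_ |>.2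
    · intro N G hG
      exact ⟨le_sSup N.2 hG, sup_le_sup_right (le_sSup N.2) _ (N.2.2.1 G hG)⟩
    · refine ⟨zero_mem _, ?_⟩
      have : del 0 = 0 := by simp [del]
      rw [this]
      exact zero_mem _
    · rintro G H ⟨hG, hG'⟩ ⟨hH, hH'⟩
      refine ⟨add_mem hG hH, ?_⟩
      rw [del_add (hle hG) (hle hH)]
      exact add_mem hG' hH'
  · intro F hF
    have hF' := hF
    rw [extMI, sSup_eq_iSup'] at hF'
    refine Submodule.iSup_induction
      (motive := fun F => F ∈ extMI ∧ delBar F ∈ extMI ⊔ eisenCuspBar) _ hF' ?_ ?_ ?_ |>.2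
    · intro N G hG
      exact ⟨le_sSup N.2 hG, sup_le_sup_right (le_sSup N.2) _ (N.2.2.2 G hG)⟩
    · refine ⟨zero_mem _, ?_⟩
      have : delBar 0 = 0 := by simp [delBar]
      rw [this]
      exact zero_mem _
    · rintro G H ⟨hG, hG'⟩ ⟨hH, hH'⟩
      refine ⟨add_mem hG hH, ?_⟩
      rw [delBar_add (hle hG) (hle hH)]
      exact add_mem hG' hH'

/-! ### Eichler integrals, the series `φ^±_{r,s}` and their coefficient functions -/

/-- `∫_{i∞}^z g(w) dw`, along the vertical half-line `w = z + i t`, with `t` running from `∞` to `0`. -/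
def integralFromCusp (g : ℂ → ℂ) (z : ℍ) : ℂ :=
  -Complex.I * ∫ t in Set.Ioi (0 : ℝ), g ((z : ℂ) + Complex.I * (t : ℂ))

/-- `F_f^+(z, X) = ∫_{i∞}^z f(w) (w - X)^{k-2} dw`, as a polynomial in `X`: the integral of a
polynomial-valued function is taken coefficient by coefficient. -/
def eichlerPlus {k : ℕ} (f : CuspForm 𝒮ℒ (k : ℤ)) (z : ℍ) : Polynomial ℂ :=
  ∑ m ∈ Finset.range (k - 1), Polynomial.monomial m (integralFromCusp (fun w : ℂ =>
    f (ofComplex w) * ((Polynomial.C w - Polynomial.X) ^ (k - 2)).coeff m) z)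

/-- `F_f^-(z, X)`, the complex conjugate of `F_f^+(z, X)`, with conjugation acting trivially on `X`. -/
def eichlerMinus {k : ℕ} (f : CuspForm 𝒮ℒ (k : ℤ)) (z : ℍ) : Polynomial ℂ :=
  (eichlerPlus f z).map (starRingEnd ℂ)

/-- For `P` of degree at most `n`, the polynomial `(c X + d) ^ n P((a X + b) / (c X + d))`. -/
def homSubst (n : ℕ) (a b c d : ℂ) (P : Polynomial ℂ) : Polynomial ℂ :=
  ∑ m ∈ Finset.range (n + 1), Polynomial.C (P.coeff m) *
    (Polynomial.C a * Polynomial.X + Polynomial.C b) ^ m *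
    (Polynomial.C c * Polynomial.X + Polynomial.C d) ^ (n - m)

/-- The action `(F |_{r,s,2-k} γ)(z, X) = F(γ z, γ X) j(γ, z)^{-r} j(γ, z̄)^{-s} j(γ, X)^{k-2}` on
functions with values in polynomials of degree at most `k - 2` in `X`. -/
def slash (k : ℕ) (r s : ℤ) (F : ℍ → Polynomial ℂ) (γ : SL(2, ℤ)) (z : ℍ) : Polynomial ℂ :=
  Polynomial.C (autj γ z ^ (-r) * autj γ (conj (z : ℂ)) ^ (-s)) *
    homSubst (k - 2) (γ 0 0) (γ 0 1) (γ 1 0) (γ 1 1) (F (γ • z))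

/-- `∑_{γ ∈ B \ Γ} F |_{r,s,2-k} γ`, summed coefficient by coefficient in `X`. For `F = F_f^±` this is
`φ^±_{r,s}(f; z, X)`. -/
def phi (k : ℕ) (r s : ℤ) (F : ℍ → Polynomial ℂ) (z : ℍ) : Polynomial ℂ :=
  ∑ m ∈ Finset.range (k - 1),
    Polynomial.monomial m (∑' γ : CosetB, (slash k r s F γ.out z).coeff m)

/-- The coefficient of `(X - z) ^ i (X - z̄) ^ {n-i}` in the expansion of a polynomial `P` of degree at
most `n` with respect to these `n + 1` polynomials (see `expCoeff_expansion` and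
`expCoeff_unique`). It is found by the substitution `u = (X - z) / (X - z̄)`. -/
def expCoeff (n : ℕ) (P : Polynomial ℂ) (i : ℕ) (z : ℍ) : ℂ :=
  ((z : ℂ) - conj (z : ℂ)) ^ (-(n : ℤ)) * (homSubst n (-conj (z : ℂ)) z (-1) 1 P).coeff i

/-- The coefficient function `φ^±_{r,s}(f; i, z)` (for `F = F_f^±`). -/
def phiCoeff (k : ℕ) (r s : ℤ) (F : ℍ → Polynomial ℂ) (i : ℕ) (z : ℍ) : ℂ :=
  expCoeff (k - 2) (phi k r s F z) i z

lemma homSubst_eval (n : ℕ) (a b c d u : ℂ) {P : Polynomial ℂ} (hP : P.natDegree ≤ n)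
    (h : c * u + d ≠ 0) :
    (homSubst n a b c d P).eval u = (c * u + d) ^ n * P.eval ((a * u + b) / (c * u + d)) := by
  rw [homSubst, Polynomial.eval_finsetSum,
    Polynomial.eval_eq_sum_range' (Nat.lt_succ_of_le hP), Finset.mul_sum]
  refine Finset.sum_congr rfl fun m hm => ?_
  have hm' : m ≤ n := Nat.lt_succ_iff.1 (Finset.mem_range.1 hm)
  obtain ⟨l, rfl⟩ := Nat.exists_eq_add_of_le hm'
  simp only [Polynomial.eval_mul, Polynomial.eval_pow, Polynomial.eval_add, Polynomial.eval_C,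
    Polynomial.eval_X, Nat.add_sub_cancel_left]
  generalize c * u + d = e at h ⊢
  rw [div_pow, pow_add]
  field_simp

lemma homSubst_natDegree (n : ℕ) (a b c d : ℂ) (P : Polynomial ℂ) :
    (homSubst n a b c d P).natDegree ≤ n := by
  refine Polynomial.natDegree_sum_le_of_forall_le _ _ fun m hm => ?_
  have hm' : m ≤ n := Nat.lt_succ_iff.1 (Finset.mem_range.1 hm)
  have h1 : ∀ (x y : ℂ) (e : ℕ),
      ((Polynomial.C x * Polynomial.X + Polynomial.C y) ^ e).natDegree ≤ e := fun x y e =>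
    (Polynomial.natDegree_pow_le_of_le e (Polynomial.natDegree_linear_le)).trans (by simp)
  calc _ ≤ (0 + m) + (n - m) := Polynomial.natDegree_mul_le_of_le
        (Polynomial.natDegree_mul_le_of_le (by simp) (h1 _ _ _)) (h1 _ _ _)
    _ = n := by omega

lemma z_sub_conj_ne (z : ℍ) : (z : ℂ) - conj (z : ℂ) ≠ 0 := by
  intro h
  have := congrArg Complex.im h
  simp at this
  exact z.im_pos.ne' this

/-- Existence of the expansion that defines the coefficient functions. -/
theorem expCoeff_expansion (n : ℕ) {P : Polynomial ℂ} (hP : P.natDegree ≤ n) (z : ℍ) :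
    P = ∑ i ∈ Finset.range (n + 1), Polynomial.C (expCoeff n P i z) *
      (Polynomial.X - Polynomial.C (z : ℂ)) ^ i *
      (Polynomial.X - Polynomial.C (conj (z : ℂ))) ^ (n - i) := by
  refine Polynomial.eq_of_infinite_eval_eq _ _
    (Set.Infinite.mono ?_ (Set.finite_singleton (conj (z : ℂ))).infinite_compl)
  intro x hx
  have hx' : x - conj (z : ℂ) ≠ 0 := sub_ne_zero.2 hx
  have hz := z_sub_conj_ne z
  set Z : ℂ := (z : ℂ) with hZ
  set u : ℂ := (x - Z) / (x - conj Z) with hu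
  have h1 : -1 * u + 1 = (Z - conj Z) / (x - conj Z) := by
    rw [hu]; field_simp; ring
  have h1' : -1 * u + 1 ≠ 0 := by rw [h1]; exact div_ne_zero hz hx'
  have h2 : (-conj Z * u + Z) / (-1 * u + 1) = x := by
    rw [h1, hu]; field_simp; ring
  have h3 := homSubst_eval n (-conj Z) Z (-1) 1 u hP h1'
  rw [h2, h1, Polynomial.eval_eq_sum_range'
    (Nat.lt_succ_of_le (homSubst_natDegree n (-conj Z) Z (-1) 1 P))] at h3
  have h4 : P.eval x = (x - conj Z) ^ n * (Z - conj Z) ^ (-(n : ℤ)) *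
      ∑ i ∈ Finset.range (n + 1), (homSubst n (-conj Z) Z (-1) 1 P).coeff i * u ^ i := by
    rw [h3, zpow_neg, zpow_natCast, div_pow]
    field_simp
  show P.eval x = _
  rw [h4, Polynomial.eval_finsetSum, Finset.mul_sum]
  refine Finset.sum_congr rfl fun i hi => ?_
  have hi' : i ≤ n := Nat.lt_succ_iff.1 (Finset.mem_range.1 hi)
  obtain ⟨l, rfl⟩ := Nat.exists_eq_add_of_le hi'
  simp only [Polynomial.eval_mul, Polynomial.eval_pow, Polynomial.eval_sub, Polynomial.eval_C,
    Polynomial.eval_X, expCoeff, hu, div_pow, Nat.add_sub_cancel_left, ← hZ]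
  rw [pow_add]
  field_simp

/-- Uniqueness of the expansion that defines the coefficient functions. -/
theorem expCoeff_unique (n : ℕ) {P : Polynomial ℂ} (z : ℍ) (c : ℕ → ℂ)
    (h : P = ∑ i ∈ Finset.range (n + 1), Polynomial.C (c i) *
      (Polynomial.X - Polynomial.C (z : ℂ)) ^ i *
      (Polynomial.X - Polynomial.C (conj (z : ℂ))) ^ (n - i)) {i : ℕ} (hi : i ≤ n) :
    c i = expCoeff n P i z := by
  have hz := z_sub_conj_ne z
  have hP : P.natDegree ≤ n := by
    rw [h]
    refine Polynomial.natDegree_sum_le_of_forall_le _ _ fun m hm => ?_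
    have hm' : m ≤ n := Nat.lt_succ_iff.1 (Finset.mem_range.1 hm)
    have h1 : ∀ (x : ℂ) (e : ℕ),
        ((Polynomial.X - Polynomial.C x) ^ e).natDegree ≤ e := fun x e =>
      (Polynomial.natDegree_pow_le_of_le e (Polynomial.natDegree_X_sub_C_le x)).trans (by simp)
    calc _ ≤ (0 + m) + (n - m) := Polynomial.natDegree_mul_le_of_le
          (Polynomial.natDegree_mul_le_of_le (by simp) (h1 _ _)) (h1 _ _)
      _ = n := by omega
  set Z : ℂ := (z : ℂ) with hZ
  have key : homSubst n (-conj Z) Z (-1) 1 P =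
      ∑ i ∈ Finset.range (n + 1), Polynomial.C ((Z - conj Z) ^ n * c i) * Polynomial.X ^ i := by
    refine Polynomial.eq_of_infinite_eval_eq _ _
      (Set.Infinite.mono ?_ (Set.finite_singleton (1 : ℂ)).infinite_compl)
    intro u hu
    have hu' : -1 * u + 1 ≠ 0 := by
      intro h0
      exact hu (by rw [Set.mem_singleton_iff]; linear_combination -h0)
    have a1 : (-conj Z * u + Z) / (-1 * u + 1) - Z = (Z - conj Z) * u / (-1 * u + 1) := by
      rw [eq_div_iff hu', sub_mul, div_mul_cancel₀ _ hu']; ring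
    have a2 : (-conj Z * u + Z) / (-1 * u + 1) - conj Z = (Z - conj Z) / (-1 * u + 1) := by
      rw [eq_div_iff hu', sub_mul, div_mul_cancel₀ _ hu']; ring
    show Polynomial.eval _ _ = Polynomial.eval _ _
    rw [homSubst_eval n _ _ _ _ u hP hu', h, Polynomial.eval_finsetSum,
      Polynomial.eval_finsetSum, Finset.mul_sum]
    refine Finset.sum_congr rfl fun i hi => ?_
    have hi' : i ≤ n := Nat.lt_succ_iff.1 (Finset.mem_range.1 hi)
    obtain ⟨l, rfl⟩ := Nat.exists_eq_add_of_le hi'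
    simp only [Polynomial.eval_mul, Polynomial.eval_pow, Polynomial.eval_sub, Polynomial.eval_C,
      Polynomial.eval_X, a1, a2, Nat.add_sub_cancel_left]
    generalize -1 * u + 1 = e at hu' ⊢
    rw [div_pow, div_pow, mul_pow, pow_add, pow_add]
    field_simp
  rw [expCoeff, key, Polynomial.finsetSum_coeff, Finset.sum_eq_single i]
  · rw [Polynomial.coeff_C_mul, Polynomial.coeff_X_pow, if_pos rfl, mul_one, ← mul_assoc,
      zpow_neg, zpow_natCast, inv_mul_cancel₀ (pow_ne_zero _ hz), one_mul]
  · intro b _ hb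
    rw [Polynomial.coeff_C_mul, Polynomial.coeff_X_pow, if_neg (Ne.symm hb), mul_zero]
  · intro h'
    exact absurd (Finset.mem_range.2 (Nat.lt_succ_of_le hi)) h'

/-- The space `𝓐` spanned by all `φ^±_{r,s}(f; i, -)`, placed in weights `(r + i, s + k - 2 - i)`, for
`f ∈ S_k` with `k ≥ 12` even, integers `r, s` with `r + s` even and `r + s > k`, and
`0 ≤ i ≤ k - 2`. -/
def spaceA : Submodule ℂ GradedFun :=
  Submodule.span ℂ {G | ∃ k : ℕ, 12 ≤ k ∧ Even k ∧ ∃ (f : CuspForm 𝒮ℒ (k : ℤ)) (r s : ℤ),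
    Even (r + s) ∧ (k : ℤ) < r + s ∧ ∃ i : ℕ, i ≤ k - 2 ∧
      ∃ F : ℍ → Polynomial ℂ, (F = eichlerPlus f ∨ F = eichlerMinus f) ∧
        G = Finsupp.single (r + i, s + k - 2 - i) (phiCoeff k r s F i)}

end ModIter

end

/-! A subspace of `gradedM` stable under both operators is already admissible, with no Eisenstein
contribution. The space `gradedMixed` of modular functions that are finite sums of `y ^ j A(q) conj
(B(q))`, with `A` and `B` holomorphic on the unit disc, is such a subspace
(`gradedMixed_admissible`). So it suffices to show that every coefficient function of `φ^±` is
modular of the stated weights and has such a mixed expansion. Complex conjugation reduces `φ^-` to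
`φ^+`.

Put `n = k - 2` and let `seed f i` be the coefficient of `(X - z) ^ i (X - z̄) ^ (n - i)` in the
Eichler integral. In this basis the slash action is diagonal (`slash_eq_sum`), so each coefficient
of `φ^+` is the Poincaré series of `seed f i` of weights `(r + i, s + n - i)`. Explicit integration
shows that the seed has a mixed expansion and is `O(y ^ (-n - 1/2))` (`exists_seed_bound`). As `r +
s ≥ n + 4`, this gives absolute convergence, and modularity follows by permuting the cosets.

The expansion of the Poincaré series comes from the cocycle property: slashing the Eichler integral
by `γ` changes it by a polynomial that does not depend on `z` (`periodPoly_eq`). Evaluated at the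
point `(-d + i) / c`, this polynomial becomes `∑ κ_m(c, d) (c X + d) ^ m`, where `κ_m(c, d)` depends
only on `d` modulo `c` and is `O(c)`. The Poincaré series is thereby the seed, plus the seed times a
sum over coprime pairs, plus powers of `y` times sums `∑ κ_m(c, d) (c z + d) ^ (-r') (c z̄ + d) ^
(-s')` with `r' + s' ≥ 4` (`poincareTerm_rowLift`).

Writing `d = l c + d₀` turns each pair sum into a weighted average, over translates by `d₀ / c`, of
the two-weight Lipschitz sum `∑_l (z + l) ^ (-r') (z̄ + l) ^ (-s')` (`pairSum_mem`). That sum is a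
finite combination of `y ^ j A(q)` and `y ^ j conj (A(q))` (`lipSum_mem`), a form that survives
averaging. -/

noncomputable section

namespace ModIter

open Metric Filter Topology Asymptotics MeasureTheory

/-! ### Wirtinger derivatives -/

/-- `g` has Wirtinger derivatives `∂g/∂z = a` and `∂g/∂z̄ = b` at `w`. -/
def HasWirt (g : ℂ → ℂ) (w a b : ℂ) : Prop :=
  HasFDerivAt g (a • ContinuousLinearMap.id ℝ ℂ + b • (Complex.conjCLE : ℂ →L[ℝ] ℂ)) w

lemma hasWirt_iff {g : ℂ → ℂ} {w a b : ℂ} {L : ℂ →L[ℝ] ℂ} (h : HasFDerivAt g L w)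
    (hL : ∀ v, L v = a * v + b * conj v) : HasWirt g w a b := by
  have : L = a • ContinuousLinearMap.id ℝ ℂ + b • (Complex.conjCLE : ℂ →L[ℝ] ℂ) := by
    ext v
    simp [hL]
  rw [this] at h
  exact h

lemma DifferentiableAt.hasWirt {f : ℍ → ℂ} {z : ℍ}
    (h : DifferentiableAt ℝ (fun w : ℂ => f (ofComplex w)) z) :
    HasWirt (fun w : ℂ => f (ofComplex w)) z (dz f z) (dzbar f z) := by
  refine hasWirt_iff h.hasFDerivAt fun v => ?_
  have : v = v.re • (1 : ℂ) + v.im • Complex.I := by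
    simp [Complex.re_add_im]
  conv_lhs => rw [this, map_add, map_smul, map_smul]
  have hv : v = v.re + v.im * Complex.I := (Complex.re_add_im v).symm
  have hv' : conj v = v.re - v.im * Complex.I := by
    apply Complex.ext <;> simp
  rw [hv']
  conv_rhs => rw [hv]
  simp only [dz, dzbar, Complex.real_smul, Complex.add_re, Complex.add_im, Complex.ofReal_re,
    Complex.ofReal_im, Complex.mul_re, Complex.mul_im, Complex.I_re, Complex.I_im]
  ring_nf
  simp only [Complex.I_sq]
  ring

lemma HasWirt.dz_eq {f : ℍ → ℂ} {z : ℍ} {a b : ℂ}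
    (h : HasWirt (fun w : ℂ => f (ofComplex w)) z a b) : dz f z = a := by
  simp only [dz, HasFDerivAt.fderiv h]
  simp
  ring_nf
  simp
  ring

lemma HasWirt.unique_fst {g : ℂ → ℂ} {w a b a' b' : ℂ} (h : HasWirt g w a b)
    (h' : HasWirt g w a' b') : a = a' := by
  have e := HasFDerivAt.unique h h'
  have h1 := DFunLike.congr_fun e 1
  have h2 := DFunLike.congr_fun e Complex.I
  simp at h1 h2
  linear_combination h1 / 2 - Complex.I / 2 * h2 + (a - b - a' + b') / 2 * Complex.I_sq

lemma HasWirt.mul {f g : ℂ → ℂ} {w a b c d : ℂ} (hf : HasWirt f w a b) (hg : HasWirt g w c d) :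
    HasWirt (fun w => f w * g w) w (a * g w + f w * c) (b * g w + f w * d) := by
  refine hasWirt_iff (HasFDerivAt.mul hf hg) fun v => ?_
  simp
  ring

lemma HasWirt.comp {f g : ℂ → ℂ} {w a b c : ℂ} (hf : HasDerivAt f c (g w)) (hg : HasWirt g w a b) :
    HasWirt (fun w => f (g w)) w (c * a) (c * b) := by
  refine hasWirt_iff ((hf.hasFDerivAt.restrictScalars ℝ).comp w hg) fun v => ?_
  simp
  ring

lemma HasWirt.comp_hasDerivAt {f g : ℂ → ℂ} {w a b c : ℂ} (hf : HasWirt f (g w) a b)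
    (hg : HasDerivAt g c w) : HasWirt (fun w => f (g w)) w (a * c) (b * conj c) := by
  refine hasWirt_iff (HasFDerivAt.comp w hf (hg.hasFDerivAt.restrictScalars ℝ)) fun v => ?_
  simp
  ring

lemma HasDerivAt.hasWirt {f : ℂ → ℂ} {w c : ℂ} (hf : HasDerivAt f c w) : HasWirt f w c 0 := by
  refine hasWirt_iff (hf.hasFDerivAt.restrictScalars ℝ) fun v => ?_
  simp
  ring

lemma HasWirt.conj {f : ℂ → ℂ} {w a b : ℂ} (hf : HasWirt f w a b) :
    HasWirt (fun w => conj (f w)) w (conj b) (conj a) := by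
  refine hasWirt_iff ((Complex.conjCLE : ℂ →L[ℝ] ℂ).hasFDerivAt.comp w hf) fun v => ?_
  simp
  ring

lemma hasWirt_im (w : ℂ) :
    HasWirt (fun w => (w.im : ℂ)) w (-Complex.I / 2) (Complex.I / 2) := by
  refine hasWirt_iff ((Complex.ofRealCLM.comp Complex.imCLM).hasFDerivAt) fun v => ?_
  have hv : (starRingEnd ℂ) v = v - 2 * v.im * Complex.I := by
    apply Complex.ext <;> simp
    ring
  rw [hv]
  simp
  linear_combination v.im * Complex.I_sq

lemma HasWirt.congr {f g : ℂ → ℂ} {w a b : ℂ} (h : HasWirt f w a b) (e : g =ᶠ[𝓝 w] f) :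
    HasWirt g w a b :=
  HasFDerivAt.congr_of_eventuallyEq h e

lemma eventually_im_pos (z : ℍ) : ∀ᶠ w : ℂ in 𝓝 (z : ℂ), 0 < w.im :=
  (isOpen_lt continuous_const Complex.continuous_im).mem_nhds z.im_pos

/-! ### Finite sums of `y ^ j A(q) conj (B(q))` -/

lemma norm_qpar (z : ℍ) : ‖qpar z‖ = Real.exp (-(2 * Real.pi * z.im)) := by
  rw [qpar, Complex.norm_exp]
  congr 1
  simp

lemma norm_qpar_lt_one (z : ℍ) : ‖qpar z‖ < 1 := by
  rw [norm_qpar, Real.exp_lt_one_iff]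
  have := z.im_pos
  have := Real.pi_pos
  simp
  positivity

lemma qpar_mem_ball (z : ℍ) : qpar z ∈ ball (0 : ℂ) 1 := by
  simpa using norm_qpar_lt_one z

/-- Holomorphic functions on the open unit disc. -/
def DiscHol (A : ℂ → ℂ) : Prop := DifferentiableOn ℂ A (ball 0 1)

lemma DiscHol.analyticAt {A : ℂ → ℂ} (hA : DiscHol A) (z : ℍ) : AnalyticAt ℂ A (qpar z) :=
  DifferentiableOn.analyticAt hA (isOpen_ball.mem_nhds (qpar_mem_ball z))

lemma DiscHol.exists_series {A : ℂ → ℂ} (hA : DiscHol A) :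
    ∃ c : ℕ → ℂ, ∀ q : ℂ, ‖q‖ < 1 → Summable (fun n => ‖c n * q ^ n‖) ∧
      A q = ∑' n, c n * q ^ n := by
  refine ⟨fun n => (n.factorial : ℂ)⁻¹ * iteratedDeriv n A 0, fun q hq => ?_⟩
  have h := Complex.hasSum_taylorSeries_on_ball hA (z := q) (by simpa using hq)
  simp only [sub_zero, smul_eq_mul] at h
  have e : ∀ n : ℕ, (n.factorial : ℂ)⁻¹ * (q ^ n * iteratedDeriv n A 0) =
    (n.factorial : ℂ)⁻¹ * iteratedDeriv n A 0 * q ^ n := fun n => by ring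
  simp only [e] at h
  exact ⟨h.summable.norm, h.tsum_eq.symm⟩

/-- The functions that are finite sums of `y ^ j A(q) conj (B(q))`, with `A` and `B` holomorphic on
the unit disc. -/
def mixed : Submodule ℂ (ℍ → ℂ) :=
  Submodule.span ℂ {f | ∃ (j : ℤ) (A B : ℂ → ℂ), DiscHol A ∧ DiscHol B ∧
    f = fun z : ℍ => (z.im : ℂ) ^ j * A (qpar z) * conj (B (qpar z))}

lemma mixed_gen (j : ℤ) {A B : ℂ → ℂ} (hA : DiscHol A) (hB : DiscHol B) :
    (fun z : ℍ => (z.im : ℂ) ^ j * A (qpar z) * conj (B (qpar z))) ∈ mixed :=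
  Submodule.subset_span ⟨j, A, B, hA, hB, rfl⟩

lemma discHol_const (c : ℂ) : DiscHol fun _ => c := differentiableOn_const c

lemma im_ne_zero (z : ℍ) : (z.im : ℂ) ≠ 0 := by exact_mod_cast z.im_pos.ne'

lemma mixed_zpow (j : ℤ) : (fun z : ℍ => (z.im : ℂ) ^ j) ∈ mixed := by
  simpa using mixed_gen j (discHol_const 1) (discHol_const 1)

lemma mixed_const (c : ℂ) : (fun _ : ℍ => c) ∈ mixed := by
  simpa using mixed_gen 0 (discHol_const c) (discHol_const 1)

lemma mixed_hol {A : ℂ → ℂ} (hA : DiscHol A) : (fun z : ℍ => A (qpar z)) ∈ mixed := by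
  simpa using mixed_gen 0 hA (discHol_const 1)

lemma mixed_mul {f g : ℍ → ℂ} (hf : f ∈ mixed) (hg : g ∈ mixed) :
    (fun z => f z * g z) ∈ mixed := by
  induction hf, hg using Submodule.span_induction₂ with
  | mem_mem f g hf hg =>
    obtain ⟨j, A, B, hA, hB, rfl⟩ := hf
    obtain ⟨l, A', B', hA', hB', rfl⟩ := hg
    convert mixed_gen (j + l) (hA.mul hA') (hB.mul hB') using 2 with z
    rw [zpow_add₀ (im_ne_zero z)]
    simp only [Pi.mul_apply, map_mul]
    ring
  | zero_left y hy => simpa using mixed_const 0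
  | zero_right x hx => simpa using mixed_const 0
  | add_left x y z hx hy hz h1 h2 =>
    convert add_mem h1 h2 using 1
    funext w
    simp [add_mul]
  | add_right x y z hx hy hz h1 h2 =>
    convert add_mem h1 h2 using 1
    funext w
    simp [mul_add]
  | smul_left r x y hx hy h =>
    convert Submodule.smul_mem _ r h using 1
    funext w
    simp [mul_assoc]
  | smul_right r x y hx hy h =>
    convert Submodule.smul_mem _ r h using 1
    funext w
    simp [mul_left_comm]

/-- Conjugation exchanges `A` and `B`. This symmetry is what lets `∂̄` and `F_f^-` be deduced from
`∂` and `F_f^+`. -/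
lemma mixed_conj {f : ℍ → ℂ} (hf : f ∈ mixed) : (fun z => conj (f z)) ∈ mixed := by
  induction hf using Submodule.span_induction with
  | mem f hf =>
    obtain ⟨j, A, B, hA, hB, rfl⟩ := hf
    convert mixed_gen j hB hA using 2 with z
    simp only [map_mul, map_zpow₀, Complex.conj_ofReal, Complex.conj_conj]
    ring
  | zero => simpa using mixed_const 0
  | add f g _ _ h1 h2 =>
    convert add_mem h1 h2 using 1
    funext w
    simp
  | smul r f _ h =>
    convert Submodule.smul_mem _ (conj r) h using 1
    funext w
    simp

lemma mixed_const_mul (c : ℂ) {f : ℍ → ℂ} (hf : f ∈ mixed) : (fun z => c * f z) ∈ mixed :=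
  Submodule.smul_mem _ c hf

lemma mixed_add {f g : ℍ → ℂ} (hf : f ∈ mixed) (hg : g ∈ mixed) :
    (fun z => f z + g z) ∈ mixed :=
  add_mem hf hg

lemma mixed_sum {ι : Type*} (s : Finset ι) {f : ι → ℍ → ℂ} (hf : ∀ i ∈ s, f i ∈ mixed) :
    (fun z => ∑ i ∈ s, f i z) ∈ mixed := by
  convert sum_mem hf using 1
  funext z
  simp

/-! ### Analyticity, growth and expansions -/

lemma mixed_isRealAnalytic {f : ℍ → ℂ} (hf : f ∈ mixed) : IsRealAnalytic f := by
  induction hf using Submodule.span_induction with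
  | mem f hf =>
    obtain ⟨j, A, B, hA, hB, rfl⟩ := hf
    have hopen : IsOpen {w : ℂ | 0 < w.im} := isOpen_lt continuous_const Complex.continuous_im
    have key : AnalyticOnNhd ℝ (fun w : ℂ => (w.im : ℂ) ^ j *
        A (Complex.exp (2 * Real.pi * Complex.I * w)) *
        conj (B (Complex.exp (2 * Real.pi * Complex.I * w)))) {w : ℂ | 0 < w.im} := by
      intro w hw
      have h1 : ∀ {A : ℂ → ℂ}, DiscHol A →
          AnalyticAt ℝ (fun w : ℂ => A (Complex.exp (2 * Real.pi * Complex.I * w))) w := by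
        intro A hA
        have hA' : AnalyticAt ℂ A (Complex.exp (2 * Real.pi * Complex.I * w)) :=
          hA.analyticAt ⟨w, hw⟩
        have : AnalyticAt ℂ (fun w : ℂ => A (Complex.exp (2 * Real.pi * Complex.I * w))) w :=
          AnalyticAt.fun_comp (f := fun w : ℂ => Complex.exp (2 * Real.pi * Complex.I * w)) hA'
            (by fun_prop)
        exact this.restrictScalars
      have h2 : AnalyticAt ℝ (fun w : ℂ => (w.im : ℂ)) w :=
        (Complex.ofRealCLM.comp Complex.imCLM).analyticAt w
      have h3 : AnalyticAt ℝ (fun w : ℂ => (w.im : ℂ) ^ j) w :=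
        h2.zpow (by exact_mod_cast (ne_of_gt hw))
      have h4 : AnalyticAt ℝ
          (fun w : ℂ => conj (B (Complex.exp (2 * Real.pi * Complex.I * w)))) w :=
        ((Complex.conjCLE : ℂ →L[ℝ] ℂ).analyticAt _).fun_comp (h1 hB)
      exact (h3.mul (h1 hA)).mul h4
    refine key.congr hopen fun w hw => ?_
    simp only [qpar, ofComplex_apply_of_im_pos hw]
    rfl
  | zero => exact analyticOnNhd_const
  | add f g _ _ h1 h2 => exact h1.add h2
  | smul r f _ h => exact analyticOnNhd_const.mul h

lemma mixed_differentiableAt {f : ℍ → ℂ} (hf : f ∈ mixed) (z : ℍ) :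
    DifferentiableAt ℝ (fun w : ℂ => f (ofComplex w)) z :=
  (mixed_isRealAnalytic hf z z.im_pos).differentiableAt

lemma eventually_one_le_im : ∀ᶠ z : ℍ in atImInfty, 1 ≤ z.im :=
  tendsto_comap.eventually (eventually_ge_atTop (1 : ℝ))

lemma mixed_hasModerateGrowth {f : ℍ → ℂ} (hf : f ∈ mixed) : HasModerateGrowth f := by
  have mono : ∀ C D : ℝ, C ≤ D →
      (fun z : ℍ => z.im ^ C) =O[atImInfty] (fun z : ℍ => z.im ^ D) := by
    intro C D h
    refine IsBigO.of_bound 1 ?_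
    filter_upwards [eventually_one_le_im] with z hz
    rw [one_mul, Real.norm_of_nonneg (by positivity), Real.norm_of_nonneg (by positivity)]
    exact Real.rpow_le_rpow_of_exponent_le hz h
  induction hf using Submodule.span_induction with
  | mem f hf =>
    obtain ⟨j, A, B, hA, hB, rfl⟩ := hf
    have bd : ∀ {A : ℂ → ℂ}, DiscHol A →
        (fun z : ℍ => A (qpar z)) =O[atImInfty] (fun _ => (1 : ℝ)) := by
      intro A hA
      -- For `y ≥ 1` the point `q` stays in the closed disc of radius `exp (-2π)`, a compact subset
      -- of the open unit disc.
      have hlt : Real.exp (-(2 * Real.pi)) < 1 := by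
        rw [Real.exp_lt_one_iff]
        have := Real.pi_pos
        linarith
      have hs : closedBall (0 : ℂ) (Real.exp (-(2 * Real.pi))) ⊆ ball 0 1 :=
        closedBall_subset_ball hlt
      obtain ⟨M, hM⟩ := (isCompact_closedBall (0 : ℂ) (Real.exp (-(2 * Real.pi)))).exists_bound_of_continuousOn
        (hA.continuousOn.mono hs)
      refine IsBigO.of_bound M ?_
      filter_upwards [eventually_one_le_im] with z hz
      simp only [norm_one, mul_one]
      refine hM _ ?_
      rw [mem_closedBall_zero_iff, norm_qpar, Real.exp_le_exp]
      have := Real.pi_pos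
      nlinarith
    -- This exponent dominates `j` and is positive even for `j = 0`, as the definition of moderate
    -- growth demands.
    refine ⟨|(j : ℝ)| + 1, by positivity, ?_⟩
    have h0 : (fun z : ℍ => (z.im : ℂ) ^ j) =O[atImInfty] (fun z : ℍ => z.im ^ (|(j : ℝ)| + 1)) := by
      refine IsBigO.trans ?_ (mono j _ ((le_abs_self _).trans (by linarith)))
      refine IsBigO.of_bound 1 (Eventually.of_forall fun z => ?_)
      rw [one_mul, Real.norm_of_nonneg (Real.rpow_nonneg z.im_pos.le _), norm_zpow, Complex.norm_real,
        Real.norm_of_nonneg z.im_pos.le, Real.rpow_intCast]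
    have h1 := (h0.mul (bd hA)).mul
      ((Complex.conjCLE : ℂ →L[ℝ] ℂ).isBigO_comp _ _ |>.trans (bd hB))
    simpa using h1
  | zero => exact ⟨1, one_pos, isBigO_zero _ _⟩
  | add f g _ _ h1 h2 =>
    obtain ⟨C, hC, h1⟩ := h1
    obtain ⟨D, hD, h2⟩ := h2
    exact ⟨max C D, lt_max_of_lt_left hC,
      (h1.trans (mono _ _ (le_max_left _ _))).add (h2.trans (mono _ _ (le_max_right _ _)))⟩
  | smul r f _ h =>
    obtain ⟨C, hC, h⟩ := h
    exact ⟨C, hC, h.const_mul_left r⟩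

lemma mixed_hasFourierExpansion {f : ℍ → ℂ} (hf : f ∈ mixed) : HasFourierExpansion f := by
  induction hf using Submodule.span_induction with
  | mem f hf =>
    obtain ⟨j, A, B, hA, hB, rfl⟩ := hf
    obtain ⟨a, ha⟩ := hA.exists_series
    obtain ⟨b, hb⟩ := hB.exists_series
    have hb' : ∀ z : ℍ, Summable (fun n : ℕ => ‖conj (b n * qpar z ^ n)‖) := fun z =>
      (hb _ (norm_qpar_lt_one z)).1.congr fun n => (RCLike.norm_conj _).symm
    have hs : ∀ z : ℍ, Summable (fun p : ℕ × ℕ =>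
        ‖a p.1 * qpar z ^ p.1 * conj (b p.2 * qpar z ^ p.2)‖) := fun z =>
      Summable.mul_norm (f := fun n => a n * qpar z ^ n) (g := fun n => conj (b n * qpar z ^ n))
        (ha _ (norm_qpar_lt_one z)).1 (hb' z)
    have e : ∀ (z : ℍ) (p : ℕ × ℕ), a p.1 * qpar z ^ p.1 * conj (b p.2 * qpar z ^ p.2) =
        a p.1 * conj (b p.2) * qpar z ^ p.1 * conj (qpar z) ^ p.2 := fun z p => by
      simp only [map_mul, map_pow]
      ring
    refine ⟨Finsupp.single j fun p => a p.1 * conj (b p.2), fun l z => ?_, fun z => ?_⟩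
    · rcases eq_or_ne j l with rfl | h
      · simp only [Finsupp.single_eq_same]
        exact (hs z).of_norm.congr fun p => e z p
      · simp [Finsupp.single_eq_of_ne h.symm, summable_zero]
    · rw [Finsupp.sum_single_index (by simp)]
      simp only [← e]
      rw [mul_assoc, (ha _ (norm_qpar_lt_one z)).2, (hb _ (norm_qpar_lt_one z)).2, Complex.conj_tsum,
        tsum_mul_tsum_of_summable_norm (ha _ (norm_qpar_lt_one z)).1 (hb' z)]
  | zero => exact ⟨0, by simp [summable_zero], by simp⟩
  | add f g _ _ h1 h2 =>
    obtain ⟨a, ha, hf⟩ := h1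
    obtain ⟨b, hb, hg⟩ := h2
    refine ⟨a + b, fun j z => ((ha j z).add (hb j z)).congr fun p => ?_, fun z => ?_⟩
    · simp only [Finsupp.add_apply, Pi.add_apply]
      ring
    · have e : ∀ (c : ℤ →₀ (ℕ × ℕ → ℂ)) (s : Finset ℤ), c.support ⊆ s →
          (c.sum fun j c =>
          (z.im : ℂ) ^ j * ∑' p : ℕ × ℕ, c p * qpar z ^ p.1 * conj (qpar z) ^ p.2) =
          ∑ j ∈ s, (z.im : ℂ) ^ j *
            ∑' p : ℕ × ℕ, c j p * qpar z ^ p.1 * conj (qpar z) ^ p.2 := fun c s hs =>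
        Finsupp.sum_of_support_subset _ hs _ (by simp)
      simp only [Pi.add_apply, hf z, hg z]
      rw [e a (a.support ∪ b.support) Finset.subset_union_left,
        e b (a.support ∪ b.support) Finset.subset_union_right,
        e (a + b) (a.support ∪ b.support) Finsupp.support_add, ← Finset.sum_add_distrib]
      refine Finset.sum_congr rfl fun j _ => ?_
      rw [← mul_add, ← (ha j z).tsum_add (hb j z)]
      congr 1
      refine tsum_congr fun p => ?_
      simp only [Finsupp.add_apply, Pi.add_apply]
      ring
  | smul r f _ h =>
    obtain ⟨a, ha, hf⟩ := h
    refine ⟨r • a, fun j z => ((ha j z).mul_left r).congr fun p => ?_, fun z => ?_⟩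
    · simp only [Finsupp.smul_apply, Pi.smul_apply, smul_eq_mul]
      ring
    · simp only [Pi.smul_apply, smul_eq_mul, hf z]
      rw [Finsupp.sum_smul_index' (by simp), Finsupp.mul_sum]
      refine Finsupp.sum_congr fun j _ => ?_
      rw [mul_left_comm, ← tsum_mul_left]
      congr 1
      refine tsum_congr fun p => ?_
      simp only [Pi.smul_apply, smul_eq_mul]
      ring

/-! ### The operators `∂` and `∂̄` on functions with mixed expansions -/

lemma hasWirt_qpar_comp {A : ℂ → ℂ} (hA : DiscHol A) (z : ℍ) :
    HasWirt (fun w : ℂ => A (Complex.exp (2 * Real.pi * Complex.I * w))) z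
      (2 * Real.pi * Complex.I * (qpar z * deriv A (qpar z))) 0 := by
  have h1 : HasDerivAt (fun w : ℂ => Complex.exp (2 * Real.pi * Complex.I * w))
      (qpar z * (2 * Real.pi * Complex.I)) z := by
    simpa [qpar] using ((hasDerivAt_id (z : ℂ)).const_mul (2 * Real.pi * Complex.I)).cexp
  have h2 : HasDerivAt A (deriv A (qpar z)) (qpar z) := (hA.analyticAt z).differentiableAt.hasDerivAt
  have h3 := HasDerivAt.hasWirt (HasDerivAt.comp (z : ℂ) (h₂ := A) h2 h1)
  rw [show deriv A (qpar z) * (qpar z * (2 * Real.pi * Complex.I)) =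
    2 * Real.pi * Complex.I * (qpar z * deriv A (qpar z)) by ring] at h3
  exact h3

lemma DiscHol.mul_deriv {A : ℂ → ℂ} (hA : DiscHol A) : DiscHol fun q => q * deriv A q :=
  differentiableOn_id.mul (hA.deriv isOpen_ball)

/-- On a generator, `∂/∂z` kills `conj (B(q))`, sends `y ^ j` to `-(i/2) j y ^ (j-1)` and `A(q)` to
`2πi q A'(q)`. Multiplying by `2iy` gives `j y ^ j A B̄ - 4π y ^ (j+1) (q A') B̄`. -/
lemma mixed_dz {f : ℍ → ℂ} (hf : f ∈ mixed) :
    (fun z : ℍ => 2 * Complex.I * (z.im : ℂ) * dz f z) ∈ mixed := by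
  induction hf using Submodule.span_induction with
  | mem f hf =>
    obtain ⟨j, A, B, hA, hB, rfl⟩ := hf
    have key : (fun z : ℍ => 2 * Complex.I * (z.im : ℂ) * dz
        (fun z : ℍ => (z.im : ℂ) ^ j * A (qpar z) * conj (B (qpar z))) z) = fun z : ℍ =>
        (j : ℂ) * ((z.im : ℂ) ^ j * A (qpar z) * conj (B (qpar z))) +
        (-(4 * Real.pi)) * ((z.im : ℂ) ^ (j + 1) * (qpar z * deriv A (qpar z)) *
          conj (B (qpar z))) := by
      funext z
      have h1 := HasWirt.comp (f := fun w : ℂ => w ^ j) (hasDerivAt_zpow j _ (Or.inl (im_ne_zero z)))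
        (hasWirt_im (z : ℂ))
      have h2 := (h1.mul (hasWirt_qpar_comp hA z)).mul (hasWirt_qpar_comp hB z).conj
      have h3 : HasWirt (fun w : ℂ => (fun z : ℍ => (z.im : ℂ) ^ j * A (qpar z) *
          conj (B (qpar z))) (ofComplex w)) z _ _ := h2.congr <| by
        filter_upwards [eventually_im_pos z] with w hw
        simp only [qpar, ofComplex_apply_of_im_pos hw]
        rfl
      rw [h3.dz_eq]
      have hz := im_ne_zero z
      simp only [coe_im, map_zero, mul_zero, add_zero]
      rw [zpow_sub_one₀ hz, zpow_add_one₀ hz]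
      change _ * ((_ * A (qpar z) + _) * conj (B (qpar z))) = _
      field_simp
      linear_combination (-j * A (qpar z) * conj (B (qpar z)) +
        z.im * (4 * Real.pi) * (qpar z * deriv A (qpar z)) * conj (B (qpar z))) * Complex.I_sq
    rw [key]
    exact mixed_add (mixed_const_mul _ (mixed_gen _ hA hB))
      (mixed_const_mul _ (mixed_gen _ hA.mul_deriv hB))
  | zero =>
    have : dz (0 : ℍ → ℂ) = 0 := by
      funext z
      simp [dz]
    simpa [this] using mixed_const 0
  | add f g hf hg h1 h2 =>
    convert add_mem h1 h2 using 1
    funext z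
    have h := fderiv_fun_add (mixed_differentiableAt hf z) (mixed_differentiableAt hg z)
    simp only [dz, Pi.add_apply, h, add_apply]
    ring
  | smul r f hf h =>
    convert Submodule.smul_mem _ r h using 1
    funext z
    have h := fderiv_const_mul (mixed_differentiableAt hf z) r
    simp only [dz, Pi.smul_apply, smul_eq_mul, h, smul_apply]
    ring

lemma mixed_maass (r : ℤ) {f : ℍ → ℂ} (hf : f ∈ mixed) : maass r f ∈ mixed :=
  mixed_add (mixed_dz hf) (mixed_const_mul _ hf)

/-! ### Modularity and its behaviour under the two operators -/

/-- Modularity of weights `(r, s)`. -/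
def HasWeight (r s : ℤ) (f : ℍ → ℂ) : Prop :=
  ∀ (γ : SL(2, ℤ)) (z : ℍ), f (γ • z) = autj γ z ^ r * autj γ (conj (z : ℂ)) ^ s * f z

lemma autj_eq_denom (γ : SL(2, ℤ)) (z : ℍ) : autj γ z = denom γ z := by
  simp [autj, ModularGroup.denom_apply]

lemma autj_ne_zero (γ : SL(2, ℤ)) (z : ℍ) : autj γ z ≠ 0 := by
  rw [autj_eq_denom]
  exact denom_ne_zero _ z

lemma autj_conj (γ : SL(2, ℤ)) (z : ℂ) : autj γ (conj z) = conj (autj γ z) := by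
  simp [autj]

lemma autj_conj_ne_zero (γ : SL(2, ℤ)) (z : ℍ) : autj γ (conj (z : ℂ)) ≠ 0 := by
  rw [autj_conj]
  simpa using autj_ne_zero γ z

lemma coe_smul_eq (γ : SL(2, ℤ)) (z : ℍ) :
    ((γ • z : ℍ) : ℂ) = ((γ 0 0 : ℂ) * z + γ 0 1) / autj γ z := by
  rw [UpperHalfPlane.specialLinearGroup_apply]
  simp [autj]

lemma im_smul_eq (γ : SL(2, ℤ)) (z : ℍ) :
    ((γ • z : ℍ).im : ℂ) = (z.im : ℂ) / (autj γ z * autj γ (conj (z : ℂ))) := by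
  rw [ModularGroup.im_smul_eq_div_normSq, autj_conj, Complex.mul_conj, autj_eq_denom]
  push_cast
  rfl

lemma det_eq (γ : SL(2, ℤ)) : (γ 0 0 : ℂ) * γ 1 1 - γ 0 1 * γ 1 0 = 1 := by
  have h := γ.det_coe
  rw [Matrix.det_fin_two] at h
  exact_mod_cast h

lemma hasDerivAt_autj (γ : SL(2, ℤ)) (z : ℂ) : HasDerivAt (autj γ) (γ 1 0 : ℂ) z := by
  have h := ((hasDerivAt_id z).const_mul (γ 1 0 : ℂ)).add_const (γ 1 1 : ℂ)
  rw [mul_one] at h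
  exact h

lemma hasDerivAt_moebius (γ : SL(2, ℤ)) (z : ℍ) :
    HasDerivAt (fun w : ℂ => ((γ 0 0 : ℂ) * w + γ 0 1) / autj γ w) (1 / autj γ z ^ 2) z := by
  have h1 : HasDerivAt (fun w : ℂ => (γ 0 0 : ℂ) * w + γ 0 1) (γ 0 0 : ℂ) z := by
    simpa using ((hasDerivAt_id (z : ℂ)).const_mul (γ 0 0 : ℂ)).add_const (γ 0 1 : ℂ)
  have h2 := hasDerivAt_autj γ z
  have h3 := h1.div h2 (autj_ne_zero γ z)
  rw [show (γ 0 0 : ℂ) * autj γ z - ((γ 0 0 : ℂ) * z + γ 0 1) * γ 1 0 = 1 by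
    rw [show autj γ z = (γ 1 0 : ℂ) * z + γ 1 1 from rfl]
    linear_combination det_eq γ] at h3
  exact h3

lemma eventually_moebius (γ : SL(2, ℤ)) (z : ℍ) : ∀ᶠ w : ℂ in 𝓝 (z : ℂ),
    ((γ • ofComplex w : ℍ) : ℂ) = ((γ 0 0 : ℂ) * w + γ 0 1) / autj γ w ∧
      ((ofComplex w : ℍ) : ℂ) = w := by
  filter_upwards [eventually_im_pos z] with w hw
  rw [coe_smul_eq, ofComplex_apply_of_im_pos hw]
  exact ⟨rfl, rfl⟩

/-- Differentiate the transformation law in `z`. The factor `j(γ, z̄) ^ s` is antiholomorphic and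
contributes nothing; the derivative of `j(γ, z) ^ r` produces a term `r c j(γ, z) ^ (r-1)`, which
the constant `r` in `∂_r` absorbs. -/
lemma HasWeight.maass {r s : ℤ} {f : ℍ → ℂ} (hf : HasWeight r s f)
    (hd : ∀ z : ℍ, DifferentiableAt ℝ (fun w : ℂ => f (ofComplex w)) z) :
    HasWeight (r + 1) (s - 1) (maass r f) := by
  intro γ z
  have hj := autj_ne_zero γ z
  have hj' := autj_conj_ne_zero γ z
  have e1 : ((γ 0 0 : ℂ) * z + γ 0 1) / autj γ z = ((γ • z : ℍ) : ℂ) := (coe_smul_eq γ z).symm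
  have h1 : HasWirt (fun w : ℂ => f (ofComplex (((γ 0 0 : ℂ) * w + γ 0 1) / autj γ w))) z
      (dz f (γ • z) * (1 / autj γ z ^ 2)) (dzbar f (γ • z) * conj (1 / autj γ z ^ 2)) := by
    refine HasWirt.comp_hasDerivAt (f := fun w : ℂ => f (ofComplex w)) ?_ (hasDerivAt_moebius γ z)
    rw [e1]
    exact DifferentiableAt.hasWirt (hd _)
  have h2 := hasDerivAt_autj γ z
  have h3 := HasWirt.comp (f := fun w : ℂ => w ^ r) (hasDerivAt_zpow r _ (Or.inl hj))
    (HasDerivAt.hasWirt h2)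
  have h4 := HasWirt.comp (f := fun w : ℂ => w ^ s)
    (hasDerivAt_zpow s _ (Or.inl (by simpa using hj))) (HasDerivAt.hasWirt h2).conj
  have h5 := (h3.mul h4).mul (DifferentiableAt.hasWirt (hd z))
  have h6 := h1.congr (g := fun w : ℂ => autj γ w ^ r * conj (autj γ w) ^ s * f (ofComplex w)) <| by
    filter_upwards [eventually_moebius γ z] with w ⟨hw, hw'⟩
    rw [← hw, ofComplex_apply, hf, hw', autj_conj]
  have h7 := h6.unique_fst h5
  simp only [ofComplex_apply, map_zero, mul_zero, add_zero] at h7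
  rw [← autj_conj] at h7
  have h8 : dz f (γ • z) = autj γ z ^ 2 * (r * autj γ z ^ (r - 1) * (γ 1 0 : ℂ) *
      autj γ (conj (z : ℂ)) ^ s * f z +
      autj γ z ^ r * autj γ (conj (z : ℂ)) ^ s * dz f z) := by
    rw [← h7]
    field_simp
  -- This relation makes the two terms proportional to `r f` combine.
  have h9 : 2 * Complex.I * z.im * (γ 1 0 : ℂ) + autj γ (conj (z : ℂ)) = autj γ z := by
    have : (z : ℂ) - conj (z : ℂ) = 2 * Complex.I * z.im := by
      rw [Complex.sub_conj]
      push_cast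
      rw [coe_im]
      ring
    simp only [autj]
    linear_combination -(γ 1 0 : ℂ) * this
  simp only [ModIter.maass]
  rw [h8, hf γ z, im_smul_eq, zpow_sub_one₀ hj, zpow_add_one₀ hj, zpow_sub_one₀ hj']
  rw [← sub_eq_zero]
  field_simp
  ring_nf
  linear_combination autj γ z ^ r * autj γ (conj (z : ℂ)) ^ s * r * f z * h9

lemma HasWeight.conj {r s : ℤ} {f : ℍ → ℂ} (hf : HasWeight r s f) :
    HasWeight s r (fun z => conj (f z)) := by
  intro γ z
  simp only [hf γ z, map_mul, map_zpow₀, autj_conj, Complex.conj_conj]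
  ring

lemma maassBar_eq {f : ℍ → ℂ} (s : ℤ)
    (hd : ∀ z : ℍ, DifferentiableAt ℝ (fun w : ℂ => f (ofComplex w)) z) :
    maassBar s f = fun z => conj (maass s (fun z => conj (f z)) z) := by
  funext z
  have h := (DifferentiableAt.hasWirt (hd z)).conj
  have h' : dz (fun z => conj (f z)) z = conj (dzbar f z) := HasWirt.dz_eq h
  simp only [maass, maassBar, h']
  simp [Complex.conj_ofNat]

/-- The functions of weights `(r, s)` with a mixed expansion. -/
def mixedForms (r s : ℤ) : Submodule ℂ (ℍ → ℂ) where
  carrier := {f | f ∈ mixed ∧ HasWeight r s f}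
  zero_mem' := ⟨zero_mem _, fun γ z => by simp⟩
  add_mem' := fun hf hg => ⟨add_mem hf.1 hg.1, fun γ z => by
    simp only [Pi.add_apply, hf.2 γ z, hg.2 γ z]
    ring⟩
  smul_mem' := fun c _ hf => ⟨Submodule.smul_mem _ c hf.1, fun γ z => by
    simp only [Pi.smul_apply, smul_eq_mul, hf.2 γ z]
    ring⟩

lemma mixedForms_le (r s : ℤ) : mixedForms r s ≤ realAnForms r s := fun _ hf =>
  ⟨mixed_isRealAnalytic hf.1, mixed_hasModerateGrowth hf.1, hf.2, mixed_hasFourierExpansion hf.1⟩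

lemma mixedForms_conj {r s : ℤ} {f : ℍ → ℂ} (hf : f ∈ mixedForms r s) :
    (fun z => conj (f z)) ∈ mixedForms s r :=
  ⟨mixed_conj hf.1, hf.2.conj⟩

lemma mixedForms_maass {r s : ℤ} {f : ℍ → ℂ} (hf : f ∈ mixedForms r s) :
    maass r f ∈ mixedForms (r + 1) (s - 1) :=
  ⟨mixed_maass r hf.1, hf.2.maass (mixed_differentiableAt hf.1)⟩

lemma mixedForms_maassBar {r s : ℤ} {f : ℍ → ℂ} (hf : f ∈ mixedForms r s) :
    maassBar s f ∈ mixedForms (r - 1) (s + 1) := by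
  rw [maassBar_eq s (mixed_differentiableAt hf.1)]
  exact mixedForms_conj (mixedForms_maass (mixedForms_conj hf))

/-- The bigraded space of modular functions with a mixed expansion. -/
def gradedMixed : Submodule ℂ GradedFun where
  carrier := {F | ∀ p : ℤ × ℤ, F p ∈ mixedForms p.1 p.2}
  zero_mem' := fun _ => Submodule.zero_mem _
  add_mem' := fun hF hG p => Submodule.add_mem _ (hF p) (hG p)
  smul_mem' := fun c _ hF p => Submodule.smul_mem _ c (hF p)

/-- Both operators map this space to itself, so the left summand of each supremum is enough and the
Eisenstein summands never enter. -/
lemma gradedMixed_admissible : gradedMixed ∈ admissible := by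
  refine ⟨fun F hF p => mixedForms_le _ _ (hF p), fun F hF => Submodule.mem_sup_left fun p => ?_,
    fun F hF => Submodule.mem_sup_left fun p => ?_⟩
  · rw [del_apply]
    simpa using mixedForms_maass (hF (p.1 - 1, p.2 + 1))
  · rw [delBar_apply]
    simpa using mixedForms_maassBar (hF (p.1 + 1, p.2 - 1))

lemma single_mem_gradedMixed {r s : ℤ} {f : ℍ → ℂ} (hf : f ∈ mixedForms r s) :
    Finsupp.single (r, s) f ∈ gradedMixed := by
  intro p
  rcases eq_or_ne (r, s) p with rfl | h
  · simpa using hf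
  · rw [Finsupp.single_eq_of_ne h.symm]
    exact zero_mem _

/-! ### Sums over lattice translates -/

/-- The functions that are finite sums of `y ^ j A(q)` and `y ^ j conj (A(q))`. -/
def pureMixed : Submodule ℂ (ℍ → ℂ) :=
  Submodule.span ℂ {f | ∃ (j : ℤ) (A : ℂ → ℂ), DiscHol A ∧
    (f = (fun z : ℍ => (z.im : ℂ) ^ j * A (qpar z)) ∨
      f = fun z : ℍ => (z.im : ℂ) ^ j * conj (A (qpar z)))}

lemma pureMixed_hol (j : ℤ) {A : ℂ → ℂ} (hA : DiscHol A) :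
    (fun z : ℍ => (z.im : ℂ) ^ j * A (qpar z)) ∈ pureMixed :=
  Submodule.subset_span ⟨j, A, hA, Or.inl rfl⟩

lemma pureMixed_conj {f : ℍ → ℂ} (hf : f ∈ pureMixed) : (fun z => conj (f z)) ∈ pureMixed := by
  induction hf using Submodule.span_induction with
  | mem f hf =>
    obtain ⟨j, A, hA, rfl | rfl⟩ := hf
    · exact Submodule.subset_span ⟨j, A, hA, Or.inr (by funext z; simp)⟩
    · exact Submodule.subset_span ⟨j, A, hA, Or.inl (by funext z; simp)⟩
  | zero =>
    simp only [Pi.zero_apply, map_zero]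
    exact zero_mem pureMixed
  | add f g _ _ h1 h2 =>
    convert add_mem h1 h2 using 1
    funext w
    simp
  | smul r f _ h =>
    convert Submodule.smul_mem _ (conj r) h using 1
    funext w
    simp

lemma pureMixed_zpow_mul (j : ℤ) {f : ℍ → ℂ} (hf : f ∈ pureMixed) :
    (fun z : ℍ => (z.im : ℂ) ^ j * f z) ∈ pureMixed := by
  induction hf using Submodule.span_induction with
  | mem f hf =>
    obtain ⟨l, A, hA, rfl | rfl⟩ := hf
    · exact Submodule.subset_span ⟨j + l, A, hA, Or.inl (by
        funext z; rw [zpow_add₀ (im_ne_zero z), mul_assoc])⟩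
    · exact Submodule.subset_span ⟨j + l, A, hA, Or.inr (by
        funext z; rw [zpow_add₀ (im_ne_zero z), mul_assoc])⟩
  | zero =>
    simp only [Pi.zero_apply, mul_zero]
    exact zero_mem pureMixed
  | add f g _ _ h1 h2 =>
    convert add_mem h1 h2 using 1
    funext w
    simp [mul_add]
  | smul r f _ h =>
    convert Submodule.smul_mem _ r h using 1
    funext w
    simp [mul_left_comm]

lemma discHol_tsum {ι : Type*} {F : ι → ℂ → ℂ} (hF : ∀ i, DiscHol (F i))
    (hs : ∀ ρ : ℝ, 0 < ρ → ρ < 1 → ∃ u : ι → ℝ, Summable u ∧ ∀ i q, ‖q‖ < ρ → ‖F i q‖ ≤ u i) :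
    DiscHol fun q => ∑' i, F i q := by
  intro q hq
  obtain ⟨ρ, h1, h2⟩ := exists_between (show ‖q‖ < 1 by simpa using hq)
  obtain ⟨u, hu, hle⟩ := hs ρ ((norm_nonneg _).trans_lt h1) h2
  have hd := Complex.differentiableOn_tsum_of_summable_norm (F := F) (U := ball 0 ρ) hu
    (fun i => (hF i).mono (ball_subset_ball h2.le)) isOpen_ball
    (fun i q hq => hle i q (by simpa using hq))
  exact (hd.differentiableAt (isOpen_ball.mem_nhds (by simpa using h1))).differentiableWithinAt

lemma DiscHol.exists_bound {A : ℂ → ℂ} (hA : DiscHol A) {ρ : ℝ} (hρ : ρ < 1) :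
    ∃ M, ∀ q, ‖q‖ ≤ ρ → ‖A q‖ ≤ M := by
  obtain ⟨M, hM⟩ := (isCompact_closedBall (0 : ℂ) ρ).exists_bound_of_continuousOn
    (hA.continuousOn.mono (closedBall_subset_ball hρ))
  exact ⟨M, fun q hq => hM q (by simpa using hq)⟩

lemma qpar_vadd (x : ℝ) (z : ℍ) :
    qpar (x +ᵥ z) = Complex.exp (2 * Real.pi * x * Complex.I) * qpar z := by
  rw [qpar, qpar, ← Complex.exp_add]
  congr 1
  rw [coe_vadd]
  ring

lemma norm_exp_two_pi_mul_I (x : ℝ) : ‖Complex.exp (2 * Real.pi * x * Complex.I)‖ = 1 := by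
  have := Complex.norm_exp_ofReal_mul_I (2 * Real.pi * x)
  push_cast at this
  exact this

/-- Translating `z` by a real number rotates `q`, so an averaged `A(q)` is again a holomorphic
function of `q`. An averaged product `A(q) conj (B(q))` need not be a finite sum of such products,
which is why averaging is confined to `pureMixed`. -/
lemma discHol_average {ι : Type*} {w : ι → ℂ} (hw : Summable fun i => ‖w i‖) (x : ι → ℝ)
    {A : ℂ → ℂ} (hA : DiscHol A) :
    DiscHol fun q => ∑' i, w i * A (Complex.exp (2 * Real.pi * x i * Complex.I) * q) := by
  refine discHol_tsum (fun i => ?_) fun ρ h0 hρ => ?_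
  · refine (DifferentiableOn.comp (t := ball 0 1) hA (by fun_prop) fun q hq => ?_).const_mul _
    simpa [norm_exp_two_pi_mul_I] using hq
  · obtain ⟨M, hM⟩ := hA.exists_bound hρ
    refine ⟨fun i => ‖w i‖ * M, hw.mul_right M, fun i q hq => ?_⟩
    rw [norm_mul]
    exact mul_le_mul_of_nonneg_left (hM _ (by simpa [norm_exp_two_pi_mul_I] using hq.le))
      (norm_nonneg _)

lemma summable_average {ι : Type*} {w : ι → ℂ} (hw : Summable fun i => ‖w i‖) (x : ι → ℝ)
    {A : ℂ → ℂ} (hA : DiscHol A) {q : ℂ} (hq : ‖q‖ < 1) :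
    Summable fun i => w i * A (Complex.exp (2 * Real.pi * x i * Complex.I) * q) := by
  obtain ⟨M, hM⟩ := hA.exists_bound hq
  refine Summable.of_norm_bounded (hw.mul_right M) fun i => ?_
  rw [norm_mul]
  exact mul_le_mul_of_nonneg_left (hM _ (by simp [norm_exp_two_pi_mul_I])) (norm_nonneg _)

/-- Weighted averages over translates preserve `pureMixed`. -/
lemma pureMixed_average {ι : Type*} {w : ι → ℂ} (hw : Summable fun i => ‖w i‖) (x : ι → ℝ)
    {f : ℍ → ℂ} (hf : f ∈ pureMixed) :
    (∀ z, Summable fun i => w i * f (x i +ᵥ z)) ∧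
      (fun z => ∑' i, w i * f (x i +ᵥ z)) ∈ pureMixed := by
  induction hf using Submodule.span_induction with
  | mem f hf =>
    obtain ⟨j, A, hA, rfl | rfl⟩ := hf
    · have e : ∀ (z : ℍ) i, w i * (((x i +ᵥ z : ℍ).im : ℂ) ^ j * A (qpar (x i +ᵥ z))) =
          (z.im : ℂ) ^ j * (w i * A (Complex.exp (2 * Real.pi * x i * Complex.I) * qpar z)) := by
        intro z i
        rw [vadd_im, qpar_vadd]
        ring
      simp only [e, tsum_mul_left]
      exact ⟨fun z => (summable_average hw x hA (norm_qpar_lt_one z)).mul_left _,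
        pureMixed_hol j (discHol_average hw x hA)⟩
    · have hw' : Summable fun i => ‖conj (w i)‖ := by simpa using hw
      have e : ∀ (z : ℍ) i, w i * (((x i +ᵥ z : ℍ).im : ℂ) ^ j * conj (A (qpar (x i +ᵥ z)))) =
          (z.im : ℂ) ^ j *
            conj (conj (w i) * A (Complex.exp (2 * Real.pi * x i * Complex.I) * qpar z)) := by
        intro z i
        rw [vadd_im, qpar_vadd, map_mul, Complex.conj_conj]
        ring
      simp only [e, tsum_mul_left, ← Complex.conj_tsum]
      refine ⟨fun z => Summable.mul_left _ ?_,
        Submodule.subset_span ⟨j, _, discHol_average hw' x hA, Or.inr rfl⟩⟩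
      exact (summable_average hw' x hA (norm_qpar_lt_one z)).map (starRingEnd ℂ)
        Complex.continuous_conj
  | zero =>
    simp only [Pi.zero_apply, mul_zero, tsum_zero]
    exact ⟨fun _ => summable_zero, zero_mem pureMixed⟩
  | add f g _ _ h1 h2 =>
    simp only [Pi.add_apply, mul_add]
    refine ⟨fun z => (h1.1 z).add (h2.1 z), ?_⟩
    convert add_mem h1.2 h2.2 using 1
    funext z
    exact (h1.1 z).tsum_add (h2.1 z)
  | smul r f _ h =>
    simp only [Pi.smul_apply, smul_eq_mul, mul_left_comm _ r]
    refine ⟨fun z => (h.1 z).mul_left r, ?_⟩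
    convert Submodule.smul_mem _ r h.2 using 1
    funext z
    exact tsum_mul_left

lemma pureMixed_le_mixed : pureMixed ≤ mixed := by
  refine Submodule.span_le.2 ?_
  rintro _ ⟨j, A, hA, rfl | rfl⟩
  · simpa using mixed_gen j hA (discHol_const 1)
  · simpa using mixed_gen j (discHol_const 1) hA

/-! ### The Lipschitz formula with two weights -/

/-- `∑_{l ∈ ℤ} (z + l)^{-r} (z̄ + l)^{-s}`. -/
def lipSum (r s : ℤ) (z : ℍ) : ℂ :=
  ∑' l : ℤ, ((z : ℂ) + l) ^ (-r) * (conj (z : ℂ) + l) ^ (-s)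

lemma add_int_ne_zero (z : ℍ) (l : ℤ) : (z : ℂ) + l ≠ 0 := by
  intro h
  have := congrArg Complex.im h
  simp at this
  exact z.im_pos.ne' this

lemma conj_add_int (z : ℍ) (l : ℤ) : conj (z : ℂ) + l = conj ((z : ℂ) + l) := by simp

lemma conj_add_int_ne_zero (z : ℍ) (l : ℤ) : conj (z : ℂ) + l ≠ 0 := by
  rw [conj_add_int]
  exact (map_ne_zero _).2 (add_int_ne_zero z l)

lemma norm_zpow_mul_zpow {a b : ℂ} (ha : a ≠ 0) (hab : ‖b‖ = ‖a‖) (r s : ℤ) :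
    ‖a ^ r * b ^ s‖ = ‖a‖ ^ (r + s) := by
  rw [norm_mul, norm_zpow, norm_zpow, hab, zpow_add₀ (by simpa using ha)]

lemma summable_lipSum {r s : ℤ} (h : 2 ≤ r + s) (z : ℍ) :
    Summable fun l : ℤ => ((z : ℂ) + l) ^ (-r) * (conj (z : ℂ) + l) ^ (-s) := by
  refine Summable.of_norm ?_
  refine (EisensteinSeries.linear_right_summable (z : ℂ) 1 h).norm.congr fun l => ?_
  rw [norm_zpow_mul_zpow (add_int_ne_zero z l) (by rw [conj_add_int, RCLike.norm_conj]),
    Int.cast_one, one_mul, norm_inv, norm_zpow, ← zpow_neg]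
  congr 1
  ring

lemma lipSum_conj (r s : ℤ) (z : ℍ) : lipSum r s z = conj (lipSum s r z) := by
  rw [lipSum, lipSum, Complex.conj_tsum]
  refine tsum_congr fun l => ?_
  simp only [map_mul, map_zpow₀, map_add, Complex.conj_conj, map_intCast]
  ring

lemma sub_conj_eq (z : ℍ) : (z : ℂ) - conj (z : ℂ) = 2 * Complex.I * z.im := by
  rw [Complex.sub_conj]
  push_cast
  rw [coe_im]
  ring

/-- Termwise this is `(z + l) - (z̄ + l) = 2iy`. The bound on `r + s` keeps all three series
absolutely convergent. -/
lemma lipSum_recursion {r s : ℤ} (h : 3 ≤ r + s) (z : ℍ) :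
    lipSum (r - 1) s z = lipSum r (s - 1) z + 2 * Complex.I * z.im * lipSum r s z := by
  rw [lipSum, lipSum, lipSum, ← tsum_mul_left, ← Summable.tsum_add (summable_lipSum (by linarith) z)
    ((summable_lipSum (by linarith) z).mul_left _)]
  refine tsum_congr fun l => ?_
  have h1 := add_int_ne_zero z l
  have h2 := conj_add_int_ne_zero z l
  rw [show -(r - 1) = -r + 1 by ring, show -(s - 1) = -s + 1 by ring, zpow_add_one₀ h1,
    zpow_add_one₀ h2]
  linear_combination ((z : ℂ) + l) ^ (-r) * (conj (z : ℂ) + l) ^ (-s) * sub_conj_eq z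

lemma discHol_polylog (k : ℕ) : DiscHol fun q => ∑' n : ℕ, (n : ℂ) ^ k * q ^ n := by
  refine discHol_tsum (fun n => (by fun_prop : Differentiable ℂ _).differentiableOn)
    fun ρ h0 hρ => ⟨fun n => (n : ℝ) ^ k * ρ ^ n, ?_, fun n q hq => ?_⟩
  · exact summable_pow_mul_geometric_of_norm_lt_one k (by rwa [Real.norm_of_nonneg h0.le])
  · rw [norm_mul, norm_pow, norm_pow, Complex.norm_natCast]
    exact mul_le_mul_of_nonneg_left (pow_le_pow_left₀ (norm_nonneg _) hq.le _) (by positivity)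

/-- This is the classical Lipschitz formula, with exponent `r - 1` on `n` in the `q`-series. -/
lemma lipSum_hol_mem {r : ℤ} (hr : 2 ≤ r) : lipSum r 0 ∈ pureMixed := by
  obtain ⟨k, rfl⟩ : ∃ k : ℕ, r = k + 1 := ⟨(r - 1).toNat, by omega⟩
  have hk : 1 ≤ k := by omega
  convert pureMixed_hol 0 ((discHol_polylog k).const_mul
    ((-2 * Real.pi * Complex.I) ^ (k + 1) / (k.factorial : ℂ))) using 2 with z
  rw [zpow_zero, one_mul]
  refine Eq.trans ?_ (EisensteinSeries.qExpansion_identity hk z)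
  refine tsum_congr fun l => ?_
  rw [neg_zero, zpow_zero, mul_one, zpow_neg, one_div]
  norm_cast

lemma pi_mul_cot_eq (z : ℍ) : Real.pi * Complex.cot (Real.pi * z) =
    Real.pi * Complex.I - 2 * Real.pi * Complex.I * (1 - qpar z)⁻¹ := by
  rw [pi_mul_cot_pi_q_exp, ← tsum_geometric_of_norm_lt_one (norm_qpar_lt_one z)]
  rfl

/-- Partial fractions give `2iy / ((z + l)(z̄ + l)) = 1/(z̄ + l) - 1/(z + l)`. The two parts do not
converge absolutely over `ℤ` separately, so the terms at `n + 1` and `-(n + 1)` are paired to match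
the cotangent series. -/
lemma lipSum_one_one_eq (z : ℍ) : 2 * Complex.I * z.im * lipSum 1 1 z =
    conj (Real.pi * Complex.cot (Real.pi * z)) - Real.pi * Complex.cot (Real.pi * z) := by
  have hs := (summable_lipSum (r := 1) (s := 1) le_rfl z).mul_left (2 * Complex.I * z.im)
  have hc := summable_cotTerm (coe_mem_integerComplement z)
  have hc' : Summable fun n : ℕ => conj (cotTerm (z : ℂ) n) :=
    hc.map (starRingEnd ℂ) Complex.continuous_conj
  have e : ∀ l : ℤ, 2 * Complex.I * z.im *
      (((z : ℂ) + l) ^ (-1 : ℤ) * (conj (z : ℂ) + l) ^ (-1 : ℤ)) =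
      conj (1 / ((z : ℂ) + l)) - 1 / ((z : ℂ) + l) := by
    intro l
    have h1 := add_int_ne_zero z l
    have h2 := conj_add_int_ne_zero z l
    rw [map_div₀, map_one, ← conj_add_int, ← sub_conj_eq, zpow_neg_one, zpow_neg_one]
    field_simp
    ring
  rw [lipSum, ← tsum_mul_left]
  simp only [e] at hs ⊢
  have hs' := summable_int_iff_summable_nat_and_neg.1 hs
  have h1 := (summable_nat_add_iff 1).2 hs'.1
  have h2 := (summable_nat_add_iff 1).2 hs'.2
  have h3 := cot_series_rep' (coe_mem_integerComplement z)
  change _ = ∑' n : ℕ, cotTerm (z : ℂ) n at h3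
  rw [sub_eq_iff_eq_add] at h3
  rw [h3, tsum_of_add_one_of_neg_add_one (by exact_mod_cast h1) (by exact_mod_cast h2), map_add,
    Complex.conj_tsum]
  have h4 : ∀ n : ℕ, (conj (1 / ((z : ℂ) + ((n : ℤ) + 1 : ℤ))) - 1 / ((z : ℂ) + ((n : ℤ) + 1 : ℤ))) +
      (conj (1 / ((z : ℂ) + (-((n : ℤ) + 1) : ℤ))) - 1 / ((z : ℂ) + (-((n : ℤ) + 1) : ℤ))) =
      conj (cotTerm (z : ℂ) n) - cotTerm (z : ℂ) n := by
    intro n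
    simp only [cotTerm, map_add]
    push_cast
    rw [← sub_eq_add_neg]
    ring
  have h5 := hc'.tsum_sub hc
  rw [← tsum_congr h4, Summable.tsum_add (by exact_mod_cast h1) (by exact_mod_cast h2)] at h5
  rw [Int.cast_zero, add_zero]
  linear_combination h5

lemma discHol_cot :
    DiscHol fun q => Real.pi * Complex.I - 2 * Real.pi * Complex.I * (1 - q)⁻¹ := by
  refine (differentiableOn_const _).sub ((DifferentiableOn.inv (by fun_prop) fun q hq => ?_).const_mul _)
  intro h
  rw [← sub_eq_zero.1 h] at hq
  simp at hq

lemma lipSum_one_one_mem : lipSum 1 1 ∈ pureMixed := by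
  have h : (fun z : ℍ => 2 * Complex.I * z.im * lipSum 1 1 z) ∈ pureMixed := by
    have h1 := pureMixed_hol 0 discHol_cot
    simp only [zpow_zero, one_mul, ← pi_mul_cot_eq] at h1
    simp only [lipSum_one_one_eq]
    exact sub_mem (pureMixed_conj h1) h1
  convert Submodule.smul_mem _ (2 * Complex.I)⁻¹ (pureMixed_zpow_mul (-1) h) using 1
  funext z
  have := im_ne_zero z
  simp only [Pi.smul_apply, smul_eq_mul, zpow_neg_one]
  field_simp

/-- The recursion is solved for its last term; dividing by `2iy` is harmless because negative powers
of `y` are allowed. -/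
lemma lipSum_step {r s : ℤ} (h : 3 ≤ r + s) (h1 : lipSum (r - 1) s ∈ pureMixed)
    (h2 : lipSum r (s - 1) ∈ pureMixed) : lipSum r s ∈ pureMixed := by
  convert Submodule.smul_mem _ (2 * Complex.I)⁻¹ (pureMixed_zpow_mul (-1) (sub_mem h1 h2)) using 1
  funext z
  have := im_ne_zero z
  simp only [Pi.smul_apply, smul_eq_mul, zpow_neg_one, Pi.sub_apply, lipSum_recursion h z]
  field_simp
  ring

/-- Induction on the total weight. The recursion needs total weight at least `3`, so weight `2` is
the base, and there `(1, 1)` requires the cotangent computation. -/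
lemma lipSum_mem_of_nonneg (n : ℕ) : ∀ r s : ℕ, r + s = n + 2 → lipSum r s ∈ pureMixed := by
  induction n with
  | zero =>
    intro r s h
    have h' : (r = 2 ∧ s = 0) ∨ (r = 1 ∧ s = 1) ∨ (r = 0 ∧ s = 2) := by omega
    obtain ⟨rfl, rfl⟩ | ⟨rfl, rfl⟩ | ⟨rfl, rfl⟩ := h'
    · exact lipSum_hol_mem (by norm_num)
    · exact lipSum_one_one_mem
    · rw [funext (lipSum_conj _ _)]
      exact pureMixed_conj (lipSum_hol_mem (by norm_num))
  | succ n ih =>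
    intro r s h
    rcases Nat.eq_zero_or_pos s with rfl | hs
    · exact lipSum_hol_mem (by omega)
    rcases Nat.eq_zero_or_pos r with rfl | hr
    · rw [funext (lipSum_conj _ _)]
      exact pureMixed_conj (lipSum_hol_mem (by omega))
    refine lipSum_step (by omega) ?_ ?_
    · convert ih (r - 1) s (by omega) using 1
      congr 1
      omega
    · convert ih r (s - 1) (by omega) using 1
      congr 1
      omega

/-- For `s < 0` the recursion at `(r, s + 1)` expresses the sum through two sums with second weight
`s + 1`. Here `r + s ≥ 2` forces `r ≥ 3`, so `r - 1` is still nonnegative. -/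
lemma lipSum_mem_of_neg (m : ℕ) : ∀ r s : ℤ, -(m : ℤ) ≤ s → 0 ≤ r → 2 ≤ r + s →
    lipSum r s ∈ pureMixed := by
  induction m with
  | zero =>
    intro r s hs hr h
    obtain ⟨a, rfl⟩ := Int.eq_ofNat_of_zero_le hr
    obtain ⟨b, rfl⟩ := Int.eq_ofNat_of_zero_le (by simpa using hs)
    exact lipSum_mem_of_nonneg (a + b - 2) a b (by omega)
  | succ m ih =>
    intro r s hs hr h
    rcases le_or_gt 0 s with h0 | h0
    · exact ih r s (by omega) hr h
    have h1 := ih (r - 1) (s + 1) (by push_cast at hs; omega) (by omega) (by omega)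
    have h2 := ih r (s + 1) (by push_cast at hs; omega) hr (by omega)
    have h3 : lipSum r s =
        lipSum (r - 1) (s + 1) - (2 * Complex.I) • fun z : ℍ => (z.im : ℂ) ^ (1 : ℤ) * lipSum r (s + 1) z := by
      funext z
      have := lipSum_recursion (r := r) (s := s + 1) (by omega) z
      rw [add_sub_cancel_right] at this
      simp only [Pi.sub_apply, Pi.smul_apply, smul_eq_mul, zpow_one]
      rw [this]
      ring
    rw [h3]
    exact sub_mem h1 (Submodule.smul_mem _ _ (pureMixed_zpow_mul 1 h2))

lemma lipSum_mem {r s : ℤ} (h : 2 ≤ r + s) : lipSum r s ∈ pureMixed := by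
  rcases le_or_gt 0 r with hr | hr
  · exact lipSum_mem_of_neg s.natAbs r s (by omega) hr h
  · rw [funext (lipSum_conj _ _)]
    exact pureMixed_conj (lipSum_mem_of_neg r.natAbs s r (by omega) (by omega) (by omega))

/-! ### Sums over pairs `(c, d)` with `c ≥ 1` -/

lemma linear_ne_zero (z : ℍ) {c d : ℤ} (h : c ≠ 0 ∨ d ≠ 0) : (c : ℂ) * z + d ≠ 0 := by
  intro h0
  have h1 := congrArg Complex.im h0
  simp [z.im_pos.ne'] at h1
  subst h1
  simp at h0
  tauto

lemma abs_mul_im_le (z : ℍ) (c d : ℤ) : |(c : ℝ)| * z.im ≤ ‖(c : ℂ) * z + d‖ := by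
  have := Complex.abs_im_le_norm ((c : ℂ) * z + d)
  simpa [abs_mul, abs_of_pos z.im_pos] using this

lemma summable_norm_linear {w : ℤ} (hw : 3 ≤ w) (z : ℍ) :
    Summable fun p : ℤ × ℤ => ‖(p.1 : ℂ) * z + p.2‖ ^ (-w) := by
  rw [← (finTwoArrowEquiv ℤ).summable_iff]
  refine (EisensteinSeries.summable_norm_eisSummand hw z).congr fun p => ?_
  simp [EisensteinSeries.eisSummand]

/-- The summand of the series `∑ κ(c, d) (c z + d)^{-r} (c z̄ + d)^{-s}`. -/
def pairTerm (κ : ℕ+ → ℤ → ℂ) (r s : ℤ) (z : ℍ) (p : ℕ+ × ℤ) : ℂ :=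
  κ p.1 p.2 * ((((p.1 : ℕ) : ℂ) * z + p.2) ^ (-r) * (((p.1 : ℕ) : ℂ) * conj (z : ℂ) + p.2) ^ (-s))

lemma norm_pairTerm (κ : ℕ+ → ℤ → ℂ) (r s : ℤ) (z : ℍ) (p : ℕ+ × ℤ) :
    ‖pairTerm κ r s z p‖ = ‖κ p.1 p.2‖ * ‖((p.1 : ℕ) : ℂ) * z + p.2‖ ^ (-(r + s)) := by
  have h := linear_ne_zero z (c := (p.1 : ℕ)) (d := p.2) (Or.inl (by exact_mod_cast p.1.ne_zero))
  rw [pairTerm, norm_mul, norm_zpow_mul_zpow (by exact_mod_cast h)]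
  · congr 2
    ring
  · rw [← RCLike.norm_conj]
    simp

/-- Since `c y ≤ |c z + d|`, a coefficient of size `O(c)` costs one power of `|c z + d|`, leaving
exponent at least `3` in a sum over the lattice. -/
lemma summable_pairTerm {κ : ℕ+ → ℤ → ℂ} {C : ℝ} (hC : ∀ c d, ‖κ c d‖ ≤ C * (c : ℕ)) {r s : ℤ}
    (h : 4 ≤ r + s) (z : ℍ) : Summable (pairTerm κ r s z) := by
  have hinj : Function.Injective (fun p : ℕ+ × ℤ => (((p.1 : ℕ) : ℤ), p.2)) := by
    rintro ⟨a, b⟩ ⟨a', b'⟩ h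
    simp at h
    simp [h.1, h.2]
  have h1 := ((summable_norm_linear (w := r + s - 1) (by linarith) z).comp_injective hinj).mul_left
    (C / z.im)
  refine Summable.of_norm_bounded h1 fun p => ?_
  have hne : (0 : ℝ) < ‖((p.1 : ℕ) : ℂ) * z + p.2‖ := by
    have h := linear_ne_zero z (c := (p.1 : ℕ)) (d := p.2) (Or.inl (by exact_mod_cast p.1.ne_zero))
    simpa using h
  have hC0 : 0 ≤ C := by
    have := (norm_nonneg _).trans (hC 1 0)
    simpa using this
  have hle := abs_mul_im_le z (p.1 : ℕ) p.2
  simp only [Int.cast_natCast, Nat.abs_cast] at hle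
  rw [norm_pairTerm]
  simp only [Function.comp, Int.cast_natCast]
  rw [show -(r + s - 1) = -(r + s) + 1 by ring, zpow_add_one₀ hne.ne']
  have hz := z.im_pos
  calc _ ≤ C * (p.1 : ℕ) * ‖((p.1 : ℕ) : ℂ) * z + p.2‖ ^ (-(r + s)) := by
        gcongr
        exact hC _ _
    _ = C / z.im * (‖((p.1 : ℕ) : ℂ) * z + p.2‖ ^ (-(r + s)) * ((p.1 : ℕ) * z.im)) := by
        field_simp
    _ ≤ _ := by gcongr

/-- The decomposition `d = l c + d₀` of the second entry of a pair. -/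
def pairEquiv : (Σ c : ℕ+, Fin (c : ℕ)) × ℤ ≃ ℕ+ × ℤ :=
  ((Equiv.sigmaProdDistrib _ _).trans (Equiv.sigmaCongrRight fun c : ℕ+ =>
    (Equiv.prodComm _ _).trans (Int.divModEquiv (c : ℕ)).symm)).trans (Equiv.sigmaEquivProd _ _)

lemma pairEquiv_apply (i : Σ c : ℕ+, Fin (c : ℕ)) (l : ℤ) :
    pairEquiv (i, l) = (i.1, l * (i.1 : ℕ) + (i.2 : ℕ)) := rfl

/-- With `d = l c + d₀`, `c z + d = c (z + d₀/c + l)` and `κ` does not see `l`. The sum over `l` is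
therefore `lipSum` at the translate by `d₀/c`, with weight `κ(c, d₀) c ^ (-(r+s))`. The weights are
summable: `c` residues, each contributing `O(c · c ^ (-4))`, give `O(c ^ (-2))`. -/
lemma pairSum_mem {κ : ℕ+ → ℤ → ℂ} (hκ : ∀ (c : ℕ+) (d l : ℤ), κ c (l * (c : ℕ) + d) = κ c d)
    {C : ℝ} (hC : ∀ c d, ‖κ c d‖ ≤ C * (c : ℕ)) {r s : ℤ} (h : 4 ≤ r + s) :
    (fun z => ∑' p, pairTerm κ r s z p) ∈ pureMixed := by
  have hC0 : 0 ≤ C := by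
    have := (norm_nonneg _).trans (hC 1 0)
    simpa using this
  set w : (Σ c : ℕ+, Fin (c : ℕ)) → ℂ := fun i =>
    κ i.1 (i.2 : ℕ) * ((i.1 : ℕ) : ℂ) ^ (-(r + s)) with hw_def
  have hw : Summable fun i => ‖w i‖ := by
    refine (summable_sigma_of_nonneg fun _ => norm_nonneg _).2 ⟨fun c => Summable.of_finite, ?_⟩
    have h2 : Summable fun c : ℕ+ => C * (((c : ℕ) : ℝ) ^ 2)⁻¹ :=
      ((Real.summable_nat_pow_inv.2 one_lt_two).comp_injective PNat.coe_injective).mul_left C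
    refine Summable.of_nonneg_of_le (fun c => tsum_nonneg fun _ => norm_nonneg _) (fun c => ?_) h2
    have hc : (1 : ℝ) ≤ (c : ℕ) := by exact_mod_cast (one_le : 1 ≤ c)
    rw [tsum_fintype]
    calc _ ≤ ∑ _d : Fin (c : ℕ), C * (c : ℕ) * ((c : ℕ) : ℝ) ^ (-4 : ℤ) := by
          refine Finset.sum_le_sum fun d _ => ?_
          rw [norm_mul, norm_zpow, Complex.norm_natCast]
          have := hC c (d : ℕ)
          have h4 : ((c : ℕ) : ℝ) ^ (-(r + s)) ≤ ((c : ℕ) : ℝ) ^ (-4 : ℤ) :=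
            zpow_le_zpow_right₀ hc (by linarith)
          gcongr
      _ = _ := by
          rw [Finset.sum_const, Finset.card_univ, Fintype.card_fin, nsmul_eq_mul, zpow_neg,
            show (4 : ℤ) = ((4 : ℕ) : ℤ) from rfl, zpow_natCast]
          field_simp
  convert (pureMixed_average hw (fun i => ((i.2 : ℕ) : ℝ) / (i.1 : ℕ))
    (lipSum_mem (r := r) (s := s) (by linarith))).2 using 2 with z
  rw [← pairEquiv.tsum_eq]
  refine ((pairEquiv.summable_iff.2 (summable_pairTerm hC h z)).tsum_prod).trans ?_
  refine tsum_congr fun i => ?_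
  simp only [Function.comp]
  rw [lipSum, ← tsum_mul_left]
  refine tsum_congr fun l => ?_
  have hc : ((i.1 : ℕ) : ℂ) ≠ 0 := by exact_mod_cast i.1.ne_zero
  have e : ∀ v : ℂ, ((i.1 : ℕ) : ℂ) * v + (l * (i.1 : ℕ) + (i.2 : ℕ)) =
      ((i.1 : ℕ) : ℂ) * (((i.2 : ℕ) : ℂ) / (i.1 : ℕ) + v + l) := fun v => by
    field_simp
    ring
  rw [pairEquiv_apply, pairTerm, hκ]
  simp only [coe_vadd, map_add, Complex.conj_ofReal, hw_def]
  push_cast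
  rw [e, e, mul_zpow, mul_zpow, neg_add, zpow_add₀ hc]
  ring

/-! ### Iterated integrals of `q`-series along vertical half-lines -/

lemma DiscHol.exists_factor {A : ℂ → ℂ} (hA : DiscHol A) (h0 : A 0 = 0) :
    ∃ B, DiscHol B ∧ ∀ q, A q = q * B q := by
  refine ⟨dslope A 0, (Complex.differentiableOn_dslope (ball_mem_nhds 0 one_pos)).2 hA, fun q => ?_⟩
  have := sub_smul_dslope A 0 q
  simp only [sub_zero, smul_eq_mul, h0] at this
  exact this.symm

/-- The primitive of `A(q) dq / q` that vanishes at the origin. -/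
lemma DiscHol.exists_primitive {A : ℂ → ℂ} (hA : DiscHol A) (h0 : A 0 = 0) :
    ∃ H, DiscHol H ∧ H 0 = 0 ∧ ∀ q ∈ ball (0 : ℂ) 1, ∃ D, HasDerivAt H D q ∧ q * D = A q := by
  obtain ⟨B, hB, hAB⟩ := hA.exists_factor h0
  obtain ⟨H, hH0, hH⟩ := (DifferentiableOn.isExactOn_ball hB).with_val_at 0 0
  exact ⟨H, fun q hq => (hH q hq).differentiableAt.differentiableWithinAt, hH0,
    fun q hq => ⟨B q, hH q hq, (hAB q).symm⟩⟩

/-- `q` at the point `z + i t`, where `q` is its value at `z`. -/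
def qshift (q : ℂ) (t : ℝ) : ℂ := q * Real.exp (-(2 * Real.pi) * t)

lemma norm_qshift (q : ℂ) (t : ℝ) : ‖qshift q t‖ = ‖q‖ * Real.exp (-(2 * Real.pi) * t) := by
  rw [qshift, norm_mul, Complex.norm_real, Real.norm_of_nonneg (Real.exp_pos _).le]

lemma norm_qshift_le (q : ℂ) {t : ℝ} (ht : 0 ≤ t) : ‖qshift q t‖ ≤ ‖q‖ := by
  rw [norm_qshift]
  refine mul_le_of_le_one_right (norm_nonneg _) (Real.exp_le_one_iff.2 ?_)
  have := Real.pi_pos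
  nlinarith

lemma qshift_mem {q : ℂ} (hq : q ∈ ball (0 : ℂ) 1) {t : ℝ} (ht : 0 ≤ t) :
    qshift q t ∈ ball (0 : ℂ) 1 := by
  rw [mem_ball_zero_iff] at hq ⊢
  exact (norm_qshift_le q ht).trans_lt hq

lemma hasDerivAt_qshift (q : ℂ) (t : ℝ) :
    HasDerivAt (qshift q) (-(2 * Real.pi) * qshift q t) t := by
  have h1 : HasDerivAt (fun t : ℝ => Real.exp (-(2 * Real.pi) * t))
      (Real.exp (-(2 * Real.pi) * t) * (-(2 * Real.pi))) t := by
    simpa using ((hasDerivAt_id t).const_mul (-(2 * Real.pi))).exp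
  have h2 := (h1.ofReal_comp).const_mul q
  refine h2.congr_deriv ?_
  simp only [qshift]
  push_cast
  ring

lemma continuous_qshift (q : ℂ) : Continuous (qshift q) :=
  continuous_iff_continuousAt.2 fun t => (hasDerivAt_qshift q t).continuousAt

lemma DiscHol.continuousOn_qshift {A : ℂ → ℂ} (hA : DiscHol A) {q : ℂ}
    (hq : q ∈ ball (0 : ℂ) 1) : ContinuousOn (fun t : ℝ => A (qshift q t)) (Set.Ici 0) :=
  hA.continuousOn.comp (continuous_qshift q).continuousOn fun _ ht => qshift_mem hq ht

/-- Vanishing at the origin lets a factor `q` be split off, and that factor carries the exponential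
decay in `t`. -/
lemma DiscHol.norm_qshift_le {A : ℂ → ℂ} (hA : DiscHol A) (h0 : A 0 = 0) {q : ℂ}
    (hq : q ∈ ball (0 : ℂ) 1) :
    ∃ M, ∀ t : ℝ, 0 ≤ t → ‖A (qshift q t)‖ ≤ M * Real.exp (-(2 * Real.pi) * t) := by
  obtain ⟨B, hB, hAB⟩ := hA.exists_factor h0
  obtain ⟨M, hM⟩ := hB.exists_bound (mem_ball_zero_iff.1 hq)
  refine ⟨‖q‖ * M, fun t ht => ?_⟩
  rw [hAB, norm_mul, norm_qshift, mul_right_comm]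
  exact mul_le_mul_of_nonneg_right
    (mul_le_mul_of_nonneg_left (hM _ (ModIter.norm_qshift_le q ht)) (norm_nonneg _))
    (Real.exp_pos _).le

lemma DiscHol.integrableOn_pow {A : ℂ → ℂ} (hA : DiscHol A) (h0 : A 0 = 0) {q : ℂ}
    (hq : q ∈ ball (0 : ℂ) 1) (e : ℕ) :
    IntegrableOn (fun t : ℝ => A (qshift q t) * (t : ℂ) ^ e) (Set.Ioi 0) := by
  obtain ⟨M, hM⟩ := hA.norm_qshift_le h0 hq
  have h1 : IntegrableOn (fun t : ℝ => t ^ (e : ℝ) * Real.exp (-(2 * Real.pi) * t ^ (1 : ℝ)))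
      (Set.Ioi 0) := by
    refine integrableOn_rpow_mul_exp_neg_mul_rpow ?_ one_pos (by positivity)
    have : (0 : ℝ) ≤ e := by positivity
    linarith
  refine Integrable.mono' (h1.const_mul M) ?_ ?_
  · refine ContinuousOn.aestronglyMeasurable ?_ measurableSet_Ioi
    exact ((hA.continuousOn_qshift hq).mono Set.Ioi_subset_Ici_self).mul (by fun_prop)
  · filter_upwards [ae_restrict_mem measurableSet_Ioi] with t ht
    have ht' : (0 : ℝ) < t := ht
    rw [norm_mul, norm_pow, Complex.norm_real, Real.norm_of_nonneg ht'.le, Real.rpow_natCast,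
      Real.rpow_one]
    calc _ ≤ M * Real.exp (-(2 * Real.pi) * t) * t ^ e := by
          gcongr
          exact hM t ht'.le
      _ = _ := by ring

lemma DiscHol.integrableOn_polynomial {A : ℂ → ℂ} (hA : DiscHol A) (h0 : A 0 = 0) {q : ℂ}
    (hq : q ∈ ball (0 : ℂ) 1) (P : Polynomial ℂ) :
    IntegrableOn (fun t : ℝ => A (qshift q t) * P.eval (t : ℂ)) (Set.Ioi 0) := by
  simp only [Polynomial.eval_eq_sum_range, Finset.mul_sum]
  refine integrable_finsetSum _ fun e _ => ?_
  refine ((hA.integrableOn_pow h0 hq e).const_mul (P.coeff e)).congr (Eventually.of_forall fun t => ?_)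
  simp only
  ring

/-- `∫_0^∞ A(q(z + i t)) t ^ e dt`. -/
def discInt (A : ℂ → ℂ) (e : ℕ) (q : ℂ) : ℂ :=
  ∫ t in Set.Ioi (0 : ℝ), A (qshift q t) * (t : ℂ) ^ e

lemma tendsto_qshift_pow {H : ℂ → ℂ} (hH : DiscHol H) (h0 : H 0 = 0) {q : ℂ}
    (hq : q ∈ ball (0 : ℂ) 1) (e : ℕ) :
    Tendsto (fun t : ℝ => H (qshift q t) * (t : ℂ) ^ e) atTop (𝓝 0) := by
  obtain ⟨M, hM⟩ := hH.norm_qshift_le h0 hq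
  have h1 : Tendsto (fun t : ℝ => M * (t ^ e * Real.exp (-(2 * Real.pi) * t))) atTop (𝓝 0) := by
    simpa using (tendsto_rpow_mul_exp_neg_mul_atTop_nhds_zero (e : ℝ) (2 * Real.pi)
      (by positivity)).const_mul M
  refine squeeze_zero_norm' ?_ h1
  filter_upwards [eventually_ge_atTop 0] with t ht
  rw [norm_mul, norm_pow, Complex.norm_real, Real.norm_of_nonneg ht]
  calc _ ≤ M * Real.exp (-(2 * Real.pi) * t) * t ^ e := by
        gcongr
        exact hM t ht
    _ = _ := by ring

lemma hasDerivAt_comp_qshift {H : ℂ → ℂ} {q D a : ℂ} {t : ℝ} (hD : HasDerivAt H D (qshift q t))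
    (ha : qshift q t * D = a) :
    HasDerivAt (fun t : ℝ => H (qshift q t)) (-(2 * Real.pi) * a) t := by
  have := HasDerivAt.comp_of_eq (h₂ := H) t hD (hasDerivAt_qshift q t) rfl
  refine this.congr_deriv ?_
  rw [← ha]
  ring

section primitive

variable {A H : ℂ → ℂ} (hA : DiscHol A) (hA0 : A 0 = 0) (hH : DiscHol H) (hH0 : H 0 = 0)
  (hHA : ∀ q ∈ ball (0 : ℂ) 1, ∃ D, HasDerivAt H D q ∧ q * D = A q)

include hA hA0 hH hH0 hHA

lemma discInt_zero {q : ℂ} (hq : q ∈ ball (0 : ℂ) 1) : discInt A 0 q = H q / (2 * Real.pi) := by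
  have h1 : ∀ t ∈ Set.Ici (0 : ℝ), HasDerivAt (fun t : ℝ => H (qshift q t))
      (-(2 * Real.pi) * A (qshift q t)) t := by
    intro t ht
    obtain ⟨D, hD, hD'⟩ := hHA _ (qshift_mem hq ht)
    exact hasDerivAt_comp_qshift hD hD'
  have h2 := hA.integrableOn_pow hA0 hq 0
  have h3 := tendsto_qshift_pow hH hH0 hq 0
  simp only [pow_zero, mul_one] at h2 h3
  have h4 := integral_Ioi_of_hasDerivAt_of_tendsto' h1 (h2.const_mul _) h3
  rw [integral_const_mul] at h4
  simp only [discInt, pow_zero, mul_one]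
  have h5 : qshift q 0 = q := by simp [qshift]
  rw [h5] at h4
  have hpi : (Real.pi : ℂ) ≠ 0 := by exact_mod_cast Real.pi_ne_zero
  field_simp
  linear_combination -h4

/-- Integration by parts: along the half-line, `H` has `t`-derivative `-2π A`, and the boundary
terms vanish at `0` because of `t ^ (e+1)` and at infinity by exponential decay. -/
lemma discInt_succ (e : ℕ) {q : ℂ} (hq : q ∈ ball (0 : ℂ) 1) :
    discInt A (e + 1) q = (e + 1) / (2 * Real.pi) * discInt H e q := by
  have hpi : (Real.pi : ℂ) ≠ 0 := by exact_mod_cast Real.pi_ne_zero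
  have h1 : ∀ t ∈ Set.Ici (0 : ℝ), HasDerivAt (fun t : ℝ => H (qshift q t) * (t : ℂ) ^ (e + 1))
      (-(2 * Real.pi) * (A (qshift q t) * (t : ℂ) ^ (e + 1)) +
        (e + 1) * (H (qshift q t) * (t : ℂ) ^ e)) t := by
    intro t ht
    obtain ⟨D, hD, hD'⟩ := hHA _ (qshift_mem hq ht)
    have h2 := (hasDerivAt_comp_qshift hD hD').mul ((hasDerivAt_id t).ofReal_comp.pow (e + 1))
    refine h2.congr_deriv ?_
    simp
    ring
  have h2 := hA.integrableOn_pow hA0 hq (e + 1)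
  have h2' := hH.integrableOn_pow hH0 hq e
  have h3 := tendsto_qshift_pow hH hH0 hq (e + 1)
  have h4 := integral_Ioi_of_hasDerivAt_of_tendsto' h1
    ((h2.const_mul _).add (h2'.const_mul _)) h3
  rw [integral_add (h2.const_mul _) (h2'.const_mul _), integral_const_mul, integral_const_mul] at h4
  simp only [Complex.ofReal_zero, ne_eq, Nat.succ_ne_zero, not_false_eq_true, zero_pow, mul_zero,
    sub_zero] at h4
  simp only [discInt]
  field_simp
  linear_combination -h4

end primitive

lemma discHol_congr {A B : ℂ → ℂ} (hA : DiscHol A) (h : ∀ q ∈ ball (0 : ℂ) 1, B q = A q) :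
    DiscHol B :=
  DifferentiableOn.congr hA h

/-- The induction must quantify over `A`, because each integration by parts replaces `A` by its
primitive `H`. -/
lemma discInt_discHol (e : ℕ) : ∀ {A : ℂ → ℂ}, DiscHol A → A 0 = 0 → DiscHol (discInt A e) := by
  induction e with
  | zero =>
    intro A hA h0
    obtain ⟨H, hH, hH0, hHA⟩ := hA.exists_primitive h0
    exact discHol_congr (hH.div_const _) fun q hq => discInt_zero hA h0 hH hH0 hHA hq
  | succ e ih =>
    intro A hA h0
    obtain ⟨H, hH, hH0, hHA⟩ := hA.exists_primitive h0
    exact discHol_congr ((ih hH hH0).const_mul _) fun q hq => discInt_succ hA h0 hH hH0 hHA e hq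

lemma hasDerivAt_discInt_zero {A : ℂ → ℂ} (hA : DiscHol A) (hA0 : A 0 = 0) {q : ℂ}
    (hq : q ∈ ball (0 : ℂ) 1) :
    ∃ D, HasDerivAt (discInt A 0) D q ∧ 2 * Real.pi * (q * D) = A q := by
  have hpi : (Real.pi : ℂ) ≠ 0 := by exact_mod_cast Real.pi_ne_zero
  obtain ⟨H, hH, hH0, hHA⟩ := hA.exists_primitive hA0
  obtain ⟨D, hD, hD'⟩ := hHA q hq
  refine ⟨D / (2 * Real.pi), (hD.div_const _).congr_of_eventuallyEq ?_, ?_⟩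
  · filter_upwards [isOpen_ball.mem_nhds hq] with x hx using discInt_zero hA hA0 hH hH0 hHA hx
  · rw [← hD']
    field_simp

/-- The operator `2π q d/dq` lowers the exponent of `t` by one. This is the relation behind the
telescoping in `hasDerivAt_eval_eichlerPlus`. -/
lemma hasDerivAt_discInt_succ (e : ℕ) : ∀ {A : ℂ → ℂ}, DiscHol A → A 0 = 0 → ∀ {q : ℂ},
    q ∈ ball (0 : ℂ) 1 →
    ∃ D, HasDerivAt (discInt A (e + 1)) D q ∧ 2 * Real.pi * (q * D) = (e + 1) * discInt A e q := by
  have hpi : (Real.pi : ℂ) ≠ 0 := by exact_mod_cast Real.pi_ne_zero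
  induction e with
  | zero =>
    intro A hA hA0 q hq
    obtain ⟨H, hH, hH0, hHA⟩ := hA.exists_primitive hA0
    obtain ⟨D, hD, hD'⟩ := hasDerivAt_discInt_zero hH hH0 hq
    refine ⟨_, (hD.const_mul ((((0 : ℕ) : ℂ) + 1) / (2 * Real.pi))).congr_of_eventuallyEq ?_, ?_⟩
    · filter_upwards [isOpen_ball.mem_nhds hq] with x hx using discInt_succ hA hA0 hH hH0 hHA 0 hx
    · rw [discInt_zero hA hA0 hH hH0 hHA hq, ← hD']
      field_simp
  | succ e ih =>
    intro A hA hA0 q hq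
    obtain ⟨H, hH, hH0, hHA⟩ := hA.exists_primitive hA0
    obtain ⟨D, hD, hD'⟩ := ih hH hH0 hq
    refine ⟨_, (hD.const_mul ((((e + 1 : ℕ) : ℂ) + 1) / (2 * Real.pi))).congr_of_eventuallyEq ?_, ?_⟩
    · filter_upwards [isOpen_ball.mem_nhds hq] with x hx using
        discInt_succ hA hA0 hH hH0 hHA (e + 1) hx
    · rw [discInt_succ hA hA0 hH hH0 hHA e hq]
      field_simp
      linear_combination ((e + 1 : ℕ) + 1 : ℂ) * hD'

/-! ### Eichler integrals of cusp forms -/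

/-- The `q`-series of a cusp form. -/
def cuspDisc {k : ℤ} (f : CuspForm 𝒮ℒ k) : ℂ → ℂ := cuspFunction 1 f

section

variable {k : ℤ} (f : CuspForm 𝒮ℒ k)

lemma cuspDisc_discHol : DiscHol (cuspDisc f) := fun q hq =>
  (ModularFormClass.differentiableAt_cuspFunction f one_pos one_mem_strictPeriods_SL
    (by simpa using hq)).differentiableWithinAt

lemma cuspDisc_zero : cuspDisc f 0 = 0 :=
  CuspFormClass.cuspFunction_apply_zero f one_pos one_mem_strictPeriods_SL

lemma cuspDisc_qpar (z : ℍ) : cuspDisc f (qpar z) = f z := by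
  rw [← SlashInvariantFormClass.eq_cuspFunction f z one_mem_strictPeriods_SL one_ne_zero, cuspDisc,
    qpar, Function.Periodic.qParam]
  simp

lemma apply_ofComplex_shift (z : ℍ) {t : ℝ} (ht : 0 ≤ t) :
    f (ofComplex ((z : ℂ) + Complex.I * t)) = cuspDisc f (qshift (qpar z) t) := by
  have him : 0 < ((z : ℂ) + Complex.I * t).im := by
    have := z.im_pos
    simp
    linarith
  rw [ofComplex_apply_of_im_pos him, ← cuspDisc_qpar]
  congr 1
  rw [qshift, qpar, qpar, Complex.ofReal_exp, ← Complex.exp_add]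
  congr 1
  push_cast
  linear_combination 2 * Real.pi * t * Complex.I_sq

lemma integralFromCusp_eq (p : ℂ → ℂ) (z : ℍ) :
    integralFromCusp (fun w => f (ofComplex w) * p w) z = -Complex.I *
      ∫ t in Set.Ioi (0 : ℝ), cuspDisc f (qshift (qpar z) t) * p ((z : ℂ) + Complex.I * t) := by
  rw [integralFromCusp]
  congr 1
  refine setIntegral_congr_fun measurableSet_Ioi fun t ht => ?_
  rw [apply_ofComplex_shift f z (le_of_lt ht)]

lemma integrableOn_of_polynomial (z : ℍ) (P : Polynomial ℂ) {g : ℝ → ℂ}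
    (hg : ∀ t : ℝ, g t = P.eval (t : ℂ)) :
    IntegrableOn (fun t : ℝ => cuspDisc f (qshift (qpar z) t) * g t) (Set.Ioi 0) := by
  simp only [hg]
  exact (cuspDisc_discHol f).integrableOn_polynomial (cuspDisc_zero f) (qpar_mem_ball z) P

end

lemma coeff_C_sub_X_pow (w : ℂ) (n m : ℕ) :
    ((Polynomial.C w - Polynomial.X) ^ n).coeff m = (-1) ^ n * ((-w) ^ (n - m) * (n.choose m : ℂ)) := by
  rw [← neg_sub, neg_pow, show (-1 : Polynomial ℂ) ^ n = Polynomial.C ((-1) ^ n) by simp,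
    Polynomial.coeff_C_mul, sub_eq_add_neg, ← Polynomial.C_neg, Polynomial.coeff_X_add_C_pow]

section

variable {k : ℕ} (f : CuspForm 𝒮ℒ (k : ℤ))

lemma eval_eichlerPlus (hk : 2 ≤ k) (z : ℍ) (X : ℂ) : (eichlerPlus f z).eval X =
    -Complex.I * ∫ t in Set.Ioi (0 : ℝ),
      cuspDisc f (qshift (qpar z) t) * ((z : ℂ) + Complex.I * t - X) ^ (k - 2) := by
  have e : ∀ (m : ℕ) (t : ℝ),
      ((Polynomial.C ((z : ℂ) + Complex.I * t) - Polynomial.X) ^ (k - 2)).coeff m * X ^ m =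
      (Polynomial.C ((-1) ^ (k - 2) * ((k - 2).choose m : ℂ) * X ^ m) *
        (-(Polynomial.C (z : ℂ) + Polynomial.C Complex.I * Polynomial.X)) ^ (k - 2 - m)).eval
          (t : ℂ) := by
    intro m t
    rw [coeff_C_sub_X_pow]
    simp
    ring
  have h1 : (eichlerPlus f z).eval X = ∑ m ∈ Finset.range (k - 1), -Complex.I *
      ∫ t in Set.Ioi (0 : ℝ), cuspDisc f (qshift (qpar z) t) *
        (((Polynomial.C ((z : ℂ) + Complex.I * t) - Polynomial.X) ^ (k - 2)).coeff m * X ^ m) := by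
    rw [eichlerPlus, Polynomial.eval_finsetSum]
    refine Finset.sum_congr rfl fun m _ => ?_
    rw [Polynomial.eval_monomial, integralFromCusp_eq, mul_assoc, ← integral_mul_const]
    simp only [mul_assoc]
  rw [h1, ← Finset.mul_sum, ← integral_finsetSum _ fun m _ => integrableOn_of_polynomial f z _ (e m)]
  congr 2
  funext t
  rw [← Finset.mul_sum, show k - 1 = k - 2 + 1 by omega, ← Polynomial.eval_eq_sum_range']
  · simp
  · have h2 : (Polynomial.C ((z : ℂ) + Complex.I * t) - Polynomial.X).natDegree ≤ 1 := by
      rw [Polynomial.natDegree_sub]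
      exact Polynomial.natDegree_X_sub_C_le _
    exact Nat.lt_succ_of_le (Polynomial.natDegree_pow_le.trans
      ((Nat.mul_le_mul_left _ h2).trans_eq (mul_one _)))

/-- The coefficient functions of `F_f^+`. -/
def seed (i : ℕ) (z : ℍ) : ℂ := expCoeff (k - 2) (eichlerPlus f z) i z

lemma eichlerPlus_natDegree (hk : 2 ≤ k) (z : ℍ) : (eichlerPlus f z).natDegree ≤ k - 2 := by
  refine Polynomial.natDegree_sum_le_of_forall_le _ _ fun m hm => ?_
  have := Finset.mem_range.1 hm
  exact (Polynomial.natDegree_monomial_le _).trans (by omega)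

/-- With `w = z + it` one has `w - z = it`, `w - z̄ = i(t + 2y)` and `(z - z̄)(w - X) = (X - z̄)(w -
z) - (X - z)(w - z̄)`. The binomial theorem for the power `k - 2` exhibits the expansion, and
uniqueness identifies its coefficients. -/
lemma seed_eq_integral (hk : 2 ≤ k) {i : ℕ} (hi : i ≤ k - 2) (z : ℍ) : seed f i z =
    (2 * Complex.I * z.im) ^ (-((k - 2 : ℕ) : ℤ)) * ((-1) ^ i * ((k - 2).choose i : ℂ)) *
      (-Complex.I * ∫ t in Set.Ioi (0 : ℝ), cuspDisc f (qshift (qpar z) t) *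
        ((Complex.I * t) ^ (k - 2 - i) * (Complex.I * (t + 2 * z.im)) ^ i)) := by
  symm
  refine expCoeff_unique (k - 2) z (fun i => (2 * Complex.I * z.im) ^ (-((k - 2 : ℕ) : ℤ)) *
    ((-1) ^ i * ((k - 2).choose i : ℂ)) *
      (-Complex.I * ∫ t in Set.Ioi (0 : ℝ), cuspDisc f (qshift (qpar z) t) *
        ((Complex.I * t) ^ (k - 2 - i) * (Complex.I * (t + 2 * z.im)) ^ i))) ?_ hi
  refine Polynomial.funext fun X => ?_
  have hy : (2 * Complex.I * z.im : ℂ) ≠ 0 := by simp [im_ne_zero z]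
  have e : ∀ (i : ℕ) (t : ℝ), (2 * Complex.I * z.im) ^ (-((k - 2 : ℕ) : ℤ)) *
        ((-1) ^ i * ((k - 2).choose i : ℂ)) *
        ((Complex.I * t) ^ (k - 2 - i) * (Complex.I * (t + 2 * z.im)) ^ i) *
        ((X - z) ^ i * (X - conj (z : ℂ)) ^ (k - 2 - i)) =
      (Polynomial.C ((2 * Complex.I * z.im) ^ (-((k - 2 : ℕ) : ℤ)) *
        ((-1) ^ i * ((k - 2).choose i : ℂ)) * ((X - z) ^ i * (X - conj (z : ℂ)) ^ (k - 2 - i))) *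
        ((Polynomial.C Complex.I * Polynomial.X) ^ (k - 2 - i) *
          (Polynomial.C Complex.I * (Polynomial.X + Polynomial.C (2 * z.im : ℂ))) ^ i)).eval
            (t : ℂ) := by
    intro i t
    simp only [Polynomial.eval_mul, Polynomial.eval_C, Polynomial.eval_pow, Polynomial.eval_X,
      Polynomial.eval_add]
    ring
  rw [eval_eichlerPlus f hk, Polynomial.eval_finsetSum]
  have h1 : ∀ i ∈ Finset.range (k - 2 + 1), (Polynomial.C ((2 * Complex.I * z.im) ^ (-((k - 2 : ℕ) : ℤ)) *
    ((-1) ^ i * ((k - 2).choose i : ℂ)) *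
      (-Complex.I * ∫ t in Set.Ioi (0 : ℝ), cuspDisc f (qshift (qpar z) t) *
        ((Complex.I * t) ^ (k - 2 - i) * (Complex.I * (t + 2 * z.im)) ^ i))) *
      (Polynomial.X - Polynomial.C (z : ℂ)) ^ i *
      (Polynomial.X - Polynomial.C (conj (z : ℂ))) ^ (k - 2 - i)).eval X =
      -Complex.I * ∫ t in Set.Ioi (0 : ℝ), cuspDisc f (qshift (qpar z) t) *
        ((2 * Complex.I * z.im) ^ (-((k - 2 : ℕ) : ℤ)) *
        ((-1) ^ i * ((k - 2).choose i : ℂ)) *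
        ((Complex.I * t) ^ (k - 2 - i) * (Complex.I * (t + 2 * z.im)) ^ i) *
        ((X - z) ^ i * (X - conj (z : ℂ)) ^ (k - 2 - i))) := by
    intro i _
    simp only [Polynomial.eval_mul, Polynomial.eval_C, Polynomial.eval_pow, Polynomial.eval_X,
      Polynomial.eval_sub]
    have e2 : ∀ t : ℝ, cuspDisc f (qshift (qpar z) t) *
        ((2 * Complex.I * z.im) ^ (-((k - 2 : ℕ) : ℤ)) *
        ((-1) ^ i * ((k - 2).choose i : ℂ)) *
        ((Complex.I * t) ^ (k - 2 - i) * (Complex.I * (t + 2 * z.im)) ^ i) *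
        ((X - z) ^ i * (X - conj (z : ℂ)) ^ (k - 2 - i))) =
        ((2 * Complex.I * z.im) ^ (-((k - 2 : ℕ) : ℤ)) *
        ((-1) ^ i * ((k - 2).choose i : ℂ)) * ((X - z) ^ i * (X - conj (z : ℂ)) ^ (k - 2 - i))) *
        (cuspDisc f (qshift (qpar z) t) *
        ((Complex.I * t) ^ (k - 2 - i) * (Complex.I * (t + 2 * z.im)) ^ i)) := fun t => by ring
    simp only [e2]
    rw [integral_const_mul]
    ring
  rw [Finset.sum_congr rfl h1, ← Finset.mul_sum,
    ← integral_finsetSum _ fun i _ => integrableOn_of_polynomial f z _ (e i)]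
  congr 2
  funext t
  rw [← Finset.mul_sum]
  congr 1
  have h2 : (2 * Complex.I * z.im) * ((z : ℂ) + Complex.I * t - X) =
      -((X - z) * (Complex.I * (t + 2 * z.im))) + (X - conj (z : ℂ)) * (Complex.I * t) := by
    linear_combination (-Complex.I * t) * sub_conj_eq z
  have h3 : ((z : ℂ) + Complex.I * t - X) ^ (k - 2) = (2 * Complex.I * z.im) ^ (-((k - 2 : ℕ) : ℤ)) *
      ((2 * Complex.I * z.im) * ((z : ℂ) + Complex.I * t - X)) ^ (k - 2) := by
    rw [mul_pow, zpow_neg, zpow_natCast, inv_mul_cancel_left₀ (pow_ne_zero _ hy)]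
  rw [h3, h2, add_pow, Finset.mul_sum]
  refine Finset.sum_congr rfl fun i _ => ?_
  rw [neg_pow, mul_pow (X - (z : ℂ)), mul_pow (X - conj (z : ℂ))]
  ring

lemma seed_eq_sum (hk : 2 ≤ k) {i : ℕ} (hi : i ≤ k - 2) (z : ℍ) : seed f i z =
    ∑ b ∈ Finset.range (i + 1), ((2 * Complex.I) ^ (-((k - 2 : ℕ) : ℤ)) *
      ((-1) ^ i * ((k - 2).choose i : ℂ)) * -Complex.I * Complex.I ^ (k - 2) * 2 ^ (i - b) *
        (i.choose b : ℂ)) *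
      ((z.im : ℂ) ^ (((i - b : ℕ) : ℤ) - ((k - 2 : ℕ) : ℤ)) *
        discInt (cuspDisc f) (k - 2 - i + b) (qpar z)) := by
  have e : ∀ t : ℝ, cuspDisc f (qshift (qpar z) t) *
        ((Complex.I * t) ^ (k - 2 - i) * (Complex.I * (t + 2 * z.im)) ^ i) =
      ∑ b ∈ Finset.range (i + 1), (Complex.I ^ (k - 2) * (2 * z.im) ^ (i - b) * (i.choose b : ℂ)) *
        (cuspDisc f (qshift (qpar z) t) * (t : ℂ) ^ (k - 2 - i + b)) := by
    intro t
    rw [mul_pow, mul_pow, add_pow]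
    simp only [Finset.mul_sum]
    refine Finset.sum_congr rfl fun b _ => ?_
    have : Complex.I ^ (k - 2) = Complex.I ^ (k - 2 - i) * Complex.I ^ i := by
      rw [← pow_add]
      congr 1
      omega
    rw [this, pow_add]
    ring
  rw [seed_eq_integral f hk hi]
  simp only [e]
  rw [integral_finsetSum _ fun b _ => ((cuspDisc_discHol f).integrableOn_pow (cuspDisc_zero f)
    (qpar_mem_ball z) _).const_mul _, Finset.mul_sum, Finset.mul_sum]
  refine Finset.sum_congr rfl fun b _ => ?_
  rw [integral_const_mul, zpow_sub₀ (im_ne_zero z), mul_zpow, discInt, mul_pow, zpow_natCast,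
    zpow_neg (z.im : ℂ), div_eq_mul_inv]
  ring

lemma seed_mem_mixed (hk : 2 ≤ k) {i : ℕ} (hi : i ≤ k - 2) : seed f i ∈ mixed := by
  rw [funext (seed_eq_sum f hk hi)]
  refine mixed_sum _ fun b _ => mixed_const_mul _ (mixed_mul (mixed_zpow _) (mixed_hol ?_))
  exact discInt_discHol _ (cuspDisc_discHol f) (cuspDisc_zero f)

/-- The explicit formula involves `z` only through `y` and `q`. -/
lemma seed_eq_of_vadd (hk : 2 ≤ k) {i : ℕ} (hi : i ≤ k - 2) {z z' : ℍ} (l : ℤ)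
    (h : (z' : ℂ) = z + l) : seed f i z' = seed f i z := by
  have him : z'.im = z.im := by
    have := congrArg Complex.im h
    simpa using this
  have hq : qpar z' = qpar z := by
    rw [qpar, qpar, h, Complex.exp_eq_exp_iff_exists_int]
    exact ⟨l, by ring⟩
  rw [seed_eq_sum f hk hi, seed_eq_sum f hk hi, him, hq]

/-! ### Growth of the coefficient functions of Eichler integrals -/

/-- One exponent serves both ranges of `y`: for `y ≤ 1` Hecke's bound `y ^ (-k/2)` is stronger
because `k/2 ≤ k - 1/2`, and for `y ≥ 1` exponential decay gives `y ^ (-k)`. The surplus `3/2`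
beyond `k - 2` is what makes the Eichler integral converge with a uniform constant. -/
lemma exists_cusp_bound (hk : 2 ≤ k) :
    ∃ C, 0 ≤ C ∧ ∀ z : ℍ, ‖f z‖ ≤ C * z.im ^ (-((k - 2 : ℕ) : ℝ) - 3 / 2) := by
  obtain ⟨C₀, hC₀⟩ := CuspFormClass.exists_bound f
  obtain ⟨B, hB, hAB⟩ := (cuspDisc_discHol f).exists_factor (cuspDisc_zero f)
  have hlt : Real.exp (-(2 * Real.pi)) < 1 := by
    rw [Real.exp_lt_one_iff]
    have := Real.pi_pos
    linarith
  obtain ⟨M, hM⟩ := hB.exists_bound hlt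
  refine ⟨max |C₀| (|M| * k.factorial), le_max_of_le_left (abs_nonneg _), fun z => ?_⟩
  have hk' : ((k - 2 : ℕ) : ℝ) = k - 2 := by
    rw [Nat.cast_sub hk]
    norm_num
  have hk2 : (2 : ℝ) ≤ k := by exact_mod_cast hk
  have hz := z.im_pos
  rcases le_total z.im 1 with h1 | h1
  · calc ‖f z‖ ≤ C₀ / z.im ^ (((k : ℤ) : ℝ) / 2) := hC₀ z
      _ ≤ |C₀| * z.im ^ (-((k : ℝ) / 2)) := by
          rw [Real.rpow_neg hz.le, div_eq_mul_inv]
          push_cast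
          gcongr
          exact le_abs_self _
      _ ≤ |C₀| * z.im ^ (-((k - 2 : ℕ) : ℝ) - 3 / 2) := by
          refine mul_le_mul_of_nonneg_left ?_ (abs_nonneg _)
          refine Real.rpow_le_rpow_of_exponent_ge hz h1 ?_
          rw [hk']
          linarith
      _ ≤ _ := by
          gcongr
          exact le_max_left _ _
  · have hq : ‖qpar z‖ ≤ Real.exp (-(2 * Real.pi)) := by
      rw [norm_qpar, Real.exp_le_exp]
      have := Real.pi_pos
      nlinarith
    have h2 : Real.exp (-(2 * Real.pi * z.im)) ≤ k.factorial * z.im ^ (-(k : ℝ)) := by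
      have h3 := Real.pow_div_factorial_le_exp (2 * Real.pi * z.im)
        (by have := Real.pi_pos; positivity) k
      rw [div_le_iff₀ (by positivity)] at h3
      have h4 : z.im ^ k ≤ (2 * Real.pi * z.im) ^ k := by
        refine pow_le_pow_left₀ hz.le ?_ k
        have := Real.pi_gt_three
        nlinarith
      rw [Real.exp_neg, Real.rpow_neg hz.le, Real.rpow_natCast, inv_le_iff_one_le_mul₀ (Real.exp_pos _)]
      have h5 : 0 < z.im ^ k := by positivity
      field_simp
      linarith
    calc ‖f z‖ = ‖qpar z‖ * ‖B (qpar z)‖ := by rw [← cuspDisc_qpar, hAB, norm_mul]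
      _ ≤ (k.factorial * z.im ^ (-(k : ℝ))) * |M| := by
          gcongr
          · rw [norm_qpar]
            exact h2
          · exact (hM _ hq).trans (le_abs_self _)
      _ ≤ (k.factorial * z.im ^ (-((k - 2 : ℕ) : ℝ) - 3 / 2)) * |M| := by
          gcongr
          rw [hk']
          linarith
      _ = (|M| * k.factorial) * z.im ^ (-((k - 2 : ℕ) : ℝ) - 3 / 2) := by ring
      _ ≤ _ := by
          gcongr
          exact le_max_right _ _

lemma add_rpow_eq {y t : ℝ} (hy : 0 < y) (ht : 0 ≤ t) :
    (y + t) ^ (-(3 / 2) : ℝ) = y ^ (-(3 / 2) : ℝ) * (1 + y⁻¹ * t) ^ (-(3 / 2) : ℝ) := by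
  rw [← Real.mul_rpow hy.le (by positivity)]
  congr 1
  field_simp

lemma integrableOn_add_rpow {y : ℝ} (hy : 0 < y) :
    IntegrableOn (fun t : ℝ => (y + t) ^ (-(3 / 2) : ℝ)) (Set.Ioi 0) := by
  have := integrableOn_add_rpow_Ioi_of_lt (a := -(3 / 2)) (c := 0) (m := y) (by norm_num) (by linarith)
  simpa only [add_comm] using this

lemma integral_add_rpow {y : ℝ} (hy : 0 < y) :
    ∫ t in Set.Ioi (0 : ℝ), (y + t) ^ (-(3 / 2) : ℝ) =
      y ^ (-(1 / 2) : ℝ) * ∫ t in Set.Ioi (0 : ℝ), (1 + t) ^ (-(3 / 2) : ℝ) := by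
  have h1 : ∫ t in Set.Ioi (0 : ℝ), (y + t) ^ (-(3 / 2) : ℝ) =
      ∫ t in Set.Ioi (0 : ℝ), y ^ (-(3 / 2) : ℝ) * (1 + y⁻¹ * t) ^ (-(3 / 2) : ℝ) :=
    setIntegral_congr_fun measurableSet_Ioi fun t ht => add_rpow_eq hy (le_of_lt ht)
  rw [h1, integral_const_mul, integral_comp_mul_left_Ioi (fun t => (1 + t) ^ (-(3 / 2) : ℝ)) 0
    (inv_pos.2 hy), inv_inv, mul_zero, smul_eq_mul, ← mul_assoc]
  congr 1
  rw [← Real.rpow_add_one hy.ne']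
  norm_num

/-- Both `|w - z|` and `|w - z̄|` are at most `2(y + t)`, so the integrand is `O((y + t) ^ (-3/2))`
and integrates to `O(y ^ (-1/2))`. The prefactor `(2iy) ^ (-(k-2))` supplies the rest. -/
lemma exists_seed_bound (hk : 2 ≤ k) :
    ∃ C, 0 ≤ C ∧ ∀ (i : ℕ), i ≤ k - 2 → ∀ z : ℍ,
      ‖seed f i z‖ ≤ C * z.im ^ (-((k - 2 : ℕ) : ℝ) - 1 / 2) := by
  obtain ⟨C, hC0, hC⟩ := exists_cusp_bound f hk
  set n := k - 2 with hn
  set K := ∫ t in Set.Ioi (0 : ℝ), (1 + t) ^ (-(3 / 2) : ℝ) with hK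
  have hK0 : 0 ≤ K := setIntegral_nonneg measurableSet_Ioi fun t ht => by
    have : (0 : ℝ) < t := ht
    positivity
  refine ⟨2 ^ n * 2 ^ n * (C * K), by positivity, fun i hi z => ?_⟩
  have hy := z.im_pos
  rw [seed_eq_integral f hk hi z]
  have h1 : ‖∫ t in Set.Ioi (0 : ℝ), cuspDisc f (qshift (qpar z) t) *
      ((Complex.I * t) ^ (n - i) * (Complex.I * (t + 2 * z.im)) ^ i)‖ ≤
      ∫ t in Set.Ioi (0 : ℝ), (C * 2 ^ n) * (z.im + t) ^ (-(3 / 2) : ℝ) := by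
    refine norm_integral_le_of_norm_le ((integrableOn_add_rpow hy).const_mul _) ?_
    filter_upwards [ae_restrict_mem measurableSet_Ioi] with t ht
    have ht' : (0 : ℝ) < t := ht
    have hs : 0 < z.im + t := by positivity
    have him : 0 < ((z : ℂ) + Complex.I * t).im := by simpa using hs
    have h2 : ‖cuspDisc f (qshift (qpar z) t)‖ ≤ C * (z.im + t) ^ (-(n : ℝ) - 3 / 2) := by
      rw [← apply_ofComplex_shift f z ht'.le, ofComplex_apply_of_im_pos him]
      refine (hC _).trans_eq ?_
      congr 2
      change ((z : ℂ) + Complex.I * t).im = _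
      simp
    have h3 : ‖(Complex.I * t : ℂ)‖ ≤ 2 * (z.im + t) := by
      rw [norm_mul, Complex.norm_I, one_mul, Complex.norm_real, Real.norm_of_nonneg ht'.le]
      linarith
    have h4 : ‖Complex.I * ((t : ℂ) + 2 * z.im)‖ ≤ 2 * (z.im + t) := by
      rw [norm_mul, Complex.norm_I, one_mul]
      have : ((t : ℂ) + 2 * z.im) = ((t + 2 * z.im : ℝ) : ℂ) := by push_cast; rfl
      rw [this, Complex.norm_real, Real.norm_of_nonneg (by positivity)]
      linarith
    calc _ ≤ (C * (z.im + t) ^ (-(n : ℝ) - 3 / 2)) *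
          ((2 * (z.im + t)) ^ (n - i) * (2 * (z.im + t)) ^ i) := by
          rw [norm_mul, norm_mul, norm_pow, norm_pow]
          gcongr
      _ = C * 2 ^ n * ((z.im + t) ^ (-(n : ℝ) - 3 / 2) * (z.im + t) ^ n) := by
          rw [← pow_add, Nat.sub_add_cancel hi, mul_pow]
          ring
      _ = _ := by
          rw [← Real.rpow_natCast (z.im + t) n, ← Real.rpow_add hs]
          congr 2
          ring
  rw [integral_const_mul, integral_add_rpow hy] at h1
  have h5 : ‖((2 * Complex.I * z.im : ℂ)) ^ (-(n : ℤ))‖ ≤ z.im ^ (-(n : ℝ)) := by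
    rw [norm_zpow, zpow_neg, zpow_natCast, Real.rpow_neg hy.le, Real.rpow_natCast]
    have : ‖(2 * Complex.I * z.im : ℂ)‖ = 2 * z.im := by
      simp [abs_of_pos hy]
    rw [this]
    gcongr
    linarith
  have h6 : ‖((-1) ^ i * (n.choose i : ℂ) : ℂ)‖ ≤ 2 ^ n := by
    rw [norm_mul, norm_pow, norm_neg, norm_one, one_pow, one_mul, Complex.norm_natCast]
    exact_mod_cast Nat.choose_le_two_pow n i
  rw [← hn, norm_mul, norm_mul, norm_mul (-Complex.I), norm_neg, Complex.norm_I, one_mul]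
  calc _ ≤ z.im ^ (-(n : ℝ)) * 2 ^ n * (C * 2 ^ n * (z.im ^ (-(1 / 2) : ℝ) * K)) := by
        gcongr
    _ = 2 ^ n * 2 ^ n * (C * K) * (z.im ^ (-(n : ℝ)) * z.im ^ (-(1 / 2) : ℝ)) := by ring
    _ = _ := by
        rw [← Real.rpow_add hy]
        congr 2

/-! ### Eichler integrals are primitives -/

lemma eval_eichlerPlus_eq_sum (hk : 2 ≤ k) (z : ℍ) (X : ℂ) : (eichlerPlus f z).eval X =
    ∑ e ∈ Finset.range (k - 2 + 1), (-Complex.I * Complex.I ^ e * ((k - 2).choose e : ℂ)) *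
      (((z : ℂ) - X) ^ (k - 2 - e) * discInt (cuspDisc f) e (qpar z)) := by
  have e : ∀ t : ℝ, cuspDisc f (qshift (qpar z) t) * ((z : ℂ) + Complex.I * t - X) ^ (k - 2) =
      ∑ e ∈ Finset.range (k - 2 + 1), (Complex.I ^ e * ((k - 2).choose e : ℂ) *
        ((z : ℂ) - X) ^ (k - 2 - e)) * (cuspDisc f (qshift (qpar z) t) * (t : ℂ) ^ e) := by
    intro t
    rw [show (z : ℂ) + Complex.I * t - X = Complex.I * t + ((z : ℂ) - X) by ring, add_pow,
      Finset.mul_sum]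
    refine Finset.sum_congr rfl fun e _ => ?_
    rw [mul_pow]
    ring
  rw [eval_eichlerPlus f hk]
  simp only [e]
  rw [integral_finsetSum _ fun b _ => ((cuspDisc_discHol f).integrableOn_pow (cuspDisc_zero f)
    (qpar_mem_ball z) _).const_mul _, Finset.mul_sum]
  refine Finset.sum_congr rfl fun b _ => ?_
  rw [integral_const_mul, discInt]
  ring

/-- The half-line of integration moves with `z`, so the derivative is taken on the finite sum of
products of `(z - X) ^ (n - e)` and `discInt`. -/
lemma hasDerivAt_eval_eichlerPlus (hk : 2 ≤ k) (z : ℍ) (X : ℂ) :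
    HasDerivAt (fun w : ℂ => (eichlerPlus f (ofComplex w)).eval X)
      (f z * ((z : ℂ) - X) ^ (k - 2)) z := by
  set n := k - 2 with hn
  set E : ℂ → ℂ := fun w => Complex.exp (2 * Real.pi * Complex.I * w) with hE
  set J : ℕ → ℂ → ℂ := fun e w => discInt (cuspDisc f) e (E w) with hJ
  have hE' : HasDerivAt E (qpar z * (2 * Real.pi * Complex.I)) z := by
    simpa [qpar, hE] using ((hasDerivAt_id (z : ℂ)).const_mul (2 * Real.pi * Complex.I)).cexp
  have hJ0 : HasDerivAt (J 0) (Complex.I * f z) z := by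
    obtain ⟨D, hD, hD'⟩ := hasDerivAt_discInt_zero (cuspDisc_discHol f) (cuspDisc_zero f)
      (qpar_mem_ball z)
    refine (HasDerivAt.comp_of_eq (z : ℂ) hD hE' rfl).congr_deriv ?_
    rw [← cuspDisc_qpar, ← hD']
    ring
  have hJs : ∀ e : ℕ, HasDerivAt (J (e + 1)) (Complex.I * ((e + 1) * J e z)) z := by
    intro e
    obtain ⟨D, hD, hD'⟩ := hasDerivAt_discInt_succ e (cuspDisc_discHol f) (cuspDisc_zero f)
      (qpar_mem_ball z)
    refine (HasDerivAt.comp_of_eq (z : ℂ) hD hE' rfl).congr_deriv ?_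
    change _ = Complex.I * ((e + 1) * discInt (cuspDisc f) e (qpar z))
    rw [← hD']
    ring
  have hJ' : ∀ e : ℕ, HasDerivAt (J e) (if e = 0 then Complex.I * f z else
      Complex.I * (e * J (e - 1) z)) z := by
    intro e
    rcases e with _ | e
    · simpa using hJ0
    · simpa using hJs e
  have hsub : ∀ m : ℕ, HasDerivAt (fun w : ℂ => (w - X) ^ m) (m * ((z : ℂ) - X) ^ (m - 1)) z := by
    intro m
    have h := ((hasDerivAt_id (z : ℂ)).sub_const X).pow m
    rw [mul_one] at h
    exact h
  have hsum := HasDerivAt.fun_sum (u := Finset.range (n + 1)) fun e _ =>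
    (((hsub (n - e)).mul (hJ' e)).const_mul (-Complex.I * Complex.I ^ e * (n.choose e : ℂ)))
  refine (hsum.congr_deriv ?_).congr_of_eventuallyEq ?_
  · have h1 : ∀ e ∈ Finset.range (n + 1), -Complex.I * Complex.I ^ e * (n.choose e : ℂ) *
        (((n - e : ℕ) : ℂ) * ((z : ℂ) - X) ^ (n - e - 1) * J e z + ((z : ℂ) - X) ^ (n - e) *
          (if e = 0 then Complex.I * f z else Complex.I * (e * J (e - 1) z))) =
        (-Complex.I * Complex.I ^ e * (n.choose e : ℂ) * ((n - e : ℕ) : ℂ) *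
          ((z : ℂ) - X) ^ (n - e - 1) * J e z) +
        (if e = 0 then ((z : ℂ) - X) ^ n * f z else
          Complex.I ^ e * (n.choose e : ℂ) * e * ((z : ℂ) - X) ^ (n - e) * J (e - 1) z) := by
      intro e _
      rcases e with _ | e
      · simp
        linear_combination -((z : ℂ) - X) ^ n * f z * Complex.I_sq
      · simp
        linear_combination (-(Complex.I ^ (e + 1) * (n.choose (e + 1) : ℂ) * ((e : ℂ) + 1) *
          ((z : ℂ) - X) ^ (n - (e + 1)) * J e z)) * Complex.I_sq
    rw [Finset.sum_congr rfl h1, Finset.sum_add_distrib, Finset.sum_range_succ,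
      Finset.sum_range_succ' (fun e => if e = 0 then ((z : ℂ) - X) ^ n * f z else
          Complex.I ^ e * (n.choose e : ℂ) * e * ((z : ℂ) - X) ^ (n - e) * J (e - 1) z)]
    simp only [Nat.sub_self, Nat.cast_zero, mul_zero, zero_mul, add_zero, if_true,
      Nat.succ_ne_zero, if_false, Nat.add_sub_cancel]
    -- The sum telescopes: differentiating the power in term `e` cancels differentiating the
    -- integral in term `e + 1`, and only the derivative of the integral with `e = 0` remains.
    rw [← add_assoc, ← Finset.sum_add_distrib, Finset.sum_eq_zero, zero_add, mul_comm]
    intro e he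
    have he' := Finset.mem_range.1 he
    have h2 : ((n.choose (e + 1) : ℂ)) * ((e : ℂ) + 1) = (n.choose e : ℂ) * ((n - e : ℕ) : ℂ) := by
      exact_mod_cast Nat.choose_succ_right_eq n e
    have h3 : n - (e + 1) = n - e - 1 := by omega
    rw [h3, pow_succ]
    push_cast
    linear_combination Complex.I ^ e * Complex.I * ((z : ℂ) - X) ^ (n - e - 1) * J e z * h2
  · filter_upwards [eventually_im_pos z] with w hw
    rw [eval_eichlerPlus_eq_sum f hk, ofComplex_apply_of_im_pos hw]
    rfl

end

/-! ### Poincaré series -/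

/-- Testing `X` on `ℍ` only is convenient because `j(γ, X)` never vanishes there and `γ X` is a
point of `ℍ` again. -/
lemma polynomial_eq_of_eval_eq {P Q : Polynomial ℂ} (h : ∀ x : ℍ, P.eval (x : ℂ) = Q.eval (x : ℂ)) :
    P = Q := by
  refine Polynomial.eq_of_infinite_eval_eq _ _
    (Set.infinite_of_injective_forall_mem (f := fun m : ℕ => ((m : ℂ) + 1) * Complex.I) ?_ ?_)
  · intro a b hab
    simpa using hab
  · intro m
    exact h ⟨((m : ℂ) + 1) * Complex.I, by simp; positivity⟩

lemma autj_mul (γ δ : SL(2, ℤ)) (z : ℍ) : autj (γ * δ) z = autj γ (δ • z : ℍ) * autj δ z := by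
  have h := autj_ne_zero δ z
  have e1 : (γ * δ) 1 0 = γ 1 0 * δ 0 0 + γ 1 1 * δ 1 0 := by
    simp [Matrix.mul_apply, Fin.sum_univ_two]
  have e2 : (γ * δ) 1 1 = γ 1 0 * δ 0 1 + γ 1 1 * δ 1 1 := by
    simp [Matrix.mul_apply, Fin.sum_univ_two]
  have h3 : autj γ (δ • z : ℍ) = (γ 1 0 : ℂ) * (δ • z : ℍ) + (γ 1 1 : ℂ) := rfl
  rw [h3, coe_smul_eq, add_mul, mul_assoc, div_mul_cancel₀ _ h, autj, e1, e2, autj]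
  push_cast
  ring

/-- The summand `Φ(γ z) j(γ, z)^{-R} j(γ, z̄)^{-S}` of a Poincaré series of weights `(R, S)`. -/
def poincareTerm (Φ : ℍ → ℂ) (R S : ℤ) (γ : SL(2, ℤ)) (z : ℍ) : ℂ :=
  Φ (γ • z) * (autj γ z ^ (-R) * autj γ (conj (z : ℂ)) ^ (-S))

lemma poincareTerm_smul (Φ : ℍ → ℂ) (R S : ℤ) (γ δ : SL(2, ℤ)) (z : ℍ) :
    poincareTerm Φ R S γ (δ • z) =
      autj δ z ^ R * autj δ (conj (z : ℂ)) ^ S * poincareTerm Φ R S (γ * δ) z := by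
  have h := autj_ne_zero δ z
  have h' := autj_conj_ne_zero δ z
  rw [autj_conj] at h'
  simp only [poincareTerm, autj_conj, autj_mul, mul_smul, mul_zpow, map_mul, zpow_neg]
  field_simp

lemma poincareTerm_conj (Φ : ℍ → ℂ) (R S : ℤ) (γ : SL(2, ℤ)) (z : ℍ) :
    poincareTerm (fun z => conj (Φ z)) R S γ z = conj (poincareTerm Φ S R γ z) := by
  simp only [poincareTerm, map_mul, map_zpow₀, autj_conj, Complex.conj_conj]
  ring

lemma coe_smul_sub_coe_smul (γ : SL(2, ℤ)) (w z : ℍ) :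
    ((γ • w : ℍ) : ℂ) - (γ • z : ℍ) = ((w : ℂ) - z) / (autj γ w * autj γ z) := by
  have h1 := autj_ne_zero γ w
  have h2 := autj_ne_zero γ z
  rw [coe_smul_eq, coe_smul_eq]
  field_simp
  simp only [autj]
  linear_combination ((w : ℂ) - z) * det_eq γ

lemma coe_smul_sub_conj_coe_smul (γ : SL(2, ℤ)) (w z : ℍ) :
    ((γ • w : ℍ) : ℂ) - conj ((γ • z : ℍ) : ℂ) =
      ((w : ℂ) - conj (z : ℂ)) / (autj γ w * autj γ (conj (z : ℂ))) := by
  have h1 := autj_ne_zero γ w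
  have h2 := autj_conj_ne_zero γ z
  rw [coe_smul_eq, coe_smul_eq, map_div₀, ← autj_conj]
  simp only [map_add, map_mul, map_intCast]
  field_simp
  simp only [autj]
  linear_combination ((w : ℂ) - conj (z : ℂ)) * det_eq γ

/-! ### The slash action in the basis attached to `z` and `z̄` -/

/-- The polynomial `(X - z) ^ i (X - z̄) ^ (n - i)`. -/
def expBasis (n i : ℕ) (z : ℍ) : Polynomial ℂ :=
  (Polynomial.X - Polynomial.C (z : ℂ)) ^ i *
    (Polynomial.X - Polynomial.C (conj (z : ℂ))) ^ (n - i)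

lemma expBasis_natDegree {n i : ℕ} (hi : i ≤ n) (z : ℍ) : (expBasis n i z).natDegree ≤ n := by
  have h1 : ∀ (x : ℂ) (e : ℕ),
      ((Polynomial.X - Polynomial.C x) ^ e).natDegree ≤ e := fun x e =>
    (Polynomial.natDegree_pow_le_of_le e (Polynomial.natDegree_X_sub_C_le x)).trans (by simp)
  exact (Polynomial.natDegree_mul_le_of_le (h1 _ _) (h1 _ _)).trans (by omega)

lemma eval_expBasis (n i : ℕ) (z : ℍ) (x : ℂ) :
    (expBasis n i z).eval x = (x - z) ^ i * (x - conj (z : ℂ)) ^ (n - i) := by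
  simp [expBasis]

lemma expCoeff_expansion' (n : ℕ) {P : Polynomial ℂ} (hP : P.natDegree ≤ n) (z : ℍ) :
    P = ∑ i ∈ Finset.range (n + 1), Polynomial.C (expCoeff n P i z) * expBasis n i z := by
  simpa only [expBasis, mul_assoc] using expCoeff_expansion n hP z

lemma expCoeff_unique' (n : ℕ) {P : Polynomial ℂ} (z : ℍ) (c : ℕ → ℂ)
    (h : P = ∑ i ∈ Finset.range (n + 1), Polynomial.C (c i) * expBasis n i z) {i : ℕ}
    (hi : i ≤ n) : expCoeff n P i z = c i :=
  (expCoeff_unique n z c (by simpa only [expBasis, mul_assoc] using h) hi).symm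

/-- The differences `γX - γz` and `γX - γz̄` equal `X - z` and `X - z̄` divided by automorphy
factors. The powers of `j(γ, X)` cancel against `j(γ, X) ^ (k-2)`, and those at `z` and `z̄` shift
the weights by `i` and `k - 2 - i`. -/
lemma slash_eq_sum {k : ℕ} (r s : ℤ) {F : ℍ → Polynomial ℂ} (hF : ∀ z, (F z).natDegree ≤ k - 2)
    (γ : SL(2, ℤ)) (z : ℍ) : slash k r s F γ z = ∑ i ∈ Finset.range (k - 2 + 1),
      Polynomial.C (poincareTerm (fun z => expCoeff (k - 2) (F z) i z) (r + i)
        (s + (k - 2 : ℕ) - i) γ z) * expBasis (k - 2) i z := by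
  set n := k - 2 with hn
  refine polynomial_eq_of_eval_eq fun x => ?_
  have ha := autj_ne_zero γ z
  have hb := autj_conj_ne_zero γ z
  have hJ := autj_ne_zero γ x
  have hdeg := hF (γ • z)
  have h1 := congrArg (Polynomial.eval ((γ • x : ℍ) : ℂ)) (expCoeff_expansion' n hdeg (γ • z))
  rw [Polynomial.eval_finsetSum] at h1
  rw [slash, Polynomial.eval_mul, Polynomial.eval_C, ← hn, homSubst_eval n _ _ _ _ _ hdeg hJ]
  have e : ((γ 0 0 : ℂ) * x + γ 0 1) / ((γ 1 0 : ℂ) * x + γ 1 1) = ((γ • x : ℍ) : ℂ) :=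
    (coe_smul_eq γ x).symm
  rw [e, h1, Polynomial.eval_finsetSum, Finset.mul_sum, Finset.mul_sum]
  refine Finset.sum_congr rfl fun i hi => ?_
  have hi' : i ≤ n := Nat.lt_succ_iff.1 (Finset.mem_range.1 hi)
  obtain ⟨l, hl⟩ := Nat.exists_eq_add_of_le hi'
  rw [Polynomial.eval_mul, Polynomial.eval_mul, Polynomial.eval_C, Polynomial.eval_C,
    eval_expBasis, eval_expBasis, coe_smul_sub_coe_smul, coe_smul_sub_conj_coe_smul, poincareTerm,
    show n - i = l by omega, show -(s + (n : ℤ) - i) = -s - l by rw [hl]; push_cast; ring,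
    show -(r + (i : ℤ)) = -r - i by ring, zpow_sub₀ ha, zpow_sub₀ hb, zpow_natCast, zpow_natCast]
  change _ * ((autj γ x) ^ n * _) = _
  rw [hl, pow_add, div_pow, div_pow, mul_pow, mul_pow]
  field_simp

/-! ### Cosets modulo `B` -/

lemma mem_subgroupB_of_bottom_left_eq_zero {γ : SL(2, ℤ)} (h : γ 1 0 = 0) : γ ∈ subgroupB := by
  have hd := γ.det_coe
  rw [Matrix.det_fin_two, h, mul_zero, sub_zero] at hd
  rcases Int.eq_one_or_neg_one_of_mul_eq_one' hd with ⟨h1, h2⟩ | ⟨h1, h2⟩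
  · refine ⟨γ 0 1, Or.inl ?_⟩
    ext i j
    rw [ModularGroup.coe_T_zpow]
    fin_cases i <;> fin_cases j <;> simp [h, h1, h2]
  · refine ⟨-γ 0 1, Or.inr ?_⟩
    ext i j
    rw [Matrix.SpecialLinearGroup.coe_neg, ModularGroup.coe_T_zpow]
    fin_cases i <;> fin_cases j <;> simp [h, h1, h2]

lemma bottom_left_eq_zero_of_mem {γ : SL(2, ℤ)} (h : γ ∈ subgroupB) : γ 1 0 = 0 := by
  obtain ⟨n, rfl | rfl⟩ := h
  · rw [ModularGroup.coe_T_zpow]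
    simp
  · rw [Matrix.SpecialLinearGroup.coe_neg, ModularGroup.coe_T_zpow]
    simp

/-- The lower left entry of `δ γ⁻¹` is the difference of the two sides, and `B` consists exactly of
the matrices where that entry vanishes. -/
lemma mk_eq_mk_iff {γ δ : SL(2, ℤ)} :
    (Quotient.mk (QuotientGroup.rightRel subgroupB) γ : CosetB) = Quotient.mk _ δ ↔
      δ 1 0 * γ 1 1 = δ 1 1 * γ 1 0 := by
  rw [Quotient.eq, QuotientGroup.rightRel_apply]
  have e : (δ * γ⁻¹) 1 0 = δ 1 0 * γ 1 1 - δ 1 1 * γ 1 0 := by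
    simp [Matrix.mul_apply, Fin.sum_univ_two, Matrix.adjugate_fin_two]
    ring
  constructor
  · intro h
    have := bottom_left_eq_zero_of_mem h
    linarith
  · intro h
    exact mem_subgroupB_of_bottom_left_eq_zero (by linarith)

lemma bottom_row_out_injective :
    Function.Injective fun q : CosetB => ((q.out 1 0, q.out 1 1) : ℤ × ℤ) := by
  intro q q' h
  rw [Prod.mk.injEq] at h
  rw [← q.out_eq, ← q'.out_eq]
  exact mk_eq_mk_iff.2 (by rw [h.1, h.2]; ring)

/-- As `Im γz = y / |j(γ, z)| ^ 2`, the bound on `Φ(γz)` costs `|j(γ, z)| ^ (2n+1)`. The remaining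
exponent `R + S - 2n - 1` is at least `3`, and distinct cosets have distinct bottom rows. -/
lemma summable_poincareTerm {Φ : ℍ → ℂ} {n : ℕ} {C : ℝ}
    (hC : ∀ z : ℍ, ‖Φ z‖ ≤ C * z.im ^ (-(n : ℝ) - 1 / 2)) {R S : ℤ} (h : 2 * n + 4 ≤ R + S)
    (z : ℍ) : Summable fun γ : CosetB => poincareTerm Φ R S γ.out z := by
  have h1 := ((summable_norm_linear (w := R + S - (2 * n + 1)) (by linarith) z).comp_injective
    bottom_row_out_injective).mul_left (C * z.im ^ (-(n : ℝ) - 1 / 2))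
  refine Summable.of_norm_bounded h1 fun q => ?_
  set γ := q.out
  have ha := autj_ne_zero γ z
  have ha' : 0 < ‖autj γ z‖ := norm_pos_iff.2 ha
  have hz := z.im_pos
  have him : (γ • z : ℍ).im = z.im * (‖autj γ z‖ ^ 2)⁻¹ := by
    rw [ModularGroup.im_smul_eq_div_normSq, autj_eq_denom, Complex.normSq_eq_norm_sq, div_eq_mul_inv]
  rw [poincareTerm, norm_mul, norm_zpow_mul_zpow ha (by rw [autj_conj, RCLike.norm_conj])]
  refine (mul_le_mul_of_nonneg_right (hC _) (by positivity)).trans (le_of_eq ?_)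
  have e : ((‖autj γ z‖ ^ 2)⁻¹) ^ (-(n : ℝ) - 1 / 2) = ‖autj γ z‖ ^ (2 * n + 1 : ℤ) := by
    rw [← Real.rpow_natCast, ← Real.rpow_neg ha'.le, ← Real.rpow_mul ha'.le, ← Real.rpow_intCast]
    congr 1
    push_cast
    ring
  rw [him, Real.mul_rpow hz.le (by positivity), e, mul_assoc, mul_assoc, mul_assoc,
    ← zpow_add₀ ha'.ne']
  simp only [Function.comp_apply]
  congr 3
  ring

lemma poincareTerm_mul_of_mem {Φ : ℍ → ℂ}
    (hΦ : ∀ (z z' : ℍ) (l : ℤ), (z' : ℂ) = z + l → Φ z' = Φ z) {R S : ℤ} (h : Even (R + S))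
    {β : SL(2, ℤ)} (hβ : β ∈ subgroupB) (γ : SL(2, ℤ)) (z : ℍ) :
    poincareTerm Φ R S (β * γ) z = poincareTerm Φ R S γ z := by
  obtain ⟨n, rfl | rfl⟩ := hβ
  · have e : ∀ w : ℍ, autj (ModularGroup.T ^ n) w = 1 := fun w => by
      rw [autj, ModularGroup.coe_T_zpow]
      simp
    simp only [poincareTerm, autj_conj, autj_mul, e, one_mul, mul_smul]
    rw [hΦ _ _ n (ModularGroup.coe_T_zpow_smul_eq (z := γ • z))]
  · have e : ∀ w : ℍ, autj (-ModularGroup.T ^ n) w = -1 := fun w => by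
      rw [autj, Matrix.SpecialLinearGroup.coe_neg, ModularGroup.coe_T_zpow]
      simp
    -- Evenness of `R + S` is used here, for invariance under `-1`.
    have hsign : ((-1 : ℂ)) ^ (-R) * (-1) ^ (-S) = 1 := by
      rw [← zpow_add₀ (by norm_num), ← neg_add]
      exact h.neg.neg_one_zpow
    simp only [poincareTerm, autj_conj, autj_mul, e, mul_smul, ModularGroup.SL_neg_smul, map_mul, map_neg, map_one,
      mul_zpow]
    rw [hΦ _ _ n (ModularGroup.coe_T_zpow_smul_eq (z := γ • z))]
    linear_combination (Φ (γ • z) * autj γ z ^ (-R) * (conj (autj γ z)) ^ (-S)) * hsign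

lemma poincareTerm_out_mk {Φ : ℍ → ℂ}
    (hΦ : ∀ (z z' : ℍ) (l : ℤ), (z' : ℂ) = z + l → Φ z' = Φ z) {R S : ℤ} (h : Even (R + S))
    (γ : SL(2, ℤ)) (z : ℍ) :
    poincareTerm Φ R S (Quotient.mk (QuotientGroup.rightRel subgroupB) γ : CosetB).out z =
      poincareTerm Φ R S γ z := by
  have h1 := Quotient.mk_out (s := QuotientGroup.rightRel subgroupB) γ
  have h2 := QuotientGroup.rightRel_apply.1 h1
  rw [← poincareTerm_mul_of_mem hΦ h h2, inv_mul_cancel_right]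

/-- The action of `δ` on `B \ Γ` by right multiplication. -/
def cosetMul (δ : SL(2, ℤ)) : CosetB ≃ CosetB :=
  Quotient.congr (Equiv.mulRight δ) fun a b => by
    rw [QuotientGroup.rightRel_apply, QuotientGroup.rightRel_apply]
    simp [mul_assoc]

/-- The Poincaré series of weights `(R, S)` attached to `Φ`. -/
def poincare (Φ : ℍ → ℂ) (R S : ℤ) (z : ℍ) : ℂ := ∑' γ : CosetB, poincareTerm Φ R S γ.out z

lemma poincare_hasWeight {Φ : ℍ → ℂ}
    (hΦ : ∀ (z z' : ℍ) (l : ℤ), (z' : ℂ) = z + l → Φ z' = Φ z) {R S : ℤ} (h : Even (R + S)) :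
    HasWeight R S (poincare Φ R S) := by
  intro δ z
  have e : ∀ q : CosetB, cosetMul δ q = Quotient.mk _ (q.out * δ) := fun q => by
    conv_lhs => rw [← q.out_eq]
    rfl
  rw [poincare, poincare, ← (cosetMul δ).tsum_eq fun γ : CosetB => poincareTerm Φ R S γ.out z,
    ← tsum_mul_left]
  refine tsum_congr fun q => ?_
  rw [poincareTerm_smul, e q, poincareTerm_out_mk hΦ h]

/-! ### The sum over coprime pairs -/

open scoped Classical in
/-- A matrix with bottom row `(c, d)` when `c` and `d` are coprime (and the identity otherwise). -/
def rowLift (p : ℕ+ × ℤ) : SL(2, ℤ) :=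
  if h : ∃ γ : SL(2, ℤ), γ 1 0 = ((p.1 : ℕ) : ℤ) ∧ γ 1 1 = p.2 then h.choose else 1

lemma rowLift_spec {p : ℕ+ × ℤ} (h : IsCoprime ((p.1 : ℕ) : ℤ) p.2) :
    rowLift p 1 0 = ((p.1 : ℕ) : ℤ) ∧ rowLift p 1 1 = p.2 := by
  have h1 : ∃ γ : SL(2, ℤ), γ 1 0 = ((p.1 : ℕ) : ℤ) ∧ γ 1 1 = p.2 := by
    obtain ⟨γ, -, hγ⟩ := ModularGroup.bottom_row_surj (R := ℤ)
      (show IsCoprime (![((p.1 : ℕ) : ℤ), p.2] 0) (![((p.1 : ℕ) : ℤ), p.2] 1) by simpa using h)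
    exact ⟨γ, by simpa using congrFun hγ 0, by simpa using congrFun hγ 1⟩
  rw [rowLift, dif_pos h1]
  exact h1.choose_spec

/-- Representatives of `B \ Γ`: the identity, and a matrix for every coprime pair `(c, d)` with
`c ≥ 1`. -/
def cosetRep : Option {p : ℕ+ × ℤ // IsCoprime ((p.1 : ℕ) : ℤ) p.2} → CosetB
  | none => Quotient.mk _ 1
  | some p => Quotient.mk _ (rowLift p)

lemma cosetRep_bijective : Function.Bijective cosetRep := by
  constructor
  · have aux : ∀ p : {p : ℕ+ × ℤ // IsCoprime ((p.1 : ℕ) : ℤ) p.2},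
        cosetRep none ≠ cosetRep (some p) := by
      rintro ⟨p, hp⟩ h
      have h1 := mk_eq_mk_iff.1 h
      rw [(rowLift_spec hp).1, (rowLift_spec hp).2] at h1
      simp at h1
    rintro (_ | ⟨⟨c, d⟩, hp⟩) (_ | ⟨⟨c', d'⟩, hp'⟩) h
    · rfl
    · exact absurd h (aux _)
    · exact absurd h.symm (aux _)
    · have h1 := mk_eq_mk_iff.1 h
      rw [(rowLift_spec hp).1, (rowLift_spec hp).2, (rowLift_spec hp').1, (rowLift_spec hp').2] at h1
      -- Coprimality turns the proportionality `c' d = d' c` into mutual divisibility of `c` and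
      -- `c'`; positivity then fixes the sign.
      have e1 : ((c : ℕ) : ℤ) ∣ (c' : ℕ) := hp.dvd_of_dvd_mul_right (by rw [h1]; exact dvd_mul_left _ _)
      have e2 : ((c' : ℕ) : ℤ) ∣ (c : ℕ) :=
        hp'.dvd_of_dvd_mul_left (by rw [← h1]; exact dvd_mul_right _ _)
      have e3 : c = c' := PNat.eq (Nat.dvd_antisymm (by exact_mod_cast e1) (by exact_mod_cast e2))
      subst e3
      have e4 : d = d' := by
        have : ((c : ℕ) : ℤ) ≠ 0 := by exact_mod_cast c.ne_zero
        apply mul_left_cancel₀ this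
        simpa [mul_comm] using h1
      subst e4
      rfl
  · intro q
    obtain ⟨γ, rfl⟩ := Quotient.exists_rep q
    have hco := ModularGroup.bottom_row_coprime γ
    rcases lt_trichotomy (γ 1 0) 0 with h | h | h
    · obtain ⟨m, hm⟩ := Int.eq_ofNat_of_zero_le (show 0 ≤ -γ 1 0 by omega)
      have hm0 : 0 < m := by omega
      have hp : IsCoprime ((((⟨m, hm0⟩ : ℕ+) : ℕ)) : ℤ) (-γ 1 1) := by
        change IsCoprime (m : ℤ) _
        rw [← hm]
        exact hco.neg_neg
      refine ⟨some ⟨(⟨m, hm0⟩, -γ 1 1), hp⟩, mk_eq_mk_iff.2 ?_⟩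
      have hr := rowLift_spec (p := (⟨m, hm0⟩, -γ 1 1)) hp
      rw [hr.1, hr.2]
      change γ 1 0 * -γ 1 1 = γ 1 1 * (m : ℤ)
      rw [← hm]
      ring
    · refine ⟨none, mk_eq_mk_iff.2 ?_⟩
      simp [h]
    · obtain ⟨m, hm⟩ := Int.eq_ofNat_of_zero_le h.le
      have hm0 : 0 < m := by omega
      have hp : IsCoprime ((((⟨m, hm0⟩ : ℕ+) : ℕ)) : ℤ) (γ 1 1) := by
        change IsCoprime (m : ℤ) _
        rw [← hm]
        exact hco
      refine ⟨some ⟨(⟨m, hm0⟩, γ 1 1), hp⟩, mk_eq_mk_iff.2 ?_⟩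
      have hr := rowLift_spec (p := (⟨m, hm0⟩, γ 1 1)) hp
      rw [hr.1, hr.2]
      change γ 1 0 * γ 1 1 = γ 1 1 * (m : ℤ)
      rw [← hm]
      ring

/-- The identity coset contributes `Φ z`. The rest is extended by zero to all pairs with `c ≥ 1`, so
that summation over full residue classes becomes available. -/
lemma poincare_eq_pairSum {Φ : ℍ → ℂ}
    (hΦ : ∀ (z z' : ℍ) (l : ℤ), (z' : ℂ) = z + l → Φ z' = Φ z) {R S : ℤ} (h : Even (R + S)) (z : ℍ)
    (hs : Summable fun γ : CosetB => poincareTerm Φ R S γ.out z) :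
    poincare Φ R S z = Φ z + ∑' p : ℕ+ × ℤ, if IsCoprime ((p.1 : ℕ) : ℤ) p.2 then
      poincareTerm Φ R S (rowLift p) z else 0 := by
  set e := Equiv.ofBijective _ cosetRep_bijective with he
  have h1 : ∀ o, poincareTerm Φ R S (e o).out z =
      o.elim (Φ z) fun p => poincareTerm Φ R S (rowLift p) z := by
    rintro (_ | p)
    · refine (poincareTerm_out_mk hΦ h 1 z).trans ?_
      simp [poincareTerm, autj]
    · exact poincareTerm_out_mk hΦ h (rowLift p) z
  have hs' := e.summable_iff.2 hs
  simp only [Function.comp_def, h1] at hs'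
  rw [poincare, ← e.tsum_eq]
  simp only [h1]
  rw [hs'.tsum_eq_add_tsum_ite none]
  congr 1
  have h3 := (Option.some_injective {p : ℕ+ × ℤ // IsCoprime ((p.1 : ℕ) : ℤ) p.2}).tsum_eq
    (f := fun o => if o = none then 0 else
      o.elim (Φ z) fun p => poincareTerm Φ R S (rowLift p) z) (by
      rintro (_ | p) hp
      · simp at hp
      · exact ⟨p, rfl⟩)
  rw [← h3]
  simp only [reduceCtorEq, if_false, Option.elim_some]
  refine (tsum_subtype {p : ℕ+ × ℤ | IsCoprime ((p.1 : ℕ) : ℤ) p.2}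
    fun p => poincareTerm Φ R S (rowLift p) z).trans (tsum_congr fun p => ?_)
  simp [Set.indicator]

/-! ### The coefficient functions as Poincaré series -/

lemma summable_expCoeff {k : ℕ} {F : ℍ → Polynomial ℂ} {C : ℝ}
    (hC : ∀ i ≤ k - 2, ∀ z : ℍ,
      ‖expCoeff (k - 2) (F z) i z‖ ≤ C * z.im ^ (-((k - 2 : ℕ) : ℝ) - 1 / 2))
    {r s : ℤ} (h : ((k - 2 : ℕ) : ℤ) + 4 ≤ r + s) {i : ℕ} (hi : i ≤ k - 2) (z : ℍ) : Summable fun γ : CosetB =>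
    poincareTerm (fun z => expCoeff (k - 2) (F z) i z) (r + i) (s + (k - 2 : ℕ) - i) γ.out z :=
  summable_poincareTerm (hC i hi) (by linarith) z

lemma summable_slash_coeff {k : ℕ} {F : ℍ → Polynomial ℂ}
    (hF : ∀ z, (F z).natDegree ≤ k - 2) {C : ℝ}
    (hC : ∀ i ≤ k - 2, ∀ z : ℍ,
      ‖expCoeff (k - 2) (F z) i z‖ ≤ C * z.im ^ (-((k - 2 : ℕ) : ℝ) - 1 / 2))
    {r s : ℤ} (h : ((k - 2 : ℕ) : ℤ) + 4 ≤ r + s)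
    (z : ℍ) (m : ℕ) :
    Summable fun γ : CosetB => (slash k r s F γ.out z).coeff m := by
  simp only [slash_eq_sum r s hF, Polynomial.finsetSum_coeff, Polynomial.coeff_C_mul]
  exact summable_sum fun i hi => (summable_expCoeff hC h
    (Nat.lt_succ_iff.1 (Finset.mem_range.1 hi)) z).mul_right _

lemma phiCoeff_eq_poincare {k : ℕ} {F : ℍ → Polynomial ℂ}
    (hF : ∀ z, (F z).natDegree ≤ k - 2) {C : ℝ}
    (hC : ∀ i ≤ k - 2, ∀ z : ℍ,
      ‖expCoeff (k - 2) (F z) i z‖ ≤ C * z.im ^ (-((k - 2 : ℕ) : ℝ) - 1 / 2))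
    {r s : ℤ} (h : ((k - 2 : ℕ) : ℤ) + 4 ≤ r + s)
    (hk : 2 ≤ k) {i : ℕ} (hi : i ≤ k - 2) : phiCoeff k r s F i =
    poincare (fun z => expCoeff (k - 2) (F z) i z) (r + i) (s + (k - 2 : ℕ) - i) := by
  funext z
  refine expCoeff_unique' (k - 2) z (fun i => poincare (fun z => expCoeff (k - 2) (F z) i z)
    (r + i) (s + (k - 2 : ℕ) - i) z) ?_ hi
  ext m
  have e : ∀ i ∈ Finset.range (k - 2 + 1), (expBasis (k - 2) i z).natDegree ≤ k - 2 := fun i hi =>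
    expBasis_natDegree (Nat.lt_succ_iff.1 (Finset.mem_range.1 hi)) z
  rw [phi, Polynomial.finsetSum_coeff, Polynomial.finsetSum_coeff]
  simp only [Polynomial.coeff_monomial, Polynomial.coeff_C_mul, Finset.sum_ite_eq', Finset.mem_range]
  split_ifs with hm
  · simp only [slash_eq_sum r s hF, Polynomial.finsetSum_coeff, Polynomial.coeff_C_mul]
    rw [Summable.tsum_finsetSum fun i hi => (summable_expCoeff hC h
      (Nat.lt_succ_iff.1 (Finset.mem_range.1 hi)) z).mul_right _]
    simp only [tsum_mul_right]
    rfl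
  · symm
    refine Finset.sum_eq_zero fun i hi => ?_
    rw [Polynomial.coeff_eq_zero_of_natDegree_lt, mul_zero]
    exact (e i hi).trans_lt (by omega)

lemma expBasis_map_conj {n i : ℕ} (hi : i ≤ n) (z : ℍ) :
    (expBasis n (n - i) z).map (starRingEnd ℂ) = expBasis n i z := by
  simp only [expBasis, Polynomial.map_mul, Polynomial.map_pow, Polynomial.map_sub, Polynomial.map_X,
    Polynomial.map_C, Complex.conj_conj, Nat.sub_sub_self hi]
  ring

/-- Conjugating coefficients exchanges `X - z` and `X - z̄`, hence the reflection of the index. -/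
lemma expCoeff_map_conj (n : ℕ) {P : Polynomial ℂ} (hP : P.natDegree ≤ n) (z : ℍ) {i : ℕ}
    (hi : i ≤ n) : expCoeff n (P.map (starRingEnd ℂ)) i z = conj (expCoeff n P (n - i) z) := by
  refine expCoeff_unique' n z (fun i => conj (expCoeff n P (n - i) z)) ?_ hi
  conv_lhs => rw [expCoeff_expansion' n hP z, ← Finset.sum_range_reflect]
  rw [Polynomial.map_sum]
  refine Finset.sum_congr rfl fun j hj => ?_
  have hj' : j ≤ n := Nat.lt_succ_iff.1 (Finset.mem_range.1 hj)
  rw [Nat.add_sub_cancel, Polynomial.map_mul, Polynomial.map_C, expBasis_map_conj hj']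

lemma poincare_conj (Φ : ℍ → ℂ) (R S : ℤ) :
    poincare (fun z => conj (Φ z)) R S = fun z => conj (poincare Φ S R z) := by
  funext z
  simp only [poincare, Complex.conj_tsum, poincareTerm_conj]

/-! ### The period polynomials -/

section

variable {k : ℕ} (f : CuspForm 𝒮ℒ (k : ℤ))

lemma cuspForm_smul (γ : SL(2, ℤ)) (z : ℍ) : f (γ • z) = autj γ z ^ (k : ℤ) * f z := by
  rw [autj_eq_denom]
  exact SlashInvariantForm.slash_action_eqn'' (Γ := 𝒮ℒ)
    (γ := Matrix.SpecialLinearGroup.mapGL ℝ γ) f ⟨γ, rfl⟩ z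

/-- The period polynomial of `γ`, computed from the Eichler integral at `z`. -/
def periodPoly (γ : SL(2, ℤ)) (z : ℍ) : Polynomial ℂ :=
  slash k 0 0 (eichlerPlus f) γ z - eichlerPlus f z

lemma eval_periodPoly (hk : 2 ≤ k) (γ : SL(2, ℤ)) (z x : ℍ) : (periodPoly f γ z).eval (x : ℂ) =
    autj γ x ^ (k - 2) * (eichlerPlus f (γ • z)).eval ((γ • x : ℍ) : ℂ) -
      (eichlerPlus f z).eval (x : ℂ) := by
  rw [periodPoly, slash, Polynomial.eval_sub, Polynomial.eval_mul, Polynomial.eval_C,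
    homSubst_eval _ _ _ _ _ _ (eichlerPlus_natDegree f hk _) (autj_ne_zero γ x), coe_smul_eq]
  simp [autj]

/-- The differential `f(w) (w - X) ^ (k-2) dw` is invariant: the weight `k` of `f` balances `j(γ, z)
^ (-(k-2))` from the power and `j(γ, z) ^ (-2)` from the derivative of `γz`. -/
lemma hasDerivAt_eval_periodPoly (hk : 2 ≤ k) (γ : SL(2, ℤ)) (z x : ℍ) :
    HasDerivAt (fun w : ℂ => (periodPoly f γ (ofComplex w)).eval (x : ℂ)) 0 z := by
  have h1 := hasDerivAt_eval_eichlerPlus f hk z x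
  have h2 : HasDerivAt (fun w : ℂ => (eichlerPlus f (ofComplex w)).eval ((γ • x : ℍ) : ℂ))
      (f (γ • z) * (((γ • z : ℍ) : ℂ) - (γ • x : ℍ)) ^ (k - 2))
      (((γ 0 0 : ℂ) * z + γ 0 1) / autj γ z) := by
    rw [← coe_smul_eq]
    exact hasDerivAt_eval_eichlerPlus f hk (γ • z) _
  have h3 := ((h2.comp (z : ℂ) (hasDerivAt_moebius γ z)).const_mul (autj γ x ^ (k - 2))).sub h1
  have hz := autj_ne_zero γ z
  have hx := autj_ne_zero γ x
  refine (h3.congr_of_eventuallyEq ?_).congr_deriv ?_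
  · filter_upwards [eventually_moebius γ z] with w hw
    rw [eval_periodPoly f hk, Pi.sub_apply]
    simp only [Function.comp_apply]
    rw [← hw.1, ofComplex_apply]
  · obtain ⟨n, rfl⟩ := Nat.exists_eq_add_of_le hk
    rw [cuspForm_smul, coe_smul_sub_coe_smul, Nat.add_sub_cancel_left, div_pow, mul_pow,
      zpow_natCast, pow_add]
    field_simp
    ring

lemma periodPoly_eq (hk : 2 ≤ k) (γ : SL(2, ℤ)) (z w : ℍ) : periodPoly f γ z = periodPoly f γ w := by
  refine polynomial_eq_of_eval_eq fun x => ?_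
  have hU : IsOpen {w : ℂ | 0 < w.im} := isOpen_lt continuous_const Complex.continuous_im
  have hd : ∀ v ∈ {w : ℂ | 0 < w.im},
      HasDerivAt (fun w : ℂ => (periodPoly f γ (ofComplex w)).eval (x : ℂ)) 0 v := fun v hv =>
    hasDerivAt_eval_periodPoly f hk γ ⟨v, hv⟩ x
  have h := hU.is_const_of_deriv_eq_zero (convex_halfSpace_im_gt 0).isPreconnected
    (fun v hv => (hd v hv).differentiableAt.differentiableWithinAt) (fun v hv => (hd v hv).deriv)
    z.im_pos w.im_pos
  simpa only [ofComplex_apply] using h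

lemma periodPoly_eq_sum (hk : 2 ≤ k) (γ : SL(2, ℤ)) (z : ℍ) : periodPoly f γ z =
    ∑ i ∈ Finset.range (k - 2 + 1), Polynomial.C
      (poincareTerm (seed f i) i ((k - 2 : ℕ) - i) γ z - seed f i z) * expBasis (k - 2) i z := by
  rw [periodPoly, slash_eq_sum 0 0 (eichlerPlus_natDegree f hk)]
  conv_lhs => arg 2; rw [expCoeff_expansion' _ (eichlerPlus_natDegree f hk z) z]
  rw [← Finset.sum_sub_distrib]
  refine Finset.sum_congr rfl fun i _ => ?_
  rw [Polynomial.C_sub, sub_mul, zero_add, zero_add]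
  rfl

/-- The cocycle relation read coefficient by coefficient. It replaces the value of the seed at `γz`
by its value at `z` plus a term polynomial in known data. -/
lemma poincareTerm_seed_eq (hk : 2 ≤ k) (γ : SL(2, ℤ)) (z : ℍ) {i : ℕ} (hi : i ≤ k - 2) :
    poincareTerm (seed f i) i ((k - 2 : ℕ) - i) γ z =
      seed f i z + expCoeff (k - 2) (periodPoly f γ z) i z := by
  rw [expCoeff_unique' (k - 2) z _ (periodPoly_eq_sum f hk γ z) hi]
  ring

end

/-! ### Period polynomials in powers of `c X + d` -/

/-- The point `(d + i) / c` of the upper half-plane. -/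
def basePt (c : ℕ+) (d : ℤ) : ℍ :=
  ⟨((d : ℂ) + Complex.I) / ((c : ℕ) : ℂ), by
    rw [Complex.div_natCast_im]
    have : 0 < ((c : ℕ) : ℝ) := by exact_mod_cast c.pos
    simp [this]⟩

lemma coe_basePt (c : ℕ+) (d : ℤ) : (basePt c d : ℂ) = ((d : ℂ) + Complex.I) / ((c : ℕ) : ℂ) := rfl

lemma im_basePt (c : ℕ+) (d : ℤ) : (basePt c d).im = ((c : ℕ) : ℝ)⁻¹ := by
  rw [← coe_im, coe_basePt, Complex.div_natCast_im]
  simp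

lemma pnat_ne_zero (c : ℕ+) : ((c : ℕ) : ℂ) ≠ 0 := by exact_mod_cast c.ne_zero

lemma autj_basePt {c : ℕ+} {d : ℤ} {γ : SL(2, ℤ)} (hc : γ 1 0 = ((c : ℕ) : ℤ)) (hd : γ 1 1 = d) :
    autj γ (basePt c (-d)) = Complex.I := by
  have := pnat_ne_zero c
  rw [autj, hc, hd, coe_basePt]
  push_cast
  field_simp
  ring

/-- The point `(-d + i)/c` is balanced for `γ`: its automorphy factor is `i`, so its image also has
height `1/c`, and the seed is under control at both points. -/
lemma smul_basePt {c : ℕ+} {d : ℤ} {γ : SL(2, ℤ)} (hc : γ 1 0 = ((c : ℕ) : ℤ)) (hd : γ 1 1 = d) :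
    γ • basePt c (-d) = basePt c (γ 0 0) := by
  have h := pnat_ne_zero c
  have hdet := det_eq γ
  rw [hc, hd] at hdet
  apply UpperHalfPlane.ext
  rw [coe_smul_eq, autj_basePt hc hd, coe_basePt, coe_basePt]
  push_cast at hdet ⊢
  field_simp
  linear_combination (-1) * hdet - Complex.I_sq

/-- The coefficient of `Y ^ m` in `(Y - i) ^ a (Y + i) ^ (n - a)`. -/
def lamCoeff (n a m : ℕ) : ℂ :=
  ((Polynomial.X - Polynomial.C Complex.I) ^ a *
    (Polynomial.X + Polynomial.C Complex.I) ^ (n - a)).coeff m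

/-- The linear form `c X + d`. -/
def linPoly (c d : ℂ) : Polynomial ℂ := Polynomial.C c * Polynomial.X + Polynomial.C d

lemma linPoly_pow_natDegree {n m : ℕ} (hm : m ≤ n) (c d : ℂ) : (linPoly c d ^ m).natDegree ≤ n :=
  ((Polynomial.natDegree_pow_le_of_le m Polynomial.natDegree_linear_le).trans (by simp)).trans hm

/-- At this point the two linear factors are `(Y - i)/c` and `(Y + i)/c` with `Y = c X + d`, so the
coefficients in powers of `Y` depend on `c` only through `c ^ (-n)`. -/
lemma expBasis_basePt {n a : ℕ} (ha : a ≤ n) (c : ℕ+) (d : ℤ) : expBasis n a (basePt c (-d)) =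
    ∑ m ∈ Finset.range (n + 1), Polynomial.C ((((c : ℕ) : ℂ) ^ n)⁻¹ * lamCoeff n a m) *
      linPoly (c : ℕ) d ^ m := by
  have h := pnat_ne_zero c
  set Q : Polynomial ℂ := (Polynomial.X - Polynomial.C Complex.I) ^ a *
    (Polynomial.X + Polynomial.C Complex.I) ^ (n - a) with hQ
  have hdeg : Q.natDegree ≤ n := by
    refine (Polynomial.natDegree_mul_le_of_le
      (Polynomial.natDegree_pow_le_of_le a (Polynomial.natDegree_X_sub_C_le _))
      (Polynomial.natDegree_pow_le_of_le (n - a) (Polynomial.natDegree_X_add_C _).le)).trans ?_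
    omega
  have e1 : expBasis n a (basePt c (-d)) =
      Polynomial.C (((c : ℕ) : ℂ) ^ n)⁻¹ * Q.comp (linPoly (c : ℕ) d) := by
    refine polynomial_eq_of_eval_eq fun x => ?_
    obtain ⟨l, rfl⟩ := Nat.exists_eq_add_of_le ha
    rw [eval_expBasis, hQ]
    simp only [Polynomial.eval_mul, Polynomial.eval_comp, Polynomial.eval_pow, Polynomial.eval_sub,
      Polynomial.eval_add, Polynomial.eval_C, Polynomial.eval_X, linPoly, coe_basePt, map_div₀,
      map_add, map_intCast, Complex.conj_I, map_natCast,
      Nat.add_sub_cancel_left, Polynomial.eval_natCast, Polynomial.eval_intCast]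
    push_cast
    have e2 : (x : ℂ) - (-(d : ℂ) + Complex.I) / ((c : ℕ) : ℂ) =
        (((c : ℕ) : ℂ) * x + d - Complex.I) / ((c : ℕ) : ℂ) := by field_simp; ring
    have e3 : (x : ℂ) - (-(d : ℂ) + -Complex.I) / ((c : ℕ) : ℂ) =
        (((c : ℕ) : ℂ) * x + d + Complex.I) / ((c : ℕ) : ℂ) := by field_simp; ring
    rw [e2, e3, div_pow, div_pow, pow_add]
    field_simp
  rw [e1, Polynomial.comp, Polynomial.eval₂_eq_sum_range' _ (Nat.lt_succ_of_le hdeg), Finset.mul_sum]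
  refine Finset.sum_congr rfl fun m _ => ?_
  rw [Polynomial.C_mul, mul_assoc]
  rfl

/-- The integer exponent `m - t` permits `t > m`, where the binomial coefficient vanishes; it can
then be merged with the weights of a pair sum without case distinction. -/
lemma coeff_linPoly_pow (a b : ℂ) (m t : ℕ) :
    (linPoly a b ^ m).coeff t = (m.choose t : ℂ) * a ^ t * b ^ ((m : ℤ) - t) := by
  have e : ∀ l ∈ Finset.range (m + 1), ((Polynomial.C a * Polynomial.X) ^ l * Polynomial.C b ^ (m - l) *
      ((m.choose l : ℕ) : Polynomial ℂ)).coeff t =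
        if t = l then (m.choose t : ℂ) * a ^ t * b ^ ((m : ℤ) - t) else 0 := by
    intro l hl
    have hl' : l ≤ m := Nat.lt_succ_iff.1 (Finset.mem_range.1 hl)
    have e1 : (Polynomial.C a * Polynomial.X) ^ l * Polynomial.C b ^ (m - l) *
        ((m.choose l : ℕ) : Polynomial ℂ) =
        Polynomial.C ((m.choose l : ℂ) * a ^ l * b ^ (m - l)) * Polynomial.X ^ l := by
      simp only [Polynomial.C_mul, Polynomial.C_pow, map_natCast, mul_pow]
      ring
    rw [e1, Polynomial.coeff_C_mul, Polynomial.coeff_X_pow]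
    split_ifs with h
    · rw [h, mul_one, ← zpow_natCast b, Nat.cast_sub hl']
    · rw [mul_zero]
  rw [linPoly, add_pow, Polynomial.finsetSum_coeff, Finset.sum_congr rfl e, Finset.sum_ite_eq]
  split_ifs with h
  · rfl
  · rw [Nat.choose_eq_zero_of_lt (by simpa using h)]
    simp

/-- The substitution `X = (z - z̄ u)/(1 - u)` sends `c X + d` to `((c z + d) - (c z̄ + d) u)/(1 -
u)`, and the coefficient of `u ^ i` is a convolution. -/
lemma expCoeff_linPoly_pow {n m i : ℕ} (hm : m ≤ n) (c d : ℂ) (z : ℍ) :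
    expCoeff n (linPoly c d ^ m) i z = ((z : ℂ) - conj (z : ℂ)) ^ (-(n : ℤ)) *
      ∑ t ∈ Finset.HasAntidiagonal.antidiagonal i, (linPoly (-(c * conj (z : ℂ) + d)) (c * z + d) ^ m).coeff t.1 *
        (linPoly (-1) 1 ^ (n - m)).coeff t.2 := by
  rw [expCoeff, ← Polynomial.coeff_mul]
  congr 2
  refine Polynomial.eq_of_infinite_eval_eq _ _
    (Set.Infinite.mono ?_ (Set.finite_singleton (1 : ℂ)).infinite_compl)
  intro u hu
  have hu' : -1 * u + 1 ≠ 0 := by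
    intro h0
    exact hu (by rw [Set.mem_singleton_iff]; linear_combination -h0)
  change Polynomial.eval _ _ = Polynomial.eval _ _
  rw [homSubst_eval n _ _ _ _ _ (linPoly_pow_natDegree hm c d) hu']
  obtain ⟨l, rfl⟩ := Nat.exists_eq_add_of_le hm
  simp only [linPoly, Polynomial.eval_mul, Polynomial.eval_pow, Polynomial.eval_add,
    Polynomial.eval_C, Polynomial.eval_X, Nat.add_sub_cancel_left]
  rw [pow_add, mul_right_comm, ← mul_pow]
  congr 2
  generalize hv : -1 * u + 1 = v at hu' ⊢
  field_simp
  rw [← hv]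
  ring

section

variable {k : ℕ} (f : CuspForm 𝒮ℒ (k : ℤ))

/-- The coefficient of `(c X + d) ^ m` in the period polynomial of a matrix with bottom row
`(c, d)`; it is zero if `c` and `d` are not coprime. -/
def periodCoeff (m : ℕ) (c : ℕ+) (d : ℤ) : ℂ :=
  if IsCoprime ((c : ℕ) : ℤ) d then
    (((c : ℕ) : ℂ) ^ (k - 2))⁻¹ * ∑ a ∈ Finset.range (k - 2 + 1), lamCoeff (k - 2) a m *
      (seed f a (basePt c (rowLift (c, d) 0 0)) *
        (Complex.I ^ (-(a : ℤ)) * (-Complex.I) ^ (-(((k - 2 : ℕ) : ℤ) - a))) -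
          seed f a (basePt c (-d)))
  else 0

lemma periodPoly_rowLift (hk : 2 ≤ k) {c : ℕ+} {d : ℤ} (h : IsCoprime ((c : ℕ) : ℤ) d) (z : ℍ) :
    periodPoly f (rowLift (c, d)) z = ∑ m ∈ Finset.range (k - 2 + 1),
      Polynomial.C (periodCoeff f m c d) * linPoly (c : ℕ) d ^ m := by
  have hr := rowLift_spec (p := (c, d)) h
  have e : ∀ a ∈ Finset.range (k - 2 + 1), ∀ x : ℂ,
      Polynomial.C x * expBasis (k - 2) a (basePt c (-d)) = ∑ m ∈ Finset.range (k - 2 + 1),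
        Polynomial.C ((((c : ℕ) : ℂ) ^ (k - 2))⁻¹ * (lamCoeff (k - 2) a m * x)) *
          linPoly (c : ℕ) d ^ m := fun a ha x => by
    rw [expBasis_basePt (Nat.lt_succ_iff.1 (Finset.mem_range.1 ha)), Finset.mul_sum]
    refine Finset.sum_congr rfl fun m _ => ?_
    simp only [Polynomial.C_mul]
    ring
  rw [periodPoly_eq f hk _ z (basePt c (-d)), periodPoly_eq_sum f hk,
    Finset.sum_congr rfl fun a ha => e a ha _, Finset.sum_comm]
  refine Finset.sum_congr rfl fun m _ => ?_
  rw [← Finset.sum_mul, ← map_sum Polynomial.C, periodCoeff, if_pos h, ← Finset.mul_sum]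
  congr 3
  refine Finset.sum_congr rfl fun a _ => ?_
  rw [poincareTerm, smul_basePt hr.1 hr.2, autj_conj, autj_basePt hr.1 hr.2, Complex.conj_I]

lemma seed_basePt_eq (hk : 2 ≤ k) {a : ℕ} (ha : a ≤ k - 2) (c : ℕ+) {d d' : ℤ}
    (h : ((c : ℕ) : ℤ) ∣ d' - d) : seed f a (basePt c d') = seed f a (basePt c d) := by
  obtain ⟨l, hl⟩ := h
  refine seed_eq_of_vadd f hk ha l ?_
  have := pnat_ne_zero c
  rw [coe_basePt, coe_basePt, show d' = d + (c : ℕ) * l by linarith]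
  push_cast
  field_simp
  ring

lemma periodCoeff_periodic (hk : 2 ≤ k) (m : ℕ) (c : ℕ+) (d l : ℤ) :
    periodCoeff f m c (l * (c : ℕ) + d) = periodCoeff f m c d := by
  have hiff : IsCoprime ((c : ℕ) : ℤ) (l * (c : ℕ) + d) ↔ IsCoprime ((c : ℕ) : ℤ) d := by
    rw [add_comm]
    exact IsCoprime.add_mul_right_right_iff
  by_cases h : IsCoprime ((c : ℕ) : ℤ) d
  · have h' := hiff.2 h
    rw [periodCoeff, periodCoeff, if_pos h, if_pos h']
    congr 1
    have hr := rowLift_spec (p := (c, d)) h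
    have hr' := rowLift_spec (p := (c, l * (c : ℕ) + d)) h'
    have hd := (rowLift (c, d)).det_coe
    have hd' := (rowLift (c, l * (c : ℕ) + d)).det_coe
    rw [Matrix.det_fin_two, hr.1, hr.2] at hd
    rw [Matrix.det_fin_two, hr'.1, hr'.2] at hd'
    -- The upper left entry is inverse to `d` modulo `c`, so its class depends only on that of `d`,
    -- whatever lifts are chosen.
    have hdvd : ((c : ℕ) : ℤ) ∣ rowLift (c, l * (c : ℕ) + d) 0 0 - rowLift (c, d) 0 0 := by
      refine h.dvd_of_dvd_mul_right (Dvd.intro (rowLift (c, l * (c : ℕ) + d) 0 1 -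
        rowLift (c, d) 0 1 - l * rowLift (c, l * (c : ℕ) + d) 0 0) ?_)
      linear_combination hd - hd'
    refine Finset.sum_congr rfl fun a ha => ?_
    have ha' := Nat.lt_succ_iff.1 (Finset.mem_range.1 ha)
    rw [seed_basePt_eq f hk ha' c hdvd,
      seed_basePt_eq f hk ha' c (d := -d) (d' := -(l * (c : ℕ) + d)) ⟨-l, by ring⟩]
  · rw [periodCoeff, periodCoeff, if_neg h, if_neg (mt hiff.1 h)]

/-- At height `1/c` the seed is `O(c ^ (n + 1/2))`, relaxed here to `c ^ (n + 1)`; the prefactor `c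
^ (-n)` leaves `O(c)`. -/
lemma exists_periodCoeff_bound (hk : 2 ≤ k) (m : ℕ) :
    ∃ C : ℝ, ∀ c d, ‖periodCoeff f m c d‖ ≤ C * (c : ℕ) := by
  obtain ⟨C, hC0, hC⟩ := exists_seed_bound f hk
  set n := k - 2 with hn
  refine ⟨∑ a ∈ Finset.range (n + 1), ‖lamCoeff n a m‖ * (2 * C), fun c d => ?_⟩
  have hc : 0 < ((c : ℕ) : ℝ) := by exact_mod_cast c.pos
  have hc1 : 1 ≤ ((c : ℕ) : ℝ) := by exact_mod_cast one_le
  rw [periodCoeff, ← hn]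
  split_ifs with h
  · have e : ∀ a ≤ n, ∀ b : ℤ, ‖seed f a (basePt c b)‖ ≤ C * (((c : ℕ) : ℝ) ^ n * (c : ℕ)) := by
      intro a ha b
      refine (hC a ha _).trans (mul_le_mul_of_nonneg_left ?_ hC0)
      rw [im_basePt, Real.inv_rpow hc.le, ← Real.rpow_neg hc.le, ← pow_succ, ← Real.rpow_natCast]
      refine Real.rpow_le_rpow_of_exponent_le hc1 ?_
      push_cast
      linarith
    rw [norm_mul, norm_inv, norm_pow, Complex.norm_natCast, inv_mul_le_iff₀ (by positivity),
      Finset.sum_mul, Finset.mul_sum]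
    refine (norm_sum_le _ _).trans (Finset.sum_le_sum fun a ha => ?_)
    have ha' := Nat.lt_succ_iff.1 (Finset.mem_range.1 ha)
    rw [norm_mul, show ((c : ℕ) : ℝ) ^ n * (‖lamCoeff n a m‖ * (2 * C) * (c : ℕ)) =
      ‖lamCoeff n a m‖ * (C * (((c : ℕ) : ℝ) ^ n * (c : ℕ)) + C * (((c : ℕ) : ℝ) ^ n * (c : ℕ))) by
        ring]
    refine mul_le_mul_of_nonneg_left ((norm_sub_le _ _).trans (add_le_add ?_ (e a ha' _)))
      (norm_nonneg _)
    rw [norm_mul, norm_mul, norm_zpow, norm_zpow, norm_neg, Complex.norm_I, one_zpow, one_zpow,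
      mul_one, mul_one]
    exact e a ha' _
  · rw [norm_zero]
    positivity

end

/-! ### The series `φ^±` have mixed expansions -/

/-- The indicator function of the coprime pairs. -/
def coprimeInd (c : ℕ+) (d : ℤ) : ℂ := if IsCoprime ((c : ℕ) : ℤ) d then 1 else 0

lemma coprimeInd_periodic (c : ℕ+) (d l : ℤ) : coprimeInd c (l * (c : ℕ) + d) = coprimeInd c d := by
  have hiff : IsCoprime ((c : ℕ) : ℤ) (l * (c : ℕ) + d) ↔ IsCoprime ((c : ℕ) : ℤ) d := by
    rw [add_comm]
    exact IsCoprime.add_mul_right_right_iff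
  simp only [coprimeInd, hiff]

lemma norm_coprimeInd_le (c : ℕ+) (d : ℤ) : ‖coprimeInd c d‖ ≤ 1 * (c : ℕ) := by
  have hc1 : 1 ≤ ((c : ℕ) : ℝ) := by exact_mod_cast one_le
  rw [coprimeInd]
  split_ifs
  · simpa using hc1
  · simp

section

variable {k : ℕ} (f : CuspForm 𝒮ℒ (k : ℤ))

/-- The numerical coefficients in the expansion of `(c X + d) ^ m`. -/
def binomCoeff (n m : ℕ) (t : ℕ × ℕ) : ℂ :=
  (m.choose t.1 : ℂ) * (-1) ^ t.1 * (linPoly (-1) 1 ^ (n - m)).coeff t.2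

/-- The cocycle relation splits the term into the seed at `z` and the period polynomial. Expanding
`(c X + d) ^ m` then separates the arithmetic of `(c, d)` from `z`: only powers of `c z + d` and `c
z̄ + d` remain inside the sum. -/
lemma poincareTerm_rowLift (hk : 2 ≤ k) (r s : ℤ) {i : ℕ} (hi : i ≤ k - 2) (z : ℍ) (p : ℕ+ × ℤ) :
    (if IsCoprime ((p.1 : ℕ) : ℤ) p.2 then
      poincareTerm (seed f i) (r + i) (s + (k - 2 : ℕ) - i) (rowLift p) z else 0) =
    seed f i z * pairTerm coprimeInd r s z p + ∑ m ∈ Finset.range (k - 2 + 1),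
      ∑ t ∈ Finset.HasAntidiagonal.antidiagonal i,
        ((z : ℂ) - conj (z : ℂ)) ^ (-((k - 2 : ℕ) : ℤ)) * binomCoeff (k - 2) m t *
          pairTerm (periodCoeff f m) (r - m + t.1) (s - t.1) z p := by
  obtain ⟨c, d⟩ := p
  by_cases h : IsCoprime ((c : ℕ) : ℤ) d
  · have hr := rowLift_spec (p := (c, d)) h
    have ha := autj_ne_zero (rowLift (c, d)) z
    have hb := autj_conj_ne_zero (rowLift (c, d)) z
    have ea : autj (rowLift (c, d)) z = ((c : ℕ) : ℂ) * z + d := by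
      rw [autj, hr.1, hr.2, Int.cast_natCast]
    have eb : autj (rowLift (c, d)) (conj (z : ℂ)) = ((c : ℕ) : ℂ) * conj (z : ℂ) + d := by
      rw [autj, hr.1, hr.2, Int.cast_natCast]
    have e1 : poincareTerm (seed f i) (r + i) (s + (k - 2 : ℕ) - i) (rowLift (c, d)) z =
        (autj (rowLift (c, d)) z ^ (-r) * autj (rowLift (c, d)) (conj (z : ℂ)) ^ (-s)) *
          poincareTerm (seed f i) i ((k - 2 : ℕ) - i) (rowLift (c, d)) z := by
      rw [poincareTerm, poincareTerm, show -(r + (i : ℤ)) = -r + -i by ring,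
        show -(s + ((k - 2 : ℕ) : ℤ) - i) = -s + -(((k - 2 : ℕ) : ℤ) - i) by ring, zpow_add₀ ha,
        zpow_add₀ hb]
      ring
    have hdeg : ∀ m ∈ Finset.range (k - 2 + 1),
        (linPoly ((c : ℕ) : ℂ) d ^ m).natDegree ≤ k - 2 := fun m hm =>
      linPoly_pow_natDegree (Nat.lt_succ_iff.1 (Finset.mem_range.1 hm)) _ _
    have e2 : expCoeff (k - 2) (periodPoly f (rowLift (c, d)) z) i z =
        ∑ m ∈ Finset.range (k - 2 + 1), periodCoeff f m c d *
          expCoeff (k - 2) (linPoly ((c : ℕ) : ℂ) d ^ m) i z := by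
      refine expCoeff_unique' (k - 2) z (fun i => ∑ m ∈ Finset.range (k - 2 + 1),
        periodCoeff f m c d * expCoeff (k - 2) (linPoly ((c : ℕ) : ℂ) d ^ m) i z) ?_ hi
      rw [periodPoly_rowLift f hk h]
      simp only [map_sum, Finset.sum_mul]
      rw [Finset.sum_comm]
      refine Finset.sum_congr rfl fun m hm => ?_
      conv_lhs => rw [expCoeff_expansion' (k - 2) (hdeg m hm) z, Finset.mul_sum]
      refine Finset.sum_congr rfl fun j _ => ?_
      rw [Polynomial.C_mul, mul_assoc]
    rw [if_pos h, e1, poincareTerm_seed_eq f hk _ _ hi, e2, mul_add, Finset.mul_sum]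
    congr 1
    · rw [pairTerm, coprimeInd, if_pos h, ea, eb]
      ring
    · refine Finset.sum_congr rfl fun m hm => ?_
      rw [expCoeff_linPoly_pow (Nat.lt_succ_iff.1 (Finset.mem_range.1 hm)), Finset.mul_sum,
        Finset.mul_sum, Finset.mul_sum]
      refine Finset.sum_congr rfl fun t _ => ?_
      rw [pairTerm, binomCoeff, coeff_linPoly_pow, ← ea, ← eb, neg_pow,
        show -(r - (m : ℤ) + t.1) = -r + ((m : ℤ) - t.1) by ring,
        show -(s - (t.1 : ℤ)) = -s + t.1 by ring, zpow_add₀ ha, zpow_add₀ hb, zpow_natCast]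
      ring
  · rw [if_neg h]
    simp [pairTerm, coprimeInd, periodCoeff, h]

lemma phiCoeff_mem_mixedForms (hk : 2 ≤ k) (hke : Even k) {r s : ℤ} (hrs : Even (r + s))
    (h : ((k - 2 : ℕ) : ℤ) + 4 ≤ r + s) {i : ℕ} (hi : i ≤ k - 2) :
    phiCoeff k r s (eichlerPlus f) i ∈ mixedForms (r + i) (s + (k - 2 : ℕ) - i) := by
  obtain ⟨C, -, hC⟩ := exists_seed_bound f hk
  have hper : ∀ (z z' : ℍ) (l : ℤ), (z' : ℂ) = z + l → seed f i z' = seed f i z := fun z z' l h =>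
    seed_eq_of_vadd f hk hi l h
  have hev : Even ((r + (i : ℤ)) + (s + (k - 2 : ℕ) - i)) := by
    rw [show (r + (i : ℤ)) + (s + (k - 2 : ℕ) - i) = (r + s) + ((k - 2 : ℕ) : ℤ) by ring]
    exact hrs.add (by exact_mod_cast hke.tsub even_two)
  rw [phiCoeff_eq_poincare (eichlerPlus_natDegree f hk) hC h hk hi]
  refine ⟨?_, poincare_hasWeight hper hev⟩
  choose D hD using exists_periodCoeff_bound f hk
  -- The total weight is `r + s - m` with `m ≤ k - 2`; this is where the full strength of `r + s ≥
  -- (k - 2) + 4` is needed for the expansion.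
  have h4 : ∀ m ∈ Finset.range (k - 2 + 1), ∀ t : ℕ, 4 ≤ (r - m + t) + (s - t) := fun m hm t => by
    have := Finset.mem_range.1 hm
    omega
  have e : poincare (seed f i) (r + i) (s + (k - 2 : ℕ) - i) = fun z => seed f i z +
      (seed f i z * (∑' p, pairTerm coprimeInd r s z p) + ∑ m ∈ Finset.range (k - 2 + 1),
        ∑ t ∈ Finset.HasAntidiagonal.antidiagonal i,
          ((z : ℂ) - conj (z : ℂ)) ^ (-((k - 2 : ℕ) : ℤ)) * binomCoeff (k - 2) m t *
            ∑' p, pairTerm (periodCoeff f m) (r - m + t.1) (s - t.1) z p) := by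
    funext z
    have hs1 := summable_pairTerm norm_coprimeInd_le (r := r) (s := s) (by omega) z
    have hs2 : ∀ m ∈ Finset.range (k - 2 + 1), ∀ t : ℕ × ℕ, Summable fun p =>
        ((z : ℂ) - conj (z : ℂ)) ^ (-((k - 2 : ℕ) : ℤ)) * binomCoeff (k - 2) m t *
          pairTerm (periodCoeff f m) (r - m + t.1) (s - t.1) z p := fun m hm t =>
      (summable_pairTerm (hD m) (h4 m hm t.1) z).mul_left _
    rw [poincare_eq_pairSum hper hev z (summable_expCoeff hC h hi z)]
    simp only [poincareTerm_rowLift f hk r s hi z]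
    rw [(hs1.mul_left _).tsum_add (summable_sum fun m hm => summable_sum fun t _ => hs2 m hm t),
      tsum_mul_left, Summable.tsum_finsetSum fun m hm => summable_sum fun t _ => hs2 m hm t]
    congr 2
    refine Finset.sum_congr rfl fun m hm => ?_
    rw [Summable.tsum_finsetSum fun t _ => hs2 m hm t]
    simp only [tsum_mul_left]
  have hseed := seed_mem_mixed f hk hi
  change poincare (seed f i) _ _ ∈ mixed
  rw [e]
  refine mixed_add hseed (mixed_add (mixed_mul hseed (pureMixed_le_mixed
    (pairSum_mem coprimeInd_periodic norm_coprimeInd_le (by omega))))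
    (mixed_sum _ fun m hm => mixed_sum _ fun t _ => mixed_mul (mixed_mul ?_ (mixed_const _))
      (pureMixed_le_mixed (pairSum_mem (periodCoeff_periodic f hk m) (hD m) (h4 m hm t.1)))))
  simp only [sub_conj_eq, mul_zpow]
  exact mixed_mul (mixed_const _) (mixed_zpow _)

lemma eichlerMinus_natDegree (hk : 2 ≤ k) (z : ℍ) : (eichlerMinus f z).natDegree ≤ k - 2 :=
  (Polynomial.natDegree_map_le).trans (eichlerPlus_natDegree f hk z)

lemma expCoeff_eichlerMinus (hk : 2 ≤ k) {i : ℕ} (hi : i ≤ k - 2) (z : ℍ) :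
    expCoeff (k - 2) (eichlerMinus f z) i z = conj (seed f (k - 2 - i) z) :=
  expCoeff_map_conj (k - 2) (eichlerPlus_natDegree f hk z) z hi

lemma exists_eichlerMinus_bound (hk : 2 ≤ k) : ∃ C : ℝ, ∀ i ≤ k - 2, ∀ z : ℍ,
    ‖expCoeff (k - 2) (eichlerMinus f z) i z‖ ≤ C * z.im ^ (-((k - 2 : ℕ) : ℝ) - 1 / 2) := by
  obtain ⟨C, -, hC⟩ := exists_seed_bound f hk
  refine ⟨C, fun i hi z => ?_⟩
  rw [expCoeff_eichlerMinus f hk hi, RCLike.norm_conj]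
  exact hC _ (Nat.sub_le _ _) z

/-- Conjugation swaps `r` with `s` and `i` with `k - 2 - i`, which interchanges the two weights of
the Poincaré series. -/
lemma phiCoeff_eichlerMinus (hk : 2 ≤ k) {r s : ℤ} (h : ((k - 2 : ℕ) : ℤ) + 4 ≤ r + s) {i : ℕ}
    (hi : i ≤ k - 2) : phiCoeff k r s (eichlerMinus f) i =
      fun z => conj (phiCoeff k s r (eichlerPlus f) (k - 2 - i) z) := by
  obtain ⟨C, -, hC⟩ := exists_seed_bound f hk
  obtain ⟨C', hC'⟩ := exists_eichlerMinus_bound f hk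
  rw [phiCoeff_eq_poincare (eichlerMinus_natDegree f hk) hC' h hk hi,
    phiCoeff_eq_poincare (eichlerPlus_natDegree f hk) hC (by omega) hk (Nat.sub_le _ _),
    ← poincare_conj]
  simp only [expCoeff_eichlerMinus f hk hi]
  congr 1 <;> omega

end

end ModIter

end

theorem mainTheorem2 :
    (∀ (k : ℕ), 12 ≤ k → Even k → ∀ (f : CuspForm 𝒮ℒ (k : ℤ)) (r s : ℤ),
      Even (r + s) → (k : ℤ) < r + s → ∀ (z : ℍ) (m : ℕ),
        Summable (fun γ : ModIter.CosetB =>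
          (ModIter.slash k r s (ModIter.eichlerPlus f) γ.out z).coeff m) ∧
        Summable (fun γ : ModIter.CosetB =>
          (ModIter.slash k r s (ModIter.eichlerMinus f) γ.out z).coeff m)) ∧
    ModIter.spaceA ≤ ModIter.extMI := by
  -- Parity sharpens `r + s > k` to `r + s ≥ k + 2`, the bound that both convergence and the
  -- expansion use.
  have aux : ∀ (k : ℕ) (r s : ℤ), 12 ≤ k → Even k → Even (r + s) → (k : ℤ) < r + s →
      ((k - 2 : ℕ) : ℤ) + 4 ≤ r + s := by
    intro k r s hk hke hrs h
    obtain ⟨a, rfl⟩ := hke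
    obtain ⟨b, hb⟩ := hrs
    omega
  constructor
  · intro k hk hke f r s hrs h z m
    have hk2 : 2 ≤ k := by omega
    obtain ⟨C, -, hC⟩ := ModIter.exists_seed_bound f hk2
    obtain ⟨C', hC'⟩ := ModIter.exists_eichlerMinus_bound f hk2
    exact ⟨ModIter.summable_slash_coeff (ModIter.eichlerPlus_natDegree f hk2) hC
        (aux k r s hk hke hrs h) z m,
      ModIter.summable_slash_coeff (ModIter.eichlerMinus_natDegree f hk2) hC'
        (aux k r s hk hke hrs h) z m⟩
  -- By maximality it is enough to place each generator in the admissible space `gradedMixed`.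
  · refine le_trans ?_ (ModIter.isGreatest_extMI.2 ModIter.gradedMixed_admissible)
    refine Submodule.span_le.2 ?_
    rintro _ ⟨k, hk, hke, f, r, s, hrs, h, i, hi, F, rfl | rfl, rfl⟩
    · have hmem := ModIter.phiCoeff_mem_mixedForms f (by omega) hke hrs (aux k r s hk hke hrs h) hi
      rw [show s + ((k - 2 : ℕ) : ℤ) - i = s + k - 2 - i by omega] at hmem
      exact ModIter.single_mem_gradedMixed hmem
    · have h4 := aux k r s hk hke hrs h
      have hmem := ModIter.mixedForms_conj (ModIter.phiCoeff_mem_mixedForms f (r := s) (s := r)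
        (by omega) hke (by rwa [add_comm]) (by omega) (Nat.sub_le (k - 2) i))
      rw [← ModIter.phiCoeff_eichlerMinus f (by omega) h4 hi,
        show r + ((k - 2 : ℕ) : ℤ) - ((k - 2 - i : ℕ) : ℤ) = r + i by omega,
        show s + ((k - 2 - i : ℕ) : ℤ) = s + k - 2 - i by omega] at hmem
      exact ModIter.single_mem_gradedMixed hmem
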